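/- **Setting.** Let $X$ be a finite set of words of length $n$ over a finite alphabet, and let $P$ be the transition matrix of an irreducible, time-reversible Markov chain on $X$ with $P(x,x)\ge 1/2$ for all $x$ and stationary distribution $\pi$. Put $\langle f,g\rangle=\mathbb E_{x\sim\pi}[f(x)g(x)]$. Let $\lambda_1\ge\lambda_2\ge\dots\ge\lambda_{|X|}\ge 0$ be the eigenvalues of $P$ with multiplicity and $\nu_1,\nu_2,\dots$ corresponding eigenvectors, orthonormal for $\langle\cdot,\cdot\rangle$. $P$ has an *$(N,k,\gamma,c)$-discrete spectrum* ($k\ge1$, $0<\gamma<1$) with block ends $1\le i_1\le\dots\le i_k\le|X|$ if, with $i_0=0$: $\lambda_{i_j+1}\le\gamma\lambda_{i_j}$ for $1\le j\le k$ (when $i_j<|X|$); $i_j-i_{j-1}\le N$ for $1\le j\le k$; and $\lambda_{i_k}\ge\gamma^c$. A finite collection $\mathcal G$ of functions $X\to[-1,1]$ is *$\alpha$-useful* for it if for every $1\le j\le k$ there are $N_j=i_j-i_{j-1}$ functions $g_1,\dots,g_{N_j}\in\mathcal G$ such that the $N_j\times N_j$ matrix $A=(\langle g_m,\nu_\ell\rangle)_{m,\;i_{j-1}<\ell\le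 i_j}$ is invertible with $\|A^{-1}\|_{\mathrm{op}}\le\alpha$. Algorithms run on a real random access machine with unit cost per elementary operation and additional cost $n$ per operation that handles a point of $X$. They are given $n,N,k,\gamma,c,\alpha,|\mathcal G|,\varepsilon,\delta$, and have access to fair coins, to black boxes for the functions $g\in\mathcal G$, to the one-step oracle (which on input $x$ returns a sample of $P(x,\cdot)$), and to random examples $(x,L(x))$, where $x\sim\pi$ and $L:X\to\{-1,1\}$ is an arbitrary, possibly randomized, labelling function. The output hypothesis $h:X\to\{-1,1\}$ may be randomized and may use the one-step oracle and the black boxes, but no examples. **Theorem.** There is a single learning algorithm with the following property. Let $\varepsilon>0$ and $0<\delta<1$. Let $\mathcal F$ be a class of functions $X\to\{-1,1\}$, and let $\ell^*$ be such that $$\sum_{\ell>\ell^*}\langle f,\nu_\ell\rangle^2\le\frac{\varepsilon^2}{4}\qquad\text{for every } f\in\mathcal F .$$ Suppose that $P$ has an $(N,k,\gamma,c)$-discrete spectrum with $i_k\ge\ell^*$ and that $\mathcal G$ is $\alpha$-useful for it. Then, for every $L$, with probability at least $1-\delta$ the algorithm outputs a hypothesis $h$ with $$\Pr_{(x,y)}[h(x)\ne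 y]\le\min_{f\in\mathcal F}\Pr_{(x,y)}[f(x)\ne y]+\varepsilon ,$$ where $(x,y)=(x,L(x))$ with $x\sim\pi$. Furthermore, the running time, the sample complexity and the time required to evaluate $h$ at a point are bounded by a polynomial in $(\alpha Nk)^{(1+c)^{k+1}}$, $\varepsilon^{-(1+c)^k}$, $|\mathcal G|$, $n$, $1/(1-\gamma)$ and $1/\delta$. Hence, if $\alpha\le(Nk)^{O(1)}$ and $1/(1-\gamma)\le\mathrm{poly}(n)$, they are bounded by a polynomial in $(Nk)^{(1+c)^{k+1}}$, $\varepsilon^{-(1+c)^k}$, $|\mathcal G|$, $n$ and $1/\delta$. In particular, if $\varepsilon$ is a constant, $c$ and $k$ depend only on $\varepsilon$, $N\le n^{\zeta(k)}$ for an arbitrary function $\zeta$, and $\alpha$ and $1/(1-\gamma)$ are at most polynomial in $n$, then the algorithm runs in time polynomial in $n$, $|\mathcal G|$ and $1/\delta$. -/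

import Mathlib

open scoped BigOperators

namespace SpectralLearning

noncomputable section

/-! ## Lazy reversible Markov chains on a finite set and their spectrum -/

/-- The transition matrix of the chain whose one-step law from `x` is `P x`. -/
def transitionMatrix {X : Type} (P : X → PMF X) : Matrix X X ℝ :=
  Matrix.of fun x y => (P x y).toReal

/-- `P` is an irreducible, time-reversible chain with stationary distribution `π`, and it is lazy:
it stays where it is with probability at least `1/2`. -/
structure IsLazyReversibleChain {X : Type} (P : X → PMF X) (π : PMF X) : Prop where
  irreducible : ∀ x y : X, Relation.ReflTransGen (fun a b => P a b ≠ 0) x y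
  stationary : π.bind P = π
  reversible : ∀ x y : X, π x * P x y = π y * P y x
  lazy : ∀ x : X, 1 / 2 ≤ transitionMatrix P x x

/-- The inner product `⟨f, g⟩ = 𝔼_{x ∼ π} [f x * g x]`. -/
def ip {X : Type} [Fintype X] (π : PMF X) (f g : X → ℝ) : ℝ :=
  ∑ x, (π x).toReal * (f x * g x)

/-- `lam` lists the eigenvalues of `P` with multiplicity in non-increasing order, and `nu` is a
corresponding `π`-orthonormal family of right eigenvectors. The indices start at `0`, so `lam ℓ`
is the eigenvalue that is usually written `λ_{ℓ+1}`. -/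
structure IsSpectralBasis {X : Type} [Fintype X] (P : X → PMF X) (π : PMF X)
    (lam : Fin (Fintype.card X) → ℝ) (nu : Fin (Fintype.card X) → X → ℝ) : Prop where
  antitone : Antitone lam
  eigen : ∀ l, (transitionMatrix P).mulVec (nu l) = lam l • nu l
  orthonormal : ∀ l l', ip π (nu l) (nu l') = if l = l' then 1 else 0

/-- The `(N, k, γ, c)`-discrete spectrum condition for the eigenvalues `lam`, witnessed by the
block ends `1 ≤ i 1 ≤ ⋯ ≤ i k ≤ d`, with `i 0 = 0`. As indices start at `0`, the eigenvalue
`λ_{i j}` is `lam a` with `a + 1 = i j`, and `λ_{i j + 1}` is `lam b` with `b = i j`. -/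
structure IsDiscreteSpectrum {d : ℕ} (lam : Fin d → ℝ) (N k : ℕ) (γ c : ℝ) (i : ℕ → ℕ) :
    Prop where
  gamma_pos : 0 < γ
  gamma_lt_one : γ < 1
  one_le_k : 1 ≤ k
  start : i 0 = 0
  one_le_first : 1 ≤ i 1
  mono : ∀ j < k, i j ≤ i (j + 1)
  last_le : i k ≤ d
  gap : ∀ j, 1 ≤ j → j ≤ k → ∀ a b : Fin d, a.val + 1 = i j → b.val = i j → lam b ≤ γ * lam a
  block_size : ∀ j < k, i (j + 1) - i j ≤ N
  not_small : ∀ a : Fin d, a.val + 1 = i k → γ ^ c ≤ lam a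

/-- The indices of the block between the ends `i j` and `i (j + 1)`. -/
abbrev Block (d : ℕ) (i : ℕ → ℕ) (j : ℕ) : Type :=
  {l : Fin d // i j ≤ l.val ∧ l.val < i (j + 1)}

/-- The collection `g` of functions is `α`-useful for the blocks `i` of the eigenvectors `nu`: the
functions are bounded by `1`, and for each block there are as many members of the collection as
the block has elements such that the square matrix of Fourier coefficients is invertible with an
inverse of Euclidean operator norm at most `α`. -/
structure IsUseful {X : Type} [Fintype X] (π : PMF X) (nu : Fin (Fintype.card X) → X → ℝ)
    (k : ℕ) (i : ℕ → ℕ) {M : ℕ} (g : Fin M → X → ℝ) (α : ℝ) : Prop where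
  bounded : ∀ m x, |g m x| ≤ 1
  well_conditioned : ∀ j < k, ∃ e : Block (Fintype.card X) i j → Fin M,
    ∃ A : Matrix (Block (Fintype.card X) i j) (Block (Fintype.card X) i j) ℝ,
      (∀ r l, A r l = ip π (g (e r)) (nu l.val)) ∧
      IsUnit A.det ∧ ‖Matrix.toEuclideanCLM (𝕜 := ℝ) A⁻¹‖ ≤ α

/-! ## The machine model

A while-language over a real random access machine. A store has integer registers, an array of
real numbers and an array of points of the state space `X`; both arrays can be addressed
indirectly. Integers can be added and subtracted; reals can be added, subtracted, multiplied,
divided and compared (there is no rounding). Points are opaque: they can be copied, compared for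
equality, and handed to the oracles. Every elementary operation costs one unit, and every
operation that touches a point costs in addition the length `n` of the words that represent
points. Programs do not mention `X`, the chain or the functions. -/

/-- The store. A cell for points is empty (`none`) until it is written. -/
structure Store (X : Type) where
  nreg : ℕ → ℕ
  rmem : ℕ → ℝ
  pmem : ℕ → Option X

/-- Integer expressions; subtraction is truncated at `0`. -/
inductive NExp where
  | const (v : ℕ)
  | reg (r : ℕ)
  | add (a b : NExp)
  | sub (a b : NExp)

def NExp.eval {X : Type} (s : Store X) : NExp → ℕ
  | .const v => v
  | .reg r => s.nreg r
  | .add a b => a.eval s + b.eval s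
  | .sub a b => a.eval s - b.eval s

/-- The number of operations in an expression. -/
def NExp.size : NExp → ℕ
  | .const _ => 1
  | .reg _ => 1
  | .add a b => a.size + b.size + 1
  | .sub a b => a.size + b.size + 1

/-- Real expressions: `mem a` reads the cell with address `a`, and division by `0` gives `0`. -/
inductive RExp where
  | const (v : ℤ)
  | mem (a : NExp)
  | cast (a : NExp)
  | add (a b : RExp)
  | sub (a b : RExp)
  | mul (a b : RExp)
  | div (a b : RExp)

def RExp.eval {X : Type} (s : Store X) : RExp → ℝ
  | .const v => v
  | .mem a => s.rmem (a.eval s)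
  | .cast a => (a.eval s : ℝ)
  | .add a b => a.eval s + b.eval s
  | .sub a b => a.eval s - b.eval s
  | .mul a b => a.eval s * b.eval s
  | .div a b => a.eval s / b.eval s

def RExp.size : RExp → ℕ
  | .const _ => 1
  | .mem a => a.size + 1
  | .cast a => a.size + 1
  | .add a b => a.size + b.size + 1
  | .sub a b => a.size + b.size + 1
  | .mul a b => a.size + b.size + 1
  | .div a b => a.size + b.size + 1

/-- Tests: comparison of integers, comparison of reals, and equality of two cells for points. -/
inductive Test where
  | nlt (a b : NExp)
  | rlt (a b : RExp)
  | peq (a b : NExp)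

def Test.holds {X : Type} (s : Store X) : Test → Prop
  | .nlt a b => a.eval s < b.eval s
  | .rlt a b => a.eval s < b.eval s
  | .peq a b => s.pmem (a.eval s) = s.pmem (b.eval s)

/-- The cost of a test when points are words of length `n`. -/
def Test.cost (n : ℕ) : Test → ℕ
  | .nlt a b => a.size + b.size + 1
  | .rlt a b => a.size + b.size + 1
  | .peq a b => a.size + b.size + n + 1

/-- Commands.
* `nset r e`, `rset a e`, `pset a b`: assign to an integer register, to a real cell, to a cell for
  points (a copy of cell `b` into cell `a`);
* `walk a b`: one-step oracle, puts into cell `a` a random successor of the point in cell `b`;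
* `query a m b`: black-box access, puts the value of the `m`-th function at the point in cell `b`
  into the real cell `a`;
* `draw a b`: example oracle, puts the point of a fresh labelled example into cell `a` and its
  label into the real cell `b`;
* `coin r`: puts a fair random bit into register `r`. -/
inductive Cmd where
  | skip
  | nset (r : ℕ) (e : NExp)
  | rset (a : NExp) (e : RExp)
  | pset (a b : NExp)
  | walk (a b : NExp)
  | query (a m b : NExp)
  | draw (a b : NExp)
  | coin (r : ℕ)
  | seq (p q : Cmd)
  | ite (b : Test) (p q : Cmd)
  | loop (b : Test) (p : Cmd)

/-- What a program runs against: the word length of points, the one-step oracle, the black-box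
functions, and the law of the labelled examples. -/
structure Oracles (X : Type) where
  n : ℕ
  next : X → PMF X
  M : ℕ
  g : Fin M → X → ℝ
  labelled : PMF (X × ℤˣ)

/-- The value of the `m`-th black-box function on a cell for points; `0` if there is no such
function or if the cell is empty. -/
def Oracles.value {X : Type} (O : Oracles X) (m : ℕ) : Option X → ℝ
  | none => 0
  | some x => if h : m < O.M then O.g ⟨m, h⟩ x else 0

/-- The one-step oracle on a cell for points. -/
def Oracles.succ {X : Type} (O : Oracles X) : Option X → PMF (Option X)
  | none => PMF.pure none
  | some x => (O.next x).map some

/-- A configuration: the commands still to be executed, the store, the time spent so far and the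
number of examples drawn so far. -/
structure Config (X : Type) where
  todo : List Cmd
  store : Store X
  time : ℕ
  drawn : ℕ

open Classical in
/-- One step of the machine. A configuration with nothing left to do has halted and stays put. -/
def step {X : Type} (O : Oracles X) (C : Config X) : PMF (Config X) :=
  let s := C.store
  match C.todo with
  | [] => PMF.pure C
  | .skip :: K => PMF.pure { C with todo := K, time := C.time + 1 }
  | .nset r e :: K => PMF.pure { C with
      todo := K
      store := { s with nreg := Function.update s.nreg r (e.eval s) }
      time := C.time + e.size + 1 }
  | .rset a e :: K => PMF.pure { C with
      todo := K
      store := { s with rmem := Function.update s.rmem (a.eval s) (e.eval s) }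
      time := C.time + a.size + e.size + 1 }
  | .pset a b :: K => PMF.pure { C with
      todo := K
      store := { s with pmem := Function.update s.pmem (a.eval s) (s.pmem (b.eval s)) }
      time := C.time + a.size + b.size + O.n + 1 }
  | .walk a b :: K => (O.succ (s.pmem (b.eval s))).map fun x => { C with
      todo := K
      store := { s with pmem := Function.update s.pmem (a.eval s) x }
      time := C.time + a.size + b.size + O.n + 1 }
  | .query a m b :: K => PMF.pure { C with
      todo := K
      store := { s with rmem := Function.update s.rmem (a.eval s)
                                  (O.value (m.eval s) (s.pmem (b.eval s))) }
      time := C.time + a.size + m.size + b.size + O.n + 1 }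
  | .draw a b :: K => O.labelled.map fun z =>
      { todo := K
        store := { s with
          pmem := Function.update s.pmem (a.eval s) (some z.1)
          rmem := Function.update s.rmem (b.eval s) (((z.2 : ℤˣ) : ℤ) : ℝ) }
        time := C.time + a.size + b.size + O.n + 1
        drawn := C.drawn + 1 }
  | .coin r :: K => (PMF.uniformOfFintype (Fin 2)).map fun v => { C with
      todo := K
      store := { s with nreg := Function.update s.nreg r v.val }
      time := C.time + 1 }
  | .seq p q :: K => PMF.pure { C with todo := p :: q :: K, time := C.time + 1 }
  | .ite b p q :: K => PMF.pure { C with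
      todo := (if b.holds s then p else q) :: K
      time := C.time + b.cost O.n + 1 }
  | .loop b p :: K => PMF.pure { C with
      todo := if b.holds s then p :: .loop b p :: K else K
      time := C.time + b.cost O.n + 1 }

/-- The law of the configuration after a given number of steps. -/
def runFor {X : Type} (O : Oracles X) : ℕ → Config X → PMF (Config X)
  | 0, C => PMF.pure C
  | t + 1, C => (step O C).bind (runFor O t)

/-! ## Agnostic learning -/

/-- The probability of an event as a real number. -/
def prob {Ω : Type} (p : PMF Ω) (S : Set Ω) : ℝ := (p.toOuterMeasure S).toReal

/-- The numerical parameters: word length `n`, block size `N`, number of blocks `k`, number `M` of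
functions in the collection, spectral gap ratio `γ`, exponent `c`, conditioning `α`, accuracy `ε`
and confidence `δ`. -/
structure Params where
  n : ℕ
  N : ℕ
  k : ℕ
  M : ℕ
  γ : ℝ
  c : ℝ
  α : ℝ
  ε : ℝ
  δ : ℝ

/-- The range of the parameters. -/
structure Params.Valid (p : Params) : Prop where
  one_le_N : 1 ≤ p.N
  one_le_k : 1 ≤ p.k
  gamma_pos : 0 < p.γ
  gamma_lt_one : p.γ < 1
  c_nonneg : 0 ≤ p.c
  one_le_alpha : 1 ≤ p.α
  eps_pos : 0 < p.ε
  delta_pos : 0 < p.δ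
  delta_lt_one : p.δ < 1

/-- The initial store of the learner holds the parameters and is empty otherwise. -/
def initStore (X : Type) (p : Params) : Store X where
  nreg r := match r with
    | 0 => p.n
    | 1 => p.N
    | 2 => p.k
    | 3 => p.M
    | _ => 0
  rmem a := match a with
    | 0 => p.γ
    | 1 => p.c
    | 2 => p.α
    | 3 => p.ε
    | 4 => p.δ
    | _ => 0
  pmem _ := none

/-- A learning algorithm: a program that learns, and a program that evaluates hypotheses. The
hypothesis that the algorithm outputs is the content of the store when the first program halts,
read by the second program. -/
structure LearningAlgorithm where
  train : Cmd
  evaluate : Cmd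

/-- The initial configuration of the learner. -/
def LearningAlgorithm.trainStart (A : LearningAlgorithm) (X : Type) (p : Params) : Config X where
  todo := [A.train]
  store := initStore X p
  time := 0
  drawn := 0

/-- The initial configuration of the evaluation at the point `x` of the hypothesis stored in `s`:
the point is put into cell `0`. -/
def LearningAlgorithm.evalStart (A : LearningAlgorithm) {X : Type} (s : Store X) (x : X) :
    Config X where
  todo := [A.evaluate]
  store := { s with pmem := Function.update s.pmem 0 (some x) }
  time := 0
  drawn := 0

/-- The predicted label is read off register `0`. -/
def Store.label {X : Type} (s : Store X) : ℤˣ := if s.nreg 0 = 0 then -1 else 1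

/-- The law of a labelled example `(x, y)` with `x ∼ π` and `y = L x`, for a randomized labelling
function `L`. -/
def labelledLaw {X : Type} (π : PMF X) (L : X → PMF ℤˣ) : PMF (X × ℤˣ) :=
  π.bind fun x => (L x).map fun y => (x, y)

/-- The error `Pr_{(x, y) ∼ D} [f x ≠ y]` of a Boolean function. -/
def risk {X : Type} (D : PMF (X × ℤˣ)) (f : X → ℤˣ) : ℝ := prob D {z | f z.1 ≠ z.2}

/-- The error `Pr_{(x, y) ∼ D} [h x ≠ y]` of the hypothesis stored in `s`, evaluated for `T`
steps; the probability is over the example and the randomness of the evaluation. -/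
def LearningAlgorithm.hypRisk (A : LearningAlgorithm) {X : Type} (O : Oracles X) (T : ℕ)
    (s : Store X) : ℝ :=
  prob (O.labelled.bind fun z =>
      (runFor O T (A.evalStart s z.1)).map fun C => (C.store.label, z.2))
    {q | q.1 ≠ q.2}

/-- `A` agnostically learns the class `F` to error `ε` with confidence `1 - δ`, where running time,
number of examples and evaluation time are at most `T`: the learner always halts within time `T`
after at most `T` examples; the evaluation of its hypothesis at any point always halts within time
`T` and draws no examples; and with probability at least `1 - δ` the error of the hypothesis is
at most `opt + ε`, that is, at most the error of every `f ∈ F` plus `ε`. -/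
structure LearningAlgorithm.AgnosticallyLearnsWithin (A : LearningAlgorithm) {X : Type}
    (O : Oracles X) (F : Set (X → ℤˣ)) (p : Params) (T : ℕ) : Prop where
  efficient : ∀ C ∈ (runFor O T (A.trainStart X p)).support,
    C.todo = [] ∧ C.time ≤ T ∧ C.drawn ≤ T ∧
    ∀ x : X, ∀ C' ∈ (runFor O T (A.evalStart C.store x)).support,
      C'.todo = [] ∧ C'.time ≤ T ∧ C'.drawn = 0
  accurate : 1 - p.δ ≤ prob (runFor O T (A.trainStart X p))
    {C | ∀ f ∈ F, A.hypRisk O T C.store ≤ risk O.labelled f + p.ε}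

end

end SpectralLearning

open SpectralLearning

/-! The learner does regression with absolute loss over features that the one-step oracle makes
computable: the averages, over independent walks from `x`, of `g m` at the `t`-th point of the walk.
Such an average estimates `(P^t g m) x`, and `P^t` multiplies the `l`-th spectral coefficient by
`lam l ^ t`. The heart of the matter is that every function with a small spectral tail is close in
`L²(π)` to a combination of the functions `P^t g m` whose coefficients are not too large.

This combination is built block by block, from the smallest eigenvalues to the largest
(`exists_block_coeffs`, `exists_evolved_blocks`). By usefulness some combination of the `P^t g m`
agrees exactly on a block with the current residual. If the residual has norm at most `B` and `ν` is
the least eigenvalue of the block, the coefficients sum to at most `N α B / ν^t`. Beyond the block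
the eigenvalues are at most `γ ν`, so the spill there is at most `N α B γ^t`, whatever `ν` is; a
walk of logarithmic length makes it negligible. Blocks with larger eigenvalues are spoiled, but they
are treated later. Since `ν ≥ γ^c`, the price of a block is a factor of about `γ^(-c t)`, which
turns `B` into a constant times `B^(1+c)`. Iteration over `k` blocks gives a geometric sum of powers
of `1 + c`, hence the exponents of the theorem (`coeffBound_le_scale`).

Two degenerate regimes need care. If `c < 1`, a second nonempty block is impossible, because its
eigenvalues would be at most `γ < γ^c`. If `γ < 1/4`, rounding the walk length to an integer could
cost a factor `1/γ`; but then laziness forces the trace to be at least `|X| / 2` and hence `|X| ≤ 4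
N` (`card_le_of_small_ratio`), so indicators of memorized sample points serve as features instead.

The weights are found by projected stochastic subgradient descent in a box (`descent_excess`), where
the finite number of walks adds only a small noise (`feat_noise`). Rounding the prediction at a
random threshold turns absolute loss into half as much classification error (`rounding_error_le`),
and Markov's inequality gives the confidence (`trainModel_accurate`).

To speak about the machine, each program is coupled to a finite tree of random choices, of type
`Rnd`. The relation `Sim` records the coupling together with a time bound, and `learner_of_model`
reduces the claim to an expectation over such a tree. The running time is an explicit expression in
the constants, and `PolyBounded.resources` bounds it. -/

namespace SpectralLearning

noncomputable section

section

/-! ## Finite random computations -/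

/-- A computation that makes finitely many draws from finite sample spaces. -/
inductive Rnd (α : Type) : Type 1 where
  | ret (a : α) : Rnd α
  | samp {Ω : Type} (inst : Fintype Ω) (p : PMF Ω) (k : Ω → Rnd α) : Rnd α

namespace Rnd

variable {α β γ : Type}

/-- The expectation of `f` of the result. -/
def E : Rnd α → (α → ℝ) → ℝ
  | ret a, f => f a
  | samp inst p k, f => ∑ ω ∈ inst.elems, (p ω).toReal * (k ω).E f

/-- Every possible result has the property `Q`. -/
def All : Rnd α → (α → Prop) → Prop
  | ret a, Q => Q a
  | samp _ _ k, Q => ∀ ω, (k ω).All Q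

def bind : Rnd α → (α → Rnd β) → Rnd β
  | ret a, f => f a
  | samp inst p k, f => samp inst p fun ω => (k ω).bind f

def map (f : α → β) (m : Rnd α) : Rnd β := m.bind fun a => ret (f a)

/-- The law of the result. -/
def toPMF : Rnd α → PMF α
  | ret a => PMF.pure a
  | samp _ p k => p.bind fun ω => (k ω).toPMF

@[simp] theorem E_ret (a : α) (f : α → ℝ) : (ret a).E f = f a := rfl

theorem E_samp {Ω : Type} [inst : Fintype Ω] (p : PMF Ω) (k : Ω → Rnd α) (f : α → ℝ) :
    (samp inst p k).E f = ∑ ω, (p ω).toReal * (k ω).E f := rfl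

@[simp] theorem ret_bind (a : α) (f : α → Rnd β) : (ret a).bind f = f a := rfl

@[simp] theorem All_ret (a : α) (Q : α → Prop) : (ret a).All Q ↔ Q a := Iff.rfl

theorem bind_assoc (m : Rnd α) (f : α → Rnd β) (g : β → Rnd γ) :
    (m.bind f).bind g = m.bind fun a => (f a).bind g := by
  induction m with
  | ret a => rfl
  | samp inst p k ih => simp only [bind, ih]

@[simp] theorem E_bind (m : Rnd α) (f : α → Rnd β) (g : β → ℝ) :
    (m.bind f).E g = m.E fun a => (f a).E g := by
  induction m with
  | ret a => rfl
  | samp inst p k ih => simp only [bind, E, ih]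

@[simp] theorem E_map (m : Rnd α) (f : α → β) (g : β → ℝ) :
    (m.map f).E g = m.E fun a => g (f a) := by simp [map]

theorem All_bind {m : Rnd α} {f : α → Rnd β} {Q : β → Prop} :
    (m.bind f).All Q ↔ m.All fun a => (f a).All Q := by
  induction m with
  | ret a => rfl
  | samp inst p k ih => simp only [bind, All, ih]

theorem All.mono {m : Rnd α} {Q Q' : α → Prop} (h : m.All Q) (hQ : ∀ a, Q a → Q' a) :
    m.All Q' := by
  induction m with
  | ret a => exact hQ _ h
  | samp inst p k ih => exact fun ω => ih ω (h ω)

theorem all_true (m : Rnd α) {Q : α → Prop} (h : ∀ a, Q a) : m.All Q := by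
  induction m with
  | ret a => exact h a
  | samp inst p k ih => exact fun ω => ih ω

theorem sum_toReal {Ω : Type} [Fintype Ω] (p : PMF Ω) : ∑ ω, (p ω).toReal = 1 := by
  have h := p.tsum_coe
  rw [tsum_fintype] at h
  rw [← ENNReal.toReal_sum (fun a _ => p.apply_ne_top a), h]; simp

theorem E_add (m : Rnd α) (f g : α → ℝ) : (m.E fun a => f a + g a) = m.E f + m.E g := by
  induction m with
  | ret a => rfl
  | samp inst p k ih => simp only [E, ih, mul_add, Finset.sum_add_distrib]

theorem E_mul_left (m : Rnd α) (c : ℝ) (f : α → ℝ) : (m.E fun a => c * f a) = c * m.E f := by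
  induction m with
  | ret a => rfl
  | samp inst p k ih =>
    simp only [E, ih, Finset.mul_sum]
    exact Finset.sum_congr rfl fun _ _ => by ring

theorem E_sub (m : Rnd α) (f g : α → ℝ) : (m.E fun a => f a - g a) = m.E f - m.E g := by
  have := m.E_add f (fun a => (-1) * g a)
  rw [E_mul_left] at this
  rw [sub_eq_add_neg, ← neg_one_mul, ← this]
  congr 1; funext a; ring

@[simp] theorem E_const (m : Rnd α) (c : ℝ) : (m.E fun _ => c) = c := by
  induction m with
  | ret a => rfl
  | samp inst p k ih =>
    have : (samp inst p k).E (fun _ => c) = ∑ ω, (p ω).toReal * (k ω).E fun _ => c := rfl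
    rw [this]
    simp only [ih]
    rw [← Finset.sum_mul, sum_toReal, one_mul]

theorem E_mono_of_All {m : Rnd α} {f g : α → ℝ} (h : m.All fun a => f a ≤ g a) :
    m.E f ≤ m.E g := by
  induction m with
  | ret a => exact h
  | samp inst p k ih =>
    exact Finset.sum_le_sum fun ω _ => mul_le_mul_of_nonneg_left (ih ω (h ω)) ENNReal.toReal_nonneg

theorem E_mono (m : Rnd α) {f g : α → ℝ} (h : ∀ a, f a ≤ g a) : m.E f ≤ m.E g :=
  E_mono_of_All (m.all_true h)

theorem E_congr_of_All {m : Rnd α} {f g : α → ℝ} (h : m.All fun a => f a = g a) :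
    m.E f = m.E g :=
  le_antisymm (E_mono_of_All (h.mono fun _ h => h.le)) (E_mono_of_All (h.mono fun _ h => h.ge))

theorem E_nonneg (m : Rnd α) {f : α → ℝ} (h : ∀ a, 0 ≤ f a) : 0 ≤ m.E f := by
  simpa using m.E_mono (f := fun _ => 0) h

theorem E_sum {ι : Type*} (m : Rnd α) (s : Finset ι) (f : ι → α → ℝ) :
    (m.E fun a => ∑ i ∈ s, f i a) = ∑ i ∈ s, m.E (f i) := by
  classical
  induction s using Finset.induction_on with
  | empty => simp
  | insert i s hi ih => simp only [Finset.sum_insert hi, E_add, ih]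

theorem toPMF_bind (m : Rnd α) (f : α → Rnd β) :
    (m.bind f).toPMF = m.toPMF.bind fun a => (f a).toPMF := by
  induction m with
  | ret a => simp [bind, toPMF]
  | samp inst p k ih => simp only [bind, toPMF, ih, PMF.bind_bind]

/-- `All` also covers branches of probability zero, so it is stronger than a statement about the
support. -/
theorem All.of_mem_support {m : Rnd α} {Q : α → Prop} (h : m.All Q) {a : α}
    (ha : a ∈ m.toPMF.support) : Q a := by
  induction m with
  | ret b =>
    simp only [toPMF, PMF.support_pure, Set.mem_singleton_iff] at ha
    subst ha; exact h
  | samp inst p k ih =>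
    simp only [toPMF, PMF.mem_support_bind_iff] at ha
    obtain ⟨ω, _, hω⟩ := ha
    exact ih ω (h ω) hω

open Classical in
theorem prob_toPMF_eq (m : Rnd α) (S : Set α) :
    prob m.toPMF S = m.E fun a => if a ∈ S then 1 else 0 := by
  induction m with
  | ret a =>
    simp only [prob, toPMF, E_ret, PMF.toOuterMeasure_pure_apply]
    split_ifs <;> simp
  | samp inst p k ih =>
    have hE : ∀ f, (samp inst p k).E f = ∑ ω, (p ω).toReal * (k ω).E f := fun _ => rfl
    rw [hE]
    simp only [← ih]
    simp only [prob, toPMF, PMF.toOuterMeasure_bind_apply]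
    rw [tsum_fintype, ENNReal.toReal_sum]
    · simp only [ENNReal.toReal_mul]
    · intro ω _
      refine ENNReal.mul_ne_top (p.apply_ne_top _) (ne_top_of_le_ne_top ENNReal.one_ne_top ?_)
      exact ((k ω).toPMF.toOuterMeasure.mono (Set.subset_univ S)).trans
        ((PMF.toOuterMeasure_apply_eq_one_iff _ _).2 (Set.subset_univ _)).le

/-- Run `f 0`, …, `f (n - 1)` in turn on a state. -/
def iter (f : ℕ → α → Rnd α) : ℕ → α → Rnd α
  | 0, a => ret a
  | n + 1, a => (iter f n a).bind (f n)

@[simp] theorem iter_zero (f : ℕ → α → Rnd α) (a : α) : iter f 0 a = ret a := rfl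

theorem iter_succ (f : ℕ → α → Rnd α) (n : ℕ) (a : α) :
    iter f (n + 1) a = (iter f n a).bind (f n) := rfl

/-- `iter` splits off the last round, whereas the loop of the machine splits off the first one. -/
theorem iter_succ' (f : ℕ → α → Rnd α) (n : ℕ) (a : α) :
    iter f (n + 1) a = (f 0 a).bind (iter (fun i => f (i + 1)) n) := by
  induction n with
  | zero =>
    simp only [iter, ret_bind]
    induction f 0 a with
    | ret b => rfl
    | samp inst p k ih => simp only [bind]; congr 1; funext ω; exact ih ω
  | succ n ih => rw [iter_succ, ih, bind_assoc]; rfl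

theorem iter_all {f : ℕ → α → Rnd α} {Q : ℕ → α → Prop}
    (hf : ∀ i a, Q i a → (f i a).All (Q (i + 1))) {a : α} (ha : Q 0 a) (n : ℕ) :
    (iter f n a).All (Q n) := by
  induction n with
  | zero => exact ha
  | succ n ih => rw [iter_succ, All_bind]; exact ih.mono fun a h => hf n a h

/-- Additive drift: a potential that grows in expectation by at most `c` per round grows by at most
`n * c` in `n` rounds. It yields both the regret of the descent and the variance of the features. -/
theorem E_iter_le {f : ℕ → α → Rnd α} {Φ : ℕ → α → ℝ} {c : ℝ} {Q : ℕ → α → Prop}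
    (hQ : ∀ i a, Q i a → (f i a).All (Q (i + 1)))
    (hf : ∀ i a, Q i a → (f i a).E (Φ (i + 1)) ≤ Φ i a + c) {a : α} (ha : Q 0 a) (n : ℕ) :
    (iter f n a).E (Φ n) ≤ Φ 0 a + n * c := by
  induction n with
  | zero => simp
  | succ n ih =>
    rw [iter_succ, E_bind]
    refine (E_mono_of_All ((iter_all hQ ha n).mono fun b hb => hf n b hb)).trans ?_
    rw [E_add, E_const]
    push_cast; linarith

end Rnd

end

section

/-! ## A program logic for the machine -/

/-- The result of executing a command. -/
structure Outcome (X : Type) where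
  store : Store X
  steps : ℕ
  time : ℕ
  drawn : ℕ

/-- Started in the store `s`, the commands `L` halt within time `τ`, and their outcome is coupled to
the result of the computation `m` in such a way that the relation `R` holds between the result of
`m` and the final store. -/
def SimList {X α : Type} (O : Oracles X) (L : List Cmd) (s : Store X) (τ : ℕ) (m : Rnd α)
    (R : α → Store X → Prop) : Prop :=
  ∃ κ : Rnd (α × Outcome X),
    (∀ f : α → ℝ, (κ.E fun z => f z.1) = m.E f) ∧
    (κ.All fun z => R z.1 z.2.store ∧ z.2.steps ≤ τ ∧ z.2.time ≤ τ) ∧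
    ∀ K t d T, τ ≤ T → runFor O T ⟨L ++ K, s, t, d⟩ =
      κ.toPMF.bind fun z => runFor O (T - z.2.steps) ⟨K, z.2.store, t + z.2.time, d + z.2.drawn⟩

/-- `SimList` for a single command. -/
def Sim {X α : Type} (O : Oracles X) (c : Cmd) (s : Store X) (τ : ℕ) (m : Rnd α)
    (R : α → Store X → Prop) : Prop :=
  SimList O [c] s τ m R

variable {X α β : Type} {O : Oracles X} {c c₁ c₂ : Cmd} {s : Store X} {τ τ' τ₁ τ₂ : ℕ}

theorem runFor_succ (O : Oracles X) (T : ℕ) (C : Config X) :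
    runFor O (T + 1) C = (step O C).bind (runFor O T) := rfl

theorem runFor_halted (O : Oracles X) (T : ℕ) (s : Store X) (t d : ℕ) :
    runFor O T ⟨[], s, t, d⟩ = PMF.pure ⟨[], s, t, d⟩ := by
  induction T with
  | zero => rfl
  | succ T ih => rw [runFor_succ]; simp [step, ih]

namespace Sim

theorem weaken {m m' : Rnd α} {R R' : α → Store X → Prop} (h : Sim O c s τ m R)
    (hτ : τ ≤ τ') (hm : ∀ f, m.E f = m'.E f) (hR : ∀ a s', R a s' → R' a s') :
    Sim O c s τ' m' R' := by
  obtain ⟨κ, h1, h2, h3⟩ := h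
  refine ⟨κ, fun f => (h1 f).trans (hm f), h2.mono fun z hz => ⟨hR _ _ hz.1, hz.2.1.trans hτ, hz.2.2.trans hτ⟩, fun K t d T hT => h3 K t d T (hτ.trans hT)⟩

theorem time {m : Rnd α} {R : α → Store X → Prop} (h : Sim O c s τ m R)
    (hτ : τ ≤ τ') : Sim O c s τ' m R :=
  h.weaken hτ (fun _ => rfl) fun _ _ h => h

theorem post {m : Rnd α} {R R' : α → Store X → Prop} (h : Sim O c s τ m R)
    (hR : ∀ a s', R a s' → R' a s') : Sim O c s τ m R' :=
  h.weaken le_rfl (fun _ => rfl) hR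

theorem map {m : Rnd α} {R : α → Store X → Prop} {R' : β → Store X → Prop}
    (h : Sim O c s τ m R) (f : α → β) (hR : ∀ a s', R a s' → R' (f a) s') :
    Sim O c s τ (m.map f) R' := by
  obtain ⟨κ, h1, h2, h3⟩ := h
  refine ⟨κ.map fun z => (f z.1, z.2), fun g => ?_, ?_, fun K t d T hT => ?_⟩
  · simp [h1 fun a => g (f a)]
  · rw [Rnd.map, Rnd.All_bind]; exact h2.mono fun z hz => ⟨hR _ _ hz.1, hz.2⟩
  · rw [h3 K t d T hT, Rnd.map, Rnd.toPMF_bind, PMF.bind_bind]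
    simp [Rnd.toPMF]

/-- A command that takes a single deterministic step. -/
theorem of_step {s' : Store X} (w : ℕ) (hw : 1 ≤ w)
    (h : ∀ K t d, step O ⟨c :: K, s, t, d⟩ = PMF.pure ⟨K, s', t + w, d⟩)
    {a : α} {R : α → Store X → Prop} (hR : R a s') : Sim O c s w (Rnd.ret a) R := by
  refine ⟨Rnd.ret (a, ⟨s', 1, w, 0⟩), fun f => rfl, ⟨hR, hw, le_rfl⟩, fun K t d T hT => ?_⟩
  obtain ⟨T, rfl⟩ : ∃ T', T = T' + 1 := ⟨T - 1, by omega⟩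
  simp [runFor_succ, h, Rnd.toPMF]

theorem skip {a : α} {R : α → Store X → Prop} (hR : R a s) :
    Sim O .skip s 1 (Rnd.ret a) R :=
  of_step 1 le_rfl (fun _ _ _ => rfl) hR

theorem nset {r : ℕ} {e : NExp} {a : α} {R : α → Store X → Prop}
    (hR : R a { s with nreg := Function.update s.nreg r (e.eval s) }) :
    Sim O (.nset r e) s (e.size + 1) (Rnd.ret a) R :=
  of_step _ (by omega) (fun _ _ _ => by simp [step, add_assoc]) hR

theorem rset {b : NExp} {e : RExp} {a : α} {R : α → Store X → Prop}
    (hR : R a { s with rmem := Function.update s.rmem (b.eval s) (e.eval s) }) :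
    Sim O (.rset b e) s (b.size + e.size + 1) (Rnd.ret a) R :=
  of_step _ (by omega) (fun _ _ _ => by simp [step, add_assoc]) hR

theorem pset {b b' : NExp} {a : α} {R : α → Store X → Prop}
    (hR : R a { s with pmem := Function.update s.pmem (b.eval s) (s.pmem (b'.eval s)) }) :
    Sim O (.pset b b') s (b.size + b'.size + O.n + 1) (Rnd.ret a) R :=
  of_step _ (by omega) (fun _ _ _ => by simp [step, add_assoc]) hR

theorem query {b m b' : NExp} {a : α} {R : α → Store X → Prop}
    (hR : R a { s with rmem := Function.update s.rmem (b.eval s)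
                                  (O.value (m.eval s) (s.pmem (b'.eval s))) }) :
    Sim O (.query b m b') s (b.size + m.size + b'.size + O.n + 1) (Rnd.ret a) R :=
  of_step _ (by omega) (fun _ _ _ => by simp [step, add_assoc]) hR

/-- A command that takes a single random step. -/
theorem of_step_map {Ω : Type} [inst : Fintype Ω] (p : PMF Ω) (st : Ω → Store X) (w : ℕ)
    (hw : 1 ≤ w) (dr : ℕ)
    (h : ∀ K t d, step O ⟨c :: K, s, t, d⟩ = p.map fun ω => ⟨K, st ω, t + w, d + dr⟩)
    {f : Ω → α} {R : α → Store X → Prop} (hR : ∀ ω, R (f ω) (st ω)) :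
    Sim O c s w (Rnd.samp inst p fun ω => Rnd.ret (f ω)) R := by
  refine ⟨Rnd.samp inst p fun ω => Rnd.ret (f ω, ⟨st ω, 1, w, dr⟩), fun f => rfl,
    fun ω => ⟨hR ω, hw, le_rfl⟩, fun K t d T hT => ?_⟩
  obtain ⟨T, rfl⟩ : ∃ T', T = T' + 1 := ⟨T - 1, by omega⟩
  rw [List.singleton_append, runFor_succ, h, PMF.bind_map]
  simp only [Rnd.toPMF, PMF.bind_bind, PMF.pure_bind]
  rfl

theorem walk [inst : Fintype X] {b b' : NExp} {x : X} (hx : s.pmem (b'.eval s) = some x)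
    {f : X → α} {R : α → Store X → Prop}
    (hR : ∀ y, R (f y) { s with pmem := Function.update s.pmem (b.eval s) (some y) }) :
    Sim O (.walk b b') s (b.size + b'.size + O.n + 1)
      (Rnd.samp inst (O.next x) fun y => Rnd.ret (f y)) R := by
  refine of_step_map (O.next x)
    (fun y => { s with pmem := Function.update s.pmem (b.eval s) (some y) }) _ (by omega) 0
    (fun K t d => ?_) hR
  simp [step, hx, Oracles.succ, PMF.map_comp, Function.comp_def, add_assoc]

theorem draw [inst : Fintype (X × ℤˣ)] {b b' : NExp}
    {f : X × ℤˣ → α} {R : α → Store X → Prop}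
    (hR : ∀ z, R (f z) { s with
          pmem := Function.update s.pmem (b.eval s) (some z.1)
          rmem := Function.update s.rmem (b'.eval s) (((z.2 : ℤˣ) : ℤ) : ℝ) }) :
    Sim O (.draw b b') s (b.size + b'.size + O.n + 1)
      (Rnd.samp inst O.labelled fun z => Rnd.ret (f z)) R :=
  of_step_map O.labelled _ _ (by omega) 1 (fun _ _ _ => by simp [step, add_assoc]) hR

theorem coin {r : ℕ} {f : Fin 2 → α} {R : α → Store X → Prop}
    (hR : ∀ v : Fin 2, R (f v) { s with nreg := Function.update s.nreg r v.val }) :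
    Sim O (.coin r) s 1
      (Rnd.samp inferInstance (PMF.uniformOfFintype (Fin 2)) fun v => Rnd.ret (f v)) R :=
  of_step_map _ _ 1 le_rfl 0 (fun _ _ _ => rfl) hR

/-- Sequencing, with the intermediate step of the machine left out. -/
theorem chain {m : Rnd α} {f : α → Rnd β} {R : α → Store X → Prop} {R' : β → Store X → Prop}
    (h₁ : Sim O c₁ s τ₁ m R) (h₂ : ∀ a s', R a s' → Sim O c₂ s' τ₂ (f a) R') :
    SimList O [c₁, c₂] s (τ₁ + τ₂) (m.bind f) R' := by
  classical
  obtain ⟨κ, e1, a1, r1⟩ := h₁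
  choose κ' e2 a2 r2 using h₂
  -- `R` holds on every branch of `κ`, so the second alternative is never reached; it only makes `F`
  -- total with the correct marginal.
  let F : α × Outcome X → Rnd (β × Outcome X) := fun z =>
    if h : R z.1 z.2.store then (κ' z.1 z.2.store h).map fun y =>
      (y.1, ⟨y.2.store, z.2.steps + y.2.steps, z.2.time + y.2.time, z.2.drawn + y.2.drawn⟩)
    else (f z.1).map fun b => (b, z.2)
  refine ⟨κ.bind F, fun g => ?_, ?_, fun K t d T hT => ?_⟩
  · rw [Rnd.E_bind, Rnd.E_bind, ← e1]
    congr 1; funext z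
    by_cases h : R z.1 z.2.store
    · simp [F, h, e2 _ _ h g]
    · simp [F, h]
  · rw [Rnd.All_bind]
    refine a1.mono fun z hz => ?_
    simp only [F, hz.1, dite_true, Rnd.map, Rnd.All_bind]
    refine (a2 _ _ hz.1).mono fun y hy => ?_
    exact ⟨hy.1, by have := hy.2.1; have := hz.2.1; simp; omega,
      by have := hy.2.2; have := hz.2.2; simp; omega⟩
  · rw [List.cons_append, ← List.singleton_append, r1 _ _ _ _ (by omega), Rnd.toPMF_bind, PMF.bind_bind]
    ext C
    simp only [PMF.bind_apply]
    refine tsum_congr fun z => ?_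
    -- The laws agree only where `R` holds, which is known on the support; elsewhere both terms
    -- vanish.
    by_cases hz : κ.toPMF z = 0
    · simp [hz]
    have hz := a1.of_mem_support ((PMF.mem_support_iff _ _).2 hz)
    rw [r2 _ _ hz.1 _ _ _ _ (by omega)]
    simp only [F, hz.1, dite_true, Rnd.map, Rnd.toPMF_bind, Rnd.toPMF]
    congr 1
    rw [← PMF.bind_apply, PMF.bind_bind]
    simp only [PMF.pure_bind, Nat.sub_sub, add_assoc]

/-- Covers the commands whose single step only replaces the head of the program by other commands:
sequencing, choice and loops. -/
theorem of_step_list {L : List Cmd} {m : Rnd α} {R : α → Store X → Prop} (w : ℕ) (hw : 1 ≤ w)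
    (h : ∀ K t d, step O ⟨c :: K, s, t, d⟩ = PMF.pure ⟨L ++ K, s, t + w, d⟩)
    (hL : SimList O L s τ m R) : Sim O c s (τ + w) m R := by
  obtain ⟨κ, h1, h2, h3⟩ := hL
  refine ⟨κ.map fun z => (z.1, ⟨z.2.store, z.2.steps + 1, z.2.time + w, z.2.drawn⟩),
    fun g => by simp [h1], ?_, fun K t d T hT => ?_⟩
  · rw [Rnd.map, Rnd.All_bind]
    exact h2.mono fun z hz => ⟨hz.1, by have := hz.2.1; simp; omega, by have := hz.2.2; simp; omega⟩
  · obtain ⟨T, rfl⟩ : ∃ T', T = T' + 1 := ⟨T - 1, by omega⟩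
    rw [List.singleton_append, runFor_succ, h, PMF.pure_bind, h3 _ _ _ _ (by omega), Rnd.map,
      Rnd.toPMF_bind, PMF.bind_bind]
    simp only [Rnd.toPMF, PMF.pure_bind, Nat.add_sub_add_right]
    congr 1; funext z; congr 2; ring

theorem seq {m : Rnd α} {f : α → Rnd β} {R : α → Store X → Prop} {R' : β → Store X → Prop}
    (h₁ : Sim O c₁ s τ₁ m R) (h₂ : ∀ a s', R a s' → Sim O c₂ s' τ₂ (f a) R') :
    Sim O (.seq c₁ c₂) s (τ₁ + τ₂ + 1) (m.bind f) R' :=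
  of_step_list 1 le_rfl (fun _ _ _ => rfl) (chain h₁ h₂)

theorem det_seq {m : Rnd β} {R : Store X → Prop} {R' : β → Store X → Prop}
    (h₁ : Sim O c₁ s τ₁ (Rnd.ret ()) fun _ => R) (h₂ : ∀ s', R s' → Sim O c₂ s' τ₂ m R') :
    Sim O (.seq c₁ c₂) s (τ₁ + τ₂ + 1) m R' :=
  seq (f := fun _ => m) h₁ fun _ => h₂

theorem seq_ret {m : Rnd α} {R R' : α → Store X → Prop}
    (h₁ : Sim O c₁ s τ₁ m R) (h₂ : ∀ a s', R a s' → Sim O c₂ s' τ₂ (Rnd.ret a) R') :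
    Sim O (.seq c₁ c₂) s (τ₁ + τ₂ + 1) m R' :=
  (seq (f := Rnd.ret) h₁ h₂).weaken le_rfl (fun f => by simp) fun _ _ h => h

theorem nset_seq {r : ℕ} {e : NExp} {m : Rnd α} {R : α → Store X → Prop}
    (h : Sim O c { s with nreg := Function.update s.nreg r (e.eval s) } τ m R) :
    Sim O (.seq (.nset r e) c) s (e.size + 1 + τ + 1) m R :=
  det_seq (R := (· = { s with nreg := Function.update s.nreg r (e.eval s) }))
    (nset rfl) fun _ h' => h' ▸ h

theorem rset_seq {b : NExp} {e : RExp} {m : Rnd α} {R : α → Store X → Prop}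
    (h : Sim O c { s with rmem := Function.update s.rmem (b.eval s) (e.eval s) } τ m R) :
    Sim O (.seq (.rset b e) c) s (b.size + e.size + 1 + τ + 1) m R :=
  det_seq (R := fun s' => s' = { s with rmem := Function.update s.rmem (b.eval s) (e.eval s) })
    (rset rfl) fun _ h' => h' ▸ h

theorem pset_seq {b b' : NExp} {m : Rnd α} {R : α → Store X → Prop}
    (h : Sim O c { s with pmem := Function.update s.pmem (b.eval s) (s.pmem (b'.eval s)) } τ m R) :
    Sim O (.seq (.pset b b') c) s (b.size + b'.size + O.n + 1 + τ + 1) m R :=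
  det_seq
    (R := fun s' => s' = { s with pmem := Function.update s.pmem (b.eval s) (s.pmem (b'.eval s)) })
    (pset rfl) fun _ h' => h' ▸ h

theorem query_seq {b i b' : NExp} {m : Rnd α} {R : α → Store X → Prop}
    (h : Sim O c (Store.mk s.nreg (Function.update s.rmem (b.eval s)
      (O.value (i.eval s) (s.pmem (b'.eval s)))) s.pmem) τ m R) :
    Sim O (.seq (.query b i b') c) s (b.size + i.size + b'.size + O.n + 1 + τ + 1) m R :=
  det_seq
    (R := (· = Store.mk s.nreg (Function.update s.rmem (b.eval s)
      (O.value (i.eval s) (s.pmem (b'.eval s)))) s.pmem))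
    (query rfl) fun _ h' => h' ▸ h

theorem ite {b : Test} {m : Rnd α} {R : α → Store X → Prop}
    (h₁ : b.holds s → Sim O c₁ s τ m R) (h₂ : ¬ b.holds s → Sim O c₂ s τ m R) :
    Sim O (.ite b c₁ c₂) s (τ + (b.cost O.n + 1)) m R := by
  by_cases hb : b.holds s
  · exact of_step_list (L := [c₁]) _ (by omega)
      (fun _ _ _ => by simp [step, hb, add_assoc]) (h₁ hb)
  · exact of_step_list (L := [c₂]) _ (by omega)
      (fun _ _ _ => by simp [step, hb, add_assoc]) (h₂ hb)

/-- The rule for loops with a predetermined number of iterations. -/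
theorem loop {b : Test} {n : ℕ} {f : ℕ → α → Rnd α} {I : ℕ → α → Store X → Prop}
    (hb : ∀ i a s, i ≤ n → I i a s → (b.holds s ↔ i < n))
    (hbody : ∀ i a s, i < n → I i a s → Sim O c s τ (f i a) (I (i + 1)))
    {a : α} (h0 : I 0 a s) :
    Sim O (.loop b c) s (n * (τ + b.cost O.n + 1) + b.cost O.n + 1) (Rnd.iter f n a) (I n) := by
  -- Induction on the number `r` of rounds that remain; `i` rounds have been made, whence the shift
  -- in `f`.
  suffices H : ∀ r i a s, i + r = n → I i a s → Sim O (.loop b c) s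
      (r * (τ + b.cost O.n + 1) + b.cost O.n + 1) (Rnd.iter (fun l => f (l + i)) r a) (I n) from
    H n 0 a s (by omega) h0
  intro r
  induction r with
  | zero =>
    intro i a s hi h
    obtain rfl : i = n := by omega
    have := (hb i a s le_rfl h).not.2 (by omega)
    exact (of_step (b.cost O.n + 1) (by omega)
      (fun _ _ _ => by simp [step, this, add_assoc]) h).time (by omega)
  | succ r ih =>
    intro i a s hi h
    have h1 := (hb i a s (by omega) h).2 (by omega)
    have h2 := chain (hbody i a s (by omega) h) fun a' s' h' => ih (i + 1) a' s' (by omega) h'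
    have h3 := of_step_list (c := .loop b c) (b.cost O.n + 1) (by omega)
      (fun _ _ _ => by simp [step, h1, add_assoc]) h2
    refine h3.weaken (le_of_eq (by ring)) (fun g => ?_) fun _ _ h => h
    rw [Rnd.iter_succ']
    simp only [Nat.zero_add]
    have : (fun l => f (l + (i + 1))) = fun l => f (l + 1 + i) := by funext l; congr 1; omega
    rw [this]

/-- Iterating over `Unit` gives the same expectations as `ret ()`, and `Sim` sees a computation only
through its expectations. -/
theorem det_loop {b : Test} {n : ℕ} {I : ℕ → Store X → Prop}
    (hb : ∀ i s, i ≤ n → I i s → (b.holds s ↔ i < n))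
    (hbody : ∀ i s, i < n → I i s → Sim O c s τ (Rnd.ret ()) fun _ => I (i + 1))
    (h0 : I 0 s) :
    Sim O (.loop b c) s (n * (τ + b.cost O.n + 1) + b.cost O.n + 1) (Rnd.ret ())
      fun _ => I n :=
  (loop (f := fun _ _ => Rnd.ret ()) (I := fun i (_ : Unit) => I i) (fun i _ => hb i)
    (fun i _ => hbody i) (a := ()) h0).weaken le_rfl
      (fun f => (Rnd.E_congr_of_All (g := fun _ => f ()) (Rnd.all_true _ fun _ => rfl)).trans
        (Rnd.E_const _ _)) fun _ _ h => h

/-- A whole program, started with nothing else to do. -/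
theorem runFor_eq {m : Rnd α} {R : α → Store X → Prop} (h : Sim O c s τ m R) :
    ∃ κ : Rnd (α × Outcome X), (∀ f : α → ℝ, (κ.E fun z => f z.1) = m.E f) ∧
      (κ.All fun z => R z.1 z.2.store ∧ z.2.time ≤ τ) ∧
      ∀ T, τ ≤ T → runFor O T ⟨[c], s, 0, 0⟩ =
        (κ.map fun z => Config.mk [] z.2.store z.2.time z.2.drawn).toPMF := by
  obtain ⟨κ, h1, h2, h3⟩ := h
  refine ⟨κ, h1, h2.mono fun z hz => ⟨hz.1, hz.2.2⟩, fun T hT => ?_⟩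
  have := h3 [] 0 0 T hT
  simp only [List.append_nil, runFor_halted, Nat.zero_add] at this
  rw [this, Rnd.map, Rnd.toPMF_bind]
  rfl

end Sim

end

section

/-! ## The feature map: program and model -/

def incr (r : ℕ) : Cmd := .nset r (.add (.reg r) (.const 1))

/-- Execute `body` while the counter `r` is below `b`, and increase the counter each time. -/
def forLoop (r : ℕ) (b : NExp) (body : Cmd) : Cmd :=
  .loop (.nlt (.reg r) b) (.seq body (incr r))

/-- The real cell that belongs to the index in register `15` in the array with offset `o`. There
are three interleaved arrays: offset `21` for the weights, `22` for the sums of the weights, and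
`23` for the features. -/
def cell (o : ℕ) : NExp := .add (.add (.add (.reg 15) (.reg 15)) (.reg 15)) (.const o)

variable {X α : Type} {O : Oracles X} {s : Store X} {τ : ℕ}

@[simp] theorem cell_eval (o : ℕ) : (cell o).eval s = 3 * s.nreg 15 + o := by
  simp only [cell, NExp.eval]; omega

theorem cell_size (o : ℕ) : (cell o).size = 7 := rfl

theorem Sim.forLoop {r n : ℕ} {b : NExp} {body : Cmd} {f : ℕ → α → Rnd α}
    {I : ℕ → α → Store X → Prop}
    (hI : ∀ i a s, I i a s → s.nreg r = i ∧ b.eval s = n)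
    (hbody : ∀ i a s, i < n → I i a s → Sim O body s τ (f i a) fun a' s' =>
      I (i + 1) a' ⟨Function.update s'.nreg r (s'.nreg r + 1), s'.rmem, s'.pmem⟩)
    {a : α} (h0 : I 0 a s) :
    Sim O (forLoop r b body) s (n * (τ + b.size + 8) + b.size + 3) (Rnd.iter f n a) (I n) := by
  have := Sim.loop (O := O) (b := .nlt (.reg r) b) (c := .seq body (incr r)) (n := n) (f := f)
    (I := I) (τ := τ + 4 + 1) (fun i a s _ h => by
      obtain ⟨h1, h2⟩ := hI i a s h
      simp [Test.holds, NExp.eval, h1, h2]) (fun i a s hi h =>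
        Sim.seq_ret (hbody i a s hi h) fun a' s' h' => Sim.nset h') h0
  exact this.time (by simp only [Test.cost, NExp.size]; apply le_of_eq; ring)

theorem Sim.det_forLoop {r n : ℕ} {b : NExp} {body : Cmd} {I : ℕ → Store X → Prop}
    (hI : ∀ i s, I i s → s.nreg r = i ∧ b.eval s = n)
    (hbody : ∀ i s, i < n → I i s → Sim O body s τ (Rnd.ret ()) fun _ s' =>
      I (i + 1) ⟨Function.update s'.nreg r (s'.nreg r + 1), s'.rmem, s'.pmem⟩)
    (h0 : I 0 s) :
    Sim O (SpectralLearning.forLoop r b body) s (n * (τ + b.size + 8) + b.size + 3) (Rnd.ret ())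
      fun _ => I n :=
  (Sim.forLoop (f := fun _ _ => Rnd.ret ()) (I := fun i (_ : Unit) => I i) (fun i _ => hI i)
    (fun i _ => hbody i) (a := ()) h0).weaken le_rfl
      (fun f => (Rnd.E_congr_of_All (g := fun _ => f ()) (Rnd.all_true _ fun _ => rfl)).trans
        (Rnd.E_const _ _)) fun _ _ h => h

/-- Add the values of all functions at the current point of the walk to the features. -/
def queryAll : Cmd :=
  .seq (.nset 14 (.const 0)) <|
  forLoop 14 (.reg 3) <|
    .seq (.query (.const 15) (.reg 14) (.const 1)) <|
    .seq (.rset (cell 23) (.add (.mem (cell 23)) (.div (.mem (.const 15)) (.cast (.reg 10))))) <|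
    incr 15

/-- One walk, which starts at the point in cell `0`. -/
def oneWalk : Cmd :=
  .seq (.pset (.const 1) (.const 0)) <|
  .seq (.nset 15 (.reg 7)) <|
  .seq (.nset 13 (.const 0)) <|
  forLoop 13 (.add (.reg 7) (.const 1)) <|
    .seq queryAll (.walk (.const 1) (.const 1))

/-- Store the features of the point in cell `0`. -/
def features : Cmd :=
  .seq (.nset 15 (.const 0)) <|
  .seq (forLoop 15 (.reg 8) <|
    .ite (.peq (.const 0) (.add (.reg 15) (.const 2)))
      (.rset (cell 23) (.const 1)) (.rset (cell 23) (.const 0))) <|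
  .seq (.nset 12 (.const 0)) <|
  forLoop 12 (.reg 10) oneWalk

/-- The features that belong to one time of the walk fill the window from `o` to `o + m`. The width
is a parameter so that the definition also describes a partially executed loop over the functions.
-/
def Oracles.addValues (O : Oracles X) (q o m : ℕ) (y : X) (V : ℕ → ℝ) : ℕ → ℝ := fun j =>
  if o ≤ j ∧ j < o + m then V j + O.value (j - o) (some y) / q else V j

/-- One step of the walk, which first adds the values at the current point. -/
def Oracles.walkStep [inst : Fintype X] (O : Oracles X) (z q t : ℕ) (a : X × (ℕ → ℝ)) :
    Rnd (X × (ℕ → ℝ)) :=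
  .samp inst (O.next a.1) fun y => .ret (y, O.addValues q (z + t * O.M) O.M a.1 a.2)

/-- Values are added before the point moves, so `z + 1` rounds account for the times `0, …, z`. -/
def Oracles.walkModel [Fintype X] (O : Oracles X) (z q : ℕ) (x : X) (V : ℕ → ℝ) : Rnd (ℕ → ℝ) :=
  (Rnd.iter (O.walkStep z q) (z + 1) (x, V)).map Prod.snd

-- Past the memorized points `pts j` is `none` and the value is `0`; thus the loop that writes the
-- indicators also clears the accumulators of the walks.
open Classical in
def indicators (pts : ℕ → Option X) (x : X) : ℕ → ℝ := fun j => if pts j = some x then 1 else 0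

/-- The law of the features of `x`. -/
def Oracles.featModel [Fintype X] (O : Oracles X) (z q : ℕ) (pts : ℕ → Option X) (x : X) :
    Rnd (ℕ → ℝ) :=
  Rnd.iter (fun _ => O.walkModel z q x) q (indicators pts x)

/-- `s'` differs from `s` at most in the working memory of `features`. -/
structure FeatFrame (s s' : Store X) : Prop where
  nreg : ∀ r < 12, s'.nreg r = s.nreg r
  rmem : ∀ a, a ≠ 15 → (a < 23 ∨ a % 3 ≠ 2) → s'.rmem a = s.rmem a
  pmem : ∀ a ≠ 1, s'.pmem a = s.pmem a

theorem FeatFrame.trans {s s' s'' : Store X} (h : FeatFrame s s') (h' : FeatFrame s' s'') :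
    FeatFrame s s'' :=
  ⟨fun r hr => (h'.nreg r hr).trans (h.nreg r hr),
    fun a ha ha' => (h'.rmem a ha ha').trans (h.rmem a ha ha'),
    fun a ha => (h'.pmem a ha).trans (h.pmem a ha)⟩

/-- The counters of the two surrounding loops, registers `12` and `13`, have to survive. Here `τ` is
the content of register `12` and not a time. -/
theorem sim_queryAll {q o d t : ℕ} {y : X} {V : ℕ → ℝ} (h3 : s.nreg 3 = O.M) (h10 : s.nreg 10 = q)
    (h13 : s.nreg 13 = t) (h12 : s.nreg 12 = τ)
    (h15 : s.nreg 15 = o) (h1 : s.pmem 1 = some y) (hV : ∀ j < d, s.rmem (3 * j + 23) = V j) :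
    Sim O queryAll s (O.M * (O.n + 44) + 20) (Rnd.ret ()) fun _ s' =>
      FeatFrame s s' ∧ s'.pmem 1 = some y ∧ s'.nreg 15 = o + O.M ∧ s'.nreg 13 = t ∧
        s'.nreg 12 = τ ∧
        ∀ j < d, s'.rmem (3 * j + 23) = O.addValues q o O.M y V j := by
  refine Sim.time (Sim.nset_seq (Sim.post (Sim.det_forLoop (n := O.M)
    (τ := O.n + 32)
    (I := fun i s' => s'.nreg 14 = i ∧ FeatFrame s s' ∧ s'.pmem 1 = some y ∧
      s'.nreg 15 = o + i ∧ s'.nreg 13 = t ∧ s'.nreg 12 = τ ∧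
      ∀ j < d, s'.rmem (3 * j + 23) = O.addValues q o i y V j) ?_ ?_ ?_) ?_)) ?_
  · rintro i s' ⟨h, hf, -⟩
    exact ⟨h, by simp [NExp.eval, hf.nreg 3, h3]⟩
  · rintro i s' hi ⟨h14, hf, hp, h15', h13', h12', hV'⟩
    refine Sim.time (Sim.query_seq (Sim.rset_seq (Sim.nset ?_))) ?_
    · refine ⟨by simp [h14], ?_, by simpa using hp, by simp [NExp.eval, h15']; omega, by simp [h13'],
        by simp [h12'], ?_⟩
      · refine hf.trans ⟨fun r hr => ?_, fun a ha ha' => ?_, fun a ha => rfl⟩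
        · simp only [Function.update_apply]; rw [if_neg (by omega), if_neg (by omega)]
        -- The written address `3 * _ + 23` is at least `23` and congruent to `2` modulo `3`, so it
        -- lies in the region that `FeatFrame` leaves free.
        · simp only [NExp.eval, cell_eval, Function.update_apply]
          rw [if_neg, if_neg ha]; omega
      · intro j hj
        have e10 : s'.nreg 10 = q := by rw [hf.nreg 10 (by norm_num), h10]
        simp only [NExp.eval, RExp.eval, cell_eval, Function.update_apply, h15', h14, hp, e10]
        rw [if_neg (by omega : ¬ 3 * j + 23 = 15), if_neg (by omega : ¬ 3 * (o + i) + 23 = 15)]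
        simp only [if_true]
        by_cases hji : j = o + i
        · subst hji
          rw [if_pos rfl, hV' _ hj]
          simp [Oracles.addValues]
        · rw [if_neg (by omega), hV' _ hj]
          simp only [Oracles.addValues]
          have : (o ≤ j ∧ j < o + i) ↔ (o ≤ j ∧ j < o + (i + 1)) := by omega
          simp only [this]
    · simp only [NExp.size, RExp.size, cell_size]; omega
  · refine ⟨by simp [NExp.eval], ⟨fun r hr => ?_, fun _ _ _ => rfl, fun _ _ => rfl⟩, h1, by simpa using h15, by simpa using h13, by simpa using h12, ?_⟩
    · simp [Function.update_apply]; omega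
    · intro j hj
      simp only [hV j hj, Oracles.addValues]
      rw [if_neg (by omega)]
  · rintro _ s' ⟨-, h⟩; exact h
  · simp only [NExp.size]; nlinarith

theorem sim_oneWalk [Fintype X] {z q w : ℕ} {x : X} {V : ℕ → ℝ} {d : ℕ}
    (h3 : s.nreg 3 = O.M) (h7 : s.nreg 7 = z)
    (h10 : s.nreg 10 = q) (h12 : s.nreg 12 = w) (h0 : s.pmem 0 = some x)
    (hV : ∀ j < d, s.rmem (3 * j + 23) = V j) :
    Sim O oneWalk s ((z + 1) * (O.M * (O.n + 44) + O.n + 50) + O.n + 50)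
      (O.walkModel z q x V) fun V' s' =>
      FeatFrame s s' ∧ s'.nreg 12 = w ∧ ∀ j < d, s'.rmem (3 * j + 23) = V' j := by
  refine Sim.time (Sim.pset_seq (Sim.nset_seq (Sim.nset_seq (Sim.map (Sim.forLoop (n := z + 1)
    (τ := O.M * (O.n + 44) + O.n + 30)
    (I := fun i a s' => s'.nreg 13 = i ∧ FeatFrame s s' ∧ s'.pmem 1 = some a.1 ∧
      -- Register `15` is not reset between the times of a walk, so the window advances by `O.M` at
      -- each of them.
      s'.nreg 15 = z + i * O.M ∧ s'.nreg 12 = w ∧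
      ∀ j < d, s'.rmem (3 * j + 23) = a.2 j) ?_ ?_ ?_) Prod.snd ?_)))) ?_
  · rintro i a s' ⟨h, hf, -⟩
    exact ⟨h, by simp [NExp.eval, hf.nreg 7, h7]⟩
  · rintro i ⟨y, V'⟩ s' hi ⟨h13, hf, hp, h15, h12', hV'⟩
    have e3 : s'.nreg 3 = O.M := by rw [hf.nreg 3 (by norm_num), h3]
    have e10 : s'.nreg 10 = q := by rw [hf.nreg 10 (by norm_num), h10]
    refine Sim.time (Sim.det_seq (sim_queryAll e3 e10 h13 h12' h15 hp hV') ?_) (?_ : _ + (5 + O.n) + 1 ≤ _)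
    · rintro s'' ⟨hf2, hp2, h15', h13', h12', hV''⟩
      refine Sim.time (Sim.walk (x := y) hp2 fun y' => ?_) (?_ : 1 + 1 + O.n + 1 ≤ _)
      · refine ⟨by simp [h13'], hf.trans (hf2.trans ⟨fun r hr => ?_, fun _ _ _ => rfl, fun a ha => ?_⟩), by simp [NExp.eval], by simp [h15']; ring, by simp [h12'], hV''⟩
        · simp [Function.update_apply]; omega
        · simp [NExp.eval, ha]
      · omega
    · omega
  · refine ⟨by simp [NExp.eval], ⟨fun r hr => ?_, fun _ _ _ => rfl, fun a ha => ?_⟩, by simp [NExp.eval, h0], by simp [NExp.eval, h7], by simp [h12], hV⟩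
    · simp only [Function.update_apply]; rw [if_neg (by omega), if_neg (by omega)]
    · simp [NExp.eval, ha]
  · rintro a s' ⟨-, hf, -, -, h12', hV'⟩
    exact ⟨hf, h12', hV'⟩
  · simp only [NExp.size]; nlinarith

/-- A bound for the running time of `features`. -/
def featTime (n M z d q : ℕ) : ℕ :=
  d * (n + 40) + q * ((z + 1) * (M * (n + 44) + n + 50) + n + 70) + 40

theorem sim_features [Fintype X] {z q d : ℕ} {x : X} {pts : ℕ → Option X}
    (h3 : s.nreg 3 = O.M) (h7 : s.nreg 7 = z) (h8 : s.nreg 8 = d)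
    (h10 : s.nreg 10 = q) (h0 : s.pmem 0 = some x) (hp : ∀ j, s.pmem (j + 2) = pts j) :
    Sim O features s (featTime O.n O.M z d q) (O.featModel z q pts x) fun V s' =>
      FeatFrame s s' ∧ ∀ j < d, s'.rmem (3 * j + 23) = V j := by
  classical
  refine Sim.time (Sim.nset_seq (Sim.det_seq (Sim.det_forLoop (n := d) (τ := O.n + 20)
    (I := fun i s' => s'.nreg 15 = i ∧ FeatFrame s s' ∧
      ∀ j < i, s'.rmem (3 * j + 23) = indicators pts x j) ?_ ?_ ?_) ?_)) (?_ : _ +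
      (_ + (q * ((z + 1) * (O.M * (O.n + 44) + O.n + 50) + O.n + 70) + 10) + 1) + 1 ≤ _)
  · rintro i s' ⟨h, hf, -⟩
    exact ⟨h, by simp [NExp.eval, hf.nreg 8, h8]⟩
  · rintro i s' hi ⟨h15, hf, hV⟩
    have hb : Test.holds s' (.peq (.const 0) (.add (.reg 15) (.const 2))) ↔ pts i = some x := by
      simp only [Test.holds, NExp.eval, h15, hf.pmem 0 (by norm_num), hf.pmem (i + 2) (by omega),
        h0, hp]
      exact eq_comm
    refine Sim.time (Sim.ite (fun h => Sim.rset ?_) fun h => Sim.rset ?_) ?_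
    · refine ⟨by simp [h15], hf.trans ⟨fun r hr => ?_, fun a ha ha' => ?_, fun _ _ => rfl⟩, fun j hj => ?_⟩
      · simp [Function.update_apply]; omega
      · simp only [cell_eval, Function.update_apply]; rw [if_neg]; omega
      · simp only [cell_eval, h15, Function.update_apply]
        by_cases hji : j = i
        · subst hji; simp [indicators, hb.1 h, RExp.eval]
        · rw [if_neg (by omega), hV j (by omega)]
    · refine ⟨by simp [h15], hf.trans ⟨fun r hr => ?_, fun a ha ha' => ?_, fun _ _ => rfl⟩, fun j hj => ?_⟩
      · simp [Function.update_apply]; omega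
      · simp only [cell_eval, Function.update_apply]; rw [if_neg]; omega
      · simp only [cell_eval, h15, Function.update_apply]
        by_cases hji : j = i
        · subst hji; simp [indicators, mt hb.2 h, RExp.eval]
        · rw [if_neg (by omega), hV j (by omega)]
    · simp only [NExp.size, RExp.size, cell_size, Test.cost]; omega
  · refine ⟨by simp [NExp.eval], ⟨fun r hr => ?_, fun _ _ _ => rfl, fun _ _ => rfl⟩, by simp⟩
    simp [Function.update_apply]; omega
  · rintro s₁ ⟨-, hf, hV⟩
    refine Sim.time (Sim.nset_seq (Sim.post (Sim.forLoop (n := q) (f := fun _ => O.walkModel z q x)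
      (τ := (z + 1) * (O.M * (O.n + 44) + O.n + 50) + O.n + 50)
      (I := fun i V s' => s'.nreg 12 = i ∧ FeatFrame s s' ∧
        ∀ j < d, s'.rmem (3 * j + 23) = V j) ?_ ?_ ?_) ?_)) ?_
    · rintro i a s' ⟨h, hf, -⟩
      exact ⟨h, by simp [NExp.eval, hf.nreg 10, h10]⟩
    · rintro i V s' hi ⟨h12, hf, hV⟩
      refine Sim.post (sim_oneWalk (z := z) (q := q) (w := i) (d := d) (by rw [hf.nreg 3 (by norm_num), h3])
        (by rw [hf.nreg 7 (by norm_num), h7]) (by rw [hf.nreg 10 (by norm_num), h10]) h12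
        (by rw [hf.pmem 0 (by norm_num), h0]) hV) ?_
      rintro V' s'' ⟨hf2, h12', hV'⟩
      refine ⟨by simp [h12'], hf.trans (hf2.trans ⟨fun r hr => ?_, fun _ _ _ => rfl, fun _ _ => rfl⟩), hV'⟩
      simp [Function.update_apply]; omega
    · refine ⟨by simp [NExp.eval], hf.trans ⟨fun r hr => ?_, fun _ _ _ => rfl, fun _ _ => rfl⟩, hV⟩
      simp [Function.update_apply]; omega
    · rintro V s' ⟨-, h⟩; exact h
    · simp only [NExp.size]; nlinarith
  · simp only [NExp.size, featTime]; nlinarith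

end

section

/-! ## Stochastic subgradient descent and evaluation: programs and models -/

variable {X α : Type} {O : Oracles X} {s : Store X} {τ : ℕ}

/-- Compute the scalar product of the features with the array at offset `o`. -/
def dot (o : ℕ) : Cmd :=
  .seq (.rset (.const 11) (.const 0)) <|
  .seq (.nset 15 (.const 0)) <|
  forLoop 15 (.reg 8) <|
    .rset (.const 11) (.add (.mem (.const 11)) (.mul (.mem (cell o)) (.mem (cell 23))))

/-- Update one weight and the sum of the weights. -/
def updateOne : Cmd :=
  .seq (.rset (cell 22) (.add (.mem (cell 22)) (.mem (cell 21)))) <|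
  .seq (.rset (cell 21) (.add (.mem (cell 21)) (.mul (.mem (.const 12)) (.mem (cell 23))))) <|
  .seq (.ite (.rlt (.cast (.reg 7)) (.mem (cell 21))) (.rset (cell 21) (.cast (.reg 7))) .skip) <|
  .ite (.rlt (.mem (cell 21)) (.sub (.const 0) (.cast (.reg 7))))
    (.rset (cell 21) (.sub (.const 0) (.cast (.reg 7)))) .skip

/-- A projected subgradient step. -/
def updateAll : Cmd :=
  .seq (.ite (.rlt (.mem (.const 11)) (.mem (.const 10))) (.rset (.const 12) (.mem (.const 14)))
    (.rset (.const 12) (.sub (.const 0) (.mem (.const 14))))) <|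
  .seq (.nset 15 (.const 0)) <|
  forLoop 15 (.reg 8) updateOne

def descent : Cmd :=
  .seq (.nset 11 (.const 0)) <|
  forLoop 11 (.reg 10) <|
    .seq (.draw (.const 0) (.const 10)) <|
    .seq features <|
    .seq (dot 21) updateAll

/-- Store the points of as many examples as register `7` says. -/
def memorize : Cmd :=
  .seq (.nset 11 (.const 0)) <|
  forLoop 11 (.reg 7) (.draw (.add (.reg 11) (.const 2)) (.const 10))

/-- A random dyadic number in the unit interval. -/
def threshold : Cmd :=
  .seq (.rset (.const 13) (.const 0)) <|
  .seq (.nset 15 (.const 0)) <|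
  forLoop 15 (.reg 7) <|
    .seq (.coin 14) (.rset (.const 13)
      (.div (.add (.mem (.const 13)) (.cast (.reg 14))) (.const 2)))

/-- Evaluate the hypothesis. -/
def evaluation : Cmd :=
  .seq features <|
  .seq (dot 22) <|
  .seq threshold <|
  .ite (.rlt (.mul (.cast (.reg 10)) (.sub (.mul (.const 2) (.mem (.const 13))) (.const 1)))
    (.mem (.const 11))) (.nset 0 (.const 1)) (.nset 0 (.const 0))

def inner (d : ℕ) (w V : ℕ → ℝ) : ℝ := ∑ j ∈ Finset.range d, w j * V j

theorem sim_dot {o d : ℕ} {w V : ℕ → ℝ} (ho : 21 ≤ o) (h8 : s.nreg 8 = d)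
    (hw : ∀ j < d, s.rmem (3 * j + o) = w j) (hV : ∀ j < d, s.rmem (3 * j + 23) = V j) :
    Sim O (dot o) s (d * 40 + 20) (Rnd.ret ()) fun _ s' =>
      s'.rmem 11 = inner d w V ∧ (∀ r ≠ 15, s'.nreg r = s.nreg r) ∧
      (∀ a ≠ 11, s'.rmem a = s.rmem a) ∧ s'.pmem = s.pmem := by
  refine Sim.time (Sim.rset_seq (Sim.nset_seq (Sim.post (Sim.det_forLoop (n := d) (τ := 31)
    (I := fun i s' => s'.nreg 15 = i ∧ s'.rmem 11 = inner i w V ∧ (∀ r ≠ 15, s'.nreg r = s.nreg r) ∧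
      (∀ a ≠ 11, s'.rmem a = s.rmem a) ∧ s'.pmem = s.pmem) ?_ ?_ ?_) ?_))) ?_
  · rintro i s' ⟨h, -, hf, -⟩
    exact ⟨h, by simp [NExp.eval, hf 8, h8]⟩
  · rintro i s' hi ⟨h15, ha, hn, hr, hp⟩
    refine Sim.time (Sim.rset ?_) ?_
    · refine ⟨by simp [h15], ?_, fun r hr' => ?_, fun a ha' => ?_, hp⟩
      · simp only [NExp.eval, RExp.eval, cell_eval, h15, Function.update_self, ha]
        rw [hr _ (by omega), hr _ (by omega), hw i hi, hV i hi, inner, inner, Finset.sum_range_succ]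
      · simp [hr', hn r hr']
      · simp [NExp.eval, ha', hr a ha']
    · simp [NExp.size, RExp.size, cell_size]
  · refine ⟨by simp [NExp.eval], by simp [NExp.eval, RExp.eval, inner], fun r hr => by simp [hr],
      fun a ha => by simp [NExp.eval, ha], rfl⟩
  · rintro _ s' ⟨-, h⟩; exact h
  · simp only [NExp.size, RExp.size]; omega

/-- Projection to the interval `[-z, z]`. -/
def clip (z x : ℝ) : ℝ := max (min z x) (-z)

/-- The subgradient step for the loss `|a - y|`. -/
def stepSize (η a y : ℝ) : ℝ := if a < y then η else -η

theorem sim_updateOne {z i : ℕ} (h7 : s.nreg 7 = z) (h15 : s.nreg 15 = i) :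
    Sim O updateOne s 160 (Rnd.ret ()) fun _ s' =>
      s'.rmem (3 * i + 22) = s.rmem (3 * i + 22) + s.rmem (3 * i + 21) ∧
      s'.rmem (3 * i + 21) = clip z (s.rmem (3 * i + 21) + s.rmem 12 * s.rmem (3 * i + 23)) ∧
      (∀ a, a ≠ 3 * i + 21 → a ≠ 3 * i + 22 → s'.rmem a = s.rmem a) ∧
      s'.nreg = s.nreg ∧ s'.pmem = s.pmem := by
  set x := s.rmem (3 * i + 21) + s.rmem 12 * s.rmem (3 * i + 23) with hx
  -- The first conditional assignment takes the minimum with `z`, the second the maximum with `-z`.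
  refine Sim.time (Sim.rset_seq (Sim.rset_seq (Sim.det_seq (τ₁ := 50) (τ₂ := 50) (R := fun s' =>
      s'.rmem (3 * i + 22) = s.rmem (3 * i + 22) + s.rmem (3 * i + 21) ∧
      s'.rmem (3 * i + 21) = min (z : ℝ) x ∧
      (∀ a, a ≠ 3 * i + 21 → a ≠ 3 * i + 22 → s'.rmem a = s.rmem a) ∧
      s'.nreg = s.nreg ∧ s'.pmem = s.pmem) ?_ ?_))) ?_
  · have hv : ((s.rmem (3 * i + 21) + s.rmem 12 * s.rmem (3 * i + 23))) = x := rfl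
    refine Sim.time (Sim.ite (τ := 20) (fun h => Sim.time (Sim.rset ?_) ?_) fun h => Sim.time (Sim.skip ?_) ?_) ?_
    · simp [Test.holds, RExp.eval, NExp.eval, h15, h7] at h
      rw [hv] at h
      refine ⟨?_, ?_, ?_, rfl, rfl⟩
      · simp [NExp.eval, RExp.eval, h15]
      · simp [NExp.eval, RExp.eval, h15, h7, h.le]
      · intro a ha ha'
        simp [h15, ha, ha']
    · simp [NExp.size, RExp.size, cell_size]
    · simp [Test.holds, RExp.eval, NExp.eval, h15, h7] at h
      rw [hv] at h
      refine ⟨?_, ?_, ?_, rfl, rfl⟩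
      · simp [NExp.eval, RExp.eval, h15]
      · simp [NExp.eval, RExp.eval, h15, h, ← hx]
      · intro a ha ha'
        simp [h15, ha, ha']
    · simp
    · simp [NExp.size, RExp.size, cell_size, Test.cost]
  · rintro s₁ ⟨h1, h2, h3, h4, h5⟩
    have h15' : s₁.nreg 15 = i := by rw [h4, h15]
    have h7' : s₁.nreg 7 = z := by rw [h4, h7]
    refine Sim.time (Sim.ite (τ := 20) (fun h => Sim.time (Sim.rset ?_) ?_) fun h => Sim.time (Sim.skip ?_) ?_) ?_
    · simp only [Test.holds, RExp.eval, NExp.eval, cell_eval, h15', h7', h2, Int.cast_zero, zero_sub] at h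
      refine ⟨?_, ?_, ?_, h4, h5⟩
      · simp [h15', h1]
      · simp only [cell_eval, h15', Function.update_self, RExp.eval, NExp.eval, h7', Int.cast_zero, zero_sub]
        rw [clip, max_eq_right h.le]
      · intro a ha ha'
        simp [h15', ha, h3 a ha ha']
    · simp [NExp.size, RExp.size, cell_size]
    · simp only [Test.holds, RExp.eval, NExp.eval, cell_eval, h15', h7', h2, Int.cast_zero, zero_sub, not_lt] at h
      exact ⟨h1, by rw [clip, max_eq_left h, h2], h3, h4, h5⟩
    · simp
    · simp [NExp.size, RExp.size, cell_size, Test.cost]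
  · simp [NExp.size, RExp.size, cell_size]

theorem sim_updateAll {z d : ℕ} {η a y : ℝ} {w A V : ℕ → ℝ} (h7 : s.nreg 7 = z)
    (h8 : s.nreg 8 = d) (h10 : s.rmem 10 = y) (h11 : s.rmem 11 = a) (h14 : s.rmem 14 = η)
    (hw : ∀ j < d, s.rmem (3 * j + 21) = w j) (hA : ∀ j < d, s.rmem (3 * j + 22) = A j)
    (hV : ∀ j < d, s.rmem (3 * j + 23) = V j) :
    Sim O updateAll s (d * 180 + 40) (Rnd.ret ()) fun _ s' =>
      (∀ j < d, s'.rmem (3 * j + 21) = clip z (w j + stepSize η a y * V j)) ∧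
      (∀ j < d, s'.rmem (3 * j + 22) = A j + w j) ∧
      (∀ b < 21, b ≠ 12 → s'.rmem b = s.rmem b) ∧
      (∀ r ≠ 15, s'.nreg r = s.nreg r) ∧ s'.pmem = s.pmem := by
  refine Sim.time (Sim.det_seq (τ₁ := 20) (τ₂ := d * 180 + 10) (R := fun s' =>
      s'.rmem 12 = stepSize η a y ∧ (∀ b ≠ 12, s'.rmem b = s.rmem b) ∧
      s'.nreg = s.nreg ∧ s'.pmem = s.pmem) ?_ ?_) ?_
  · refine Sim.time (Sim.ite (τ := 10) (fun h => Sim.time (Sim.rset ?_) ?_) fun h => Sim.time (Sim.rset ?_) ?_) ?_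
    · simp only [Test.holds, RExp.eval, NExp.eval, h10, h11] at h
      refine ⟨by simp [NExp.eval, RExp.eval, stepSize, h, h14], fun b hb => by simp [NExp.eval, hb], rfl, rfl⟩
    · simp [NExp.size, RExp.size]
    · simp only [Test.holds, RExp.eval, NExp.eval, h10, h11] at h
      refine ⟨by simp [NExp.eval, RExp.eval, stepSize, h, h14], fun b hb => by simp [NExp.eval, hb], rfl, rfl⟩
    · simp [NExp.size, RExp.size]
    · simp [NExp.size, RExp.size, Test.cost]
  · rintro s₁ ⟨e12, e1, e2, e3⟩
    refine Sim.time (Sim.nset_seq (Sim.post (Sim.det_forLoop (n := d) (τ := 160)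
      -- Entries below `i` are updated, entries from `i` on still have their old values.
      (I := fun i s' => s'.nreg 15 = i ∧
        (∀ j < i, s'.rmem (3 * j + 21) = clip z (w j + stepSize η a y * V j)) ∧
        (∀ j < i, s'.rmem (3 * j + 22) = A j + w j) ∧
        (∀ j, i ≤ j → j < d → s'.rmem (3 * j + 21) = w j) ∧
        (∀ j, i ≤ j → j < d → s'.rmem (3 * j + 22) = A j) ∧
        (∀ j < d, s'.rmem (3 * j + 23) = V j) ∧
        (∀ b < 21, s'.rmem b = s₁.rmem b) ∧
        (∀ r ≠ 15, s'.nreg r = s₁.nreg r) ∧ s'.pmem = s₁.pmem) ?_ ?_ ?_) ?_)) ?_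
    · rintro i s' ⟨h, -, -, -, -, -, -, hf, -⟩
      exact ⟨h, by simp [NExp.eval, hf 8, e2, h8]⟩
    · rintro i s' hi ⟨k15, k1, k2, k3, k4, k5, k6, k7, k8⟩
      refine Sim.post (sim_updateOne (z := z) (i := i) (by rw [k7 7 (by norm_num), e2, h7]) k15) ?_
      rintro _ s'' ⟨l1, l2, l3, l4, l5⟩
      refine ⟨by simp [l4, k15], fun j hj => ?_, fun j hj => ?_, fun j hj hjd => ?_, fun j hj hjd => ?_,
        fun j hj => ?_, fun b hb => ?_, fun r hr => ?_, l5.trans k8⟩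
      · by_cases hji : j = i
        · subst hji
          simp only [l2, k3 j le_rfl hi, k5 j hi, k6 12 (by norm_num), e12]
        · simp only [l3 (3 * j + 21) (by omega) (by omega), k1 j (by omega)]
      · by_cases hji : j = i
        · subst hji
          simp only [l1, k3 j le_rfl hi, k4 j le_rfl hi]
        · simp only [l3 (3 * j + 22) (by omega) (by omega), k2 j (by omega)]
      · simp only [l3 (3 * j + 21) (by omega) (by omega), k3 j (by omega) hjd]
      · simp only [l3 (3 * j + 22) (by omega) (by omega), k4 j (by omega) hjd]
      · simp only [l3 (3 * j + 23) (by omega) (by omega), k5 j hj]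
      · simp only [l3 b (by omega) (by omega), k6 b hb]
      · simp [hr, l4, k7 r hr]
    · refine ⟨by simp [NExp.eval], by simp, by simp, fun j _ hj => ?_, fun j _ hj => ?_, fun j hj => ?_, fun _ _ => rfl, fun r hr => by simp [hr], rfl⟩
      · simp only [e1 (3 * j + 21) (by omega), hw j hj]
      · simp only [e1 (3 * j + 22) (by omega), hA j hj]
      · simp only [e1 (3 * j + 23) (by omega), hV j hj]
    · rintro _ s' ⟨-, k1, k2, -, -, -, k6, k7, k8⟩
      exact ⟨k1, k2, fun b hb hb' => (k6 b hb).trans (e1 b hb'), fun r hr => by rw [k7 r hr, e2], k8.trans e3⟩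
    · simp only [NExp.size]; nlinarith
  · omega

/-- One step of stochastic subgradient descent for the absolute loss, on the weights and the sum
of the weights so far. -/
def Oracles.descentStep [Fintype X] (O : Oracles X) (z d q : ℕ) (η : ℝ) (pts : ℕ → Option X)
    (a : (ℕ → ℝ) × (ℕ → ℝ)) : Rnd ((ℕ → ℝ) × (ℕ → ℝ)) :=
  .samp inferInstance O.labelled fun e => (O.featModel z q pts e.1).map fun V =>
    (fun j => clip z (a.1 j + stepSize η (inner d a.1 V) ((e.2 : ℤˣ) : ℤ) * V j),
      fun j => a.2 j + a.1 j)

def Oracles.descentModel [Fintype X] (O : Oracles X) (z d q : ℕ) (η : ℝ) (pts : ℕ → Option X) :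
    Rnd ((ℕ → ℝ) × (ℕ → ℝ)) :=
  Rnd.iter (fun _ => O.descentStep z d q η pts) q (fun _ => 0, fun _ => 0)

def Oracles.memorizeModel [Fintype X] (O : Oracles X) (z : ℕ) : Rnd (ℕ → Option X) :=
  Rnd.iter (fun i pts => .samp inferInstance O.labelled fun e =>
    .ret (Function.update pts i (some e.1))) z fun _ => none

/-- The registers hold the constants of the learner. -/
structure HasConstants (O : Oracles X) (z d q : ℕ) (s : Store X) : Prop where
  nreg3 : s.nreg 3 = O.M
  nreg7 : s.nreg 7 = z
  nreg8 : s.nreg 8 = d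
  nreg10 : s.nreg 10 = q

theorem HasConstants.of_eq {z d q : ℕ} {s' : Store X} (h : HasConstants O z d q s)
    (h' : ∀ r < 11, s'.nreg r = s.nreg r) : HasConstants O z d q s' :=
  ⟨by rw [h' 3 (by norm_num), h.1], by rw [h' 7 (by norm_num), h.2],
    by rw [h' 8 (by norm_num), h.3], by rw [h' 10 (by norm_num), h.4]⟩

def descentTime (n M z d q : ℕ) : ℕ := q * (featTime n M z d q + d * 230 + n + 100) + 20

/-- The round counter is register `11`, just below the registers that `features` may overwrite. -/
theorem sim_descent [Fintype X] {z d q : ℕ} {η : ℝ} {pts : ℕ → Option X}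
    (hc : HasConstants O z d q s) (h14 : s.rmem 14 = η) (hp : ∀ j, s.pmem (j + 2) = pts j)
    (hw : ∀ j < d, s.rmem (3 * j + 21) = 0) (hA : ∀ j < d, s.rmem (3 * j + 22) = 0) :
    Sim O descent s (descentTime O.n O.M z d q) (O.descentModel z d q η pts) fun a s' =>
      HasConstants O z d q s' ∧ (∀ j, s'.pmem (j + 2) = pts j) ∧
      ∀ j < d, s'.rmem (3 * j + 22) = a.2 j := by
  refine Sim.time (Sim.nset_seq (Sim.post (Sim.forLoop (n := q)
    (f := fun _ => O.descentStep z d q η pts)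
    (τ := featTime O.n O.M z d q + d * 230 + O.n + 80)
    (I := fun i a s' => s'.nreg 11 = i ∧ HasConstants O z d q s' ∧ s'.rmem 14 = η ∧
      (∀ j, s'.pmem (j + 2) = pts j) ∧ (∀ j < d, s'.rmem (3 * j + 21) = a.1 j) ∧
      ∀ j < d, s'.rmem (3 * j + 22) = a.2 j) ?_ ?_ ?_) ?_)) ?_
  · rintro i a s' ⟨h, hf, -⟩
    exact ⟨h, hf.nreg10⟩
  · rintro i ⟨w, A⟩ s' hi ⟨h11, hc, h14, hp, hw, hA⟩
    refine Sim.time (Sim.weaken (Sim.seq (Sim.draw (f := id)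
      (R := fun e s₁ => s₁.nreg 11 = i ∧ HasConstants O z d q s₁ ∧ s₁.rmem 14 = η ∧
        (∀ j, s₁.pmem (j + 2) = pts j) ∧ s₁.pmem 0 = some e.1 ∧ s₁.rmem 10 = ((e.2 : ℤˣ) : ℤ) ∧
        (∀ j < d, s₁.rmem (3 * j + 21) = w j) ∧ ∀ j < d, s₁.rmem (3 * j + 22) = A j) ?_)
      (R' := fun (a : (ℕ → ℝ) × (ℕ → ℝ)) s' => s'.nreg 11 = i ∧ HasConstants O z d q s' ∧ s'.rmem 14 = η ∧
        (∀ j, s'.pmem (j + 2) = pts j) ∧ (∀ j < d, s'.rmem (3 * j + 21) = a.1 j) ∧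
        ∀ j < d, s'.rmem (3 * j + 22) = a.2 j)
      (τ₂ := featTime O.n O.M z d q + d * 230 + 70)
      (f := fun e => (O.featModel z q pts e.1).map fun V =>
        (fun j => clip z (w j + stepSize η (inner d w V) ((e.2 : ℤˣ) : ℤ) * V j),
          fun j => A j + w j)) ?_) le_rfl (fun _ => rfl) ?_) ?_
    · intro e
      refine ⟨h11, hc.of_eq fun _ _ => rfl, by simp [NExp.eval, h14], fun j => by simp [NExp.eval, hp],
        by simp [NExp.eval], by simp [NExp.eval], fun j hj => ?_, fun j hj => ?_⟩
      · simp only [NExp.eval, Function.update_apply]; rw [if_neg (by omega), hw j hj]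
      · simp only [NExp.eval, Function.update_apply]; rw [if_neg (by omega), hA j hj]
    · rintro ⟨x, y⟩ s₁ ⟨h11, hc, h14, hp, h0, h10, hw, hA⟩
      refine Sim.time (Sim.seq (sim_features hc.nreg3 hc.nreg7 hc.nreg8 hc.nreg10 h0 hp)
        (τ₂ := d * 230 + 65) ?_) ?_
      · rintro V s₂ ⟨hf, hV⟩
        have hc2 : HasConstants O z d q s₂ := hc.of_eq fun r hr => hf.nreg r (by omega)
        have hw2 : ∀ j < d, s₂.rmem (3 * j + 21) = w j := fun j hj => by
          rw [hf.rmem _ (by omega) (by omega), hw j hj]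
        have hA2 : ∀ j < d, s₂.rmem (3 * j + 22) = A j := fun j hj => by
          rw [hf.rmem _ (by omega) (by omega), hA j hj]
        refine Sim.time (Sim.det_seq (sim_dot le_rfl hc2.nreg8 hw2 hV)
          (τ₂ := d * 180 + 40) ?_) ?_
        · rintro s₃ ⟨ha, hn, hr, hp3⟩
          have hc3 : HasConstants O z d q s₃ := hc2.of_eq fun r hr => hn r (by omega)
          refine Sim.post (Sim.map (sim_updateAll (z := z) (η := η) (w := w) (A := A) (V := V)
            hc3.nreg7 hc3.nreg8 rfl ha ?_ ?_ ?_ ?_) (fun _ =>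
              (fun j => clip z (w j + stepSize η (inner d w V) ((y : ℤˣ) : ℤ) * V j),
                fun j => A j + w j)) (R' := fun (a : (ℕ → ℝ) × (ℕ → ℝ)) s' => s'.nreg 11 = i ∧ HasConstants O z d q s' ∧ s'.rmem 14 = η ∧
        (∀ j, s'.pmem (j + 2) = pts j) ∧ (∀ j < d, s'.rmem (3 * j + 21) = a.1 j) ∧
        ∀ j < d, s'.rmem (3 * j + 22) = a.2 j) ?_) fun _ _ h => h
          · rw [hr _ (by norm_num), hf.rmem _ (by norm_num) (by norm_num), h14]
          · intro j hj; rw [hr _ (by omega), hw2 j hj]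
          · intro j hj; rw [hr _ (by omega), hA2 j hj]
          · intro j hj; rw [hr _ (by omega), hV j hj]
          · rintro _ s₄ ⟨k1, k2, k3, k4, k5⟩
            have e10 : s₃.rmem 10 = ((y : ℤˣ) : ℤ) := by
              rw [hr _ (by norm_num), hf.rmem _ (by norm_num) (by norm_num), h10]
            rw [e10] at k1
            refine ⟨?_, hc3.of_eq fun r hr => k4 r (by omega), ?_, ?_, k1, k2⟩
            · rw [k4 _ (by norm_num), hn _ (by norm_num), hf.nreg _ (by norm_num), h11]
            · rw [k3 _ (by norm_num) (by norm_num), hr _ (by norm_num), hf.rmem _ (by norm_num) (by norm_num), h14]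
            · intro j; rw [k5, hp3, hf.pmem _ (by omega), hp]
        · omega
      · omega
    · rintro ⟨w', A'⟩ s'' ⟨k11, k⟩
      exact ⟨by simp [k11], k.1.of_eq fun r hr => Function.update_of_ne (by omega) _ _, k.2⟩
    · simp only [NExp.size]; omega
  · refine ⟨by simp [NExp.eval], hc.of_eq fun r hr => Function.update_of_ne (by omega) _ _, h14, hp, hw, hA⟩
  · rintro a s' ⟨-, hc, -, hp, -, hA⟩; exact ⟨hc, hp, hA⟩
  · simp only [NExp.size, descentTime]; nlinarith

theorem sim_memorize [Fintype X] {z d q : ℕ} (hc : HasConstants O z d q s)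
    (hp : ∀ j, s.pmem (j + 2) = none) :
    Sim O memorize s (z * (O.n + 20) + 20) (O.memorizeModel z) fun pts s' =>
      HasConstants O z d q s' ∧ (∀ j, s'.pmem (j + 2) = pts j) ∧
      ∀ a ≠ 10, s'.rmem a = s.rmem a := by
  refine Sim.time (Sim.nset_seq (Sim.post (Sim.forLoop (n := z) (τ := O.n + 8)
    (I := fun i pts s' => s'.nreg 11 = i ∧ HasConstants O z d q s' ∧
      (∀ j, s'.pmem (j + 2) = pts j) ∧ ∀ a ≠ 10, s'.rmem a = s.rmem a) ?_ ?_ ?_) ?_)) ?_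
  · rintro i a s' ⟨h, hf, -⟩
    exact ⟨h, hf.nreg7⟩
  · rintro i pts s' hi ⟨h11, hc, hp, hr⟩
    refine Sim.time (Sim.draw fun e => ?_) ?_
    · refine ⟨by simp [h11], hc.of_eq fun r hr => Function.update_of_ne (by omega) _ _, fun j => ?_, fun a ha => by simp [NExp.eval, ha, hr a ha]⟩
      simp [NExp.eval, h11, Function.update_apply, hp]
    · simp only [NExp.size]; omega
  · exact ⟨by simp [NExp.eval], hc.of_eq fun r hr => Function.update_of_ne (by omega) _ _, hp, fun _ _ => rfl⟩
  · rintro a s' ⟨-, h⟩; exact h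
  · simp only [NExp.size]; nlinarith

/-- Each new bit becomes the leading one; this is what makes `belowProb_succ` a recursion by
doubling. -/
def coinModel (z : ℕ) : Rnd ℝ :=
  Rnd.iter (fun _ u => .samp inferInstance (PMF.uniformOfFintype (Fin 2)) fun v =>
    .ret ((u + (v.val : ℝ)) / 2)) z 0

theorem sim_threshold {z : ℕ} (h7 : s.nreg 7 = z) :
    Sim O threshold s (z * 30 + 20) (coinModel z) fun u s' =>
      s'.rmem 13 = u ∧ (∀ r < 14, s'.nreg r = s.nreg r) ∧ ∀ a ≠ 13, s'.rmem a = s.rmem a := by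
  refine Sim.time (Sim.rset_seq (Sim.nset_seq (Sim.post (Sim.forLoop (n := z) (τ := 20)
    (I := fun i u s' => s'.nreg 15 = i ∧ s'.rmem 13 = u ∧ (∀ r < 14, s'.nreg r = s.nreg r) ∧
      ∀ a ≠ 13, s'.rmem a = s.rmem a) ?_ ?_ ?_) ?_))) ?_
  · rintro i a s' ⟨h, -, hf, -⟩
    exact ⟨h, by simp [NExp.eval, hf 7, h7]⟩
  · rintro i u s' hi ⟨h15, hu, hn, hr⟩
    refine Sim.time (Sim.weaken (Sim.seq (Sim.coin (f := id)
      (R := fun v s₁ => s₁ = ⟨Function.update s'.nreg 14 v.val, s'.rmem, s'.pmem⟩) fun v => rfl)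
      (f := fun v => .ret ((u + (v.val : ℝ)) / 2)) fun v s₁ h => Sim.rset (R := fun u s'' =>
        s''.nreg 15 = i ∧ s''.rmem 13 = u ∧ (∀ r < 14, s''.nreg r = s.nreg r) ∧
      ∀ a ≠ 13, s''.rmem a = s.rmem a) ?_) le_rfl (fun _ => rfl) ?_) ?_
    · subst h
      refine ⟨by simp [h15], by simp [NExp.eval, RExp.eval, hu], fun r hr' => ?_, fun a ha => by simp [NExp.eval, ha, hr a ha]⟩
      simp only [Function.update_apply]; rw [if_neg (by omega), hn r hr']
    · rintro u' s'' ⟨k15, k⟩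
      refine ⟨by simp [k15], k.1, fun r hr => ?_, k.2.2⟩
      simp only [Function.update_apply]; rw [if_neg (by omega), k.2.1 r hr]
    · simp [NExp.size, RExp.size]
  · refine ⟨by simp [NExp.eval], by simp [NExp.eval, RExp.eval], fun r hr => ?_, fun a ha => by simp [NExp.eval, ha]⟩
    simp only [Function.update_apply]; rw [if_neg (by omega)]
  · rintro a s' ⟨-, h⟩; exact h
  · simp only [NExp.size, RExp.size]; nlinarith

/-- The law of the label that the hypothesis with weights `A / q` assigns to `x`. -/
def Oracles.evalModel [Fintype X] (O : Oracles X) (z d q : ℕ) (pts : ℕ → Option X) (A : ℕ → ℝ)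
    (x : X) : Rnd ℤˣ :=
  (O.featModel z q pts x).bind fun V => (coinModel z).map fun u =>
    open Classical in if q * (2 * u - 1) < inner d A V then 1 else -1

def evalTime (n M z d q : ℕ) : ℕ := featTime n M z d q + d * 40 + z * 30 + 90

theorem sim_evaluation [Fintype X] {z d q : ℕ} {pts : ℕ → Option X} {A : ℕ → ℝ} {x : X}
    (hc : HasConstants O z d q s) (h0 : s.pmem 0 = some x) (hp : ∀ j, s.pmem (j + 2) = pts j)
    (hA : ∀ j < d, s.rmem (3 * j + 22) = A j) :
    Sim O evaluation s (evalTime O.n O.M z d q) (O.evalModel z d q pts A x) fun y s' =>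
      s'.label = y := by
  refine Sim.time (Sim.seq (sim_features hc.nreg3 hc.nreg7 hc.nreg8 hc.nreg10 h0 hp)
    (τ₂ := d * 40 + z * 30 + 80) ?_) ?_
  · rintro V s₂ ⟨hf, hV⟩
    have hc2 : HasConstants O z d q s₂ := hc.of_eq fun r hr => hf.nreg r (by omega)
    have hA2 : ∀ j < d, s₂.rmem (3 * j + 22) = A j := fun j hj => by
      rw [hf.rmem _ (by omega) (by omega), hA j hj]
    refine Sim.time (Sim.det_seq (sim_dot (by norm_num) hc2.nreg8 hA2 hV) (τ₂ := z * 30 + 50) ?_) ?_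
    · rintro s₃ ⟨ha, hn, hr, hp3⟩
      have hc3 : HasConstants O z d q s₃ := hc2.of_eq fun r hr => hn r (by omega)
      refine Sim.time (Sim.seq (sim_threshold hc3.nreg7) (τ₂ := 25) ?_) ?_
      · rintro u s₄ ⟨k1, k2, k3⟩
        have hc4 : HasConstants O z d q s₄ := hc3.of_eq fun r hr => k2 r (by omega)
        refine Sim.time (Sim.ite (τ := 5) (fun h => Sim.time (Sim.nset ?_) ?_) fun h => Sim.time (Sim.nset ?_) ?_) ?_
        · simp only [Test.holds, RExp.eval, NExp.eval, hc4.nreg10, k1, k3 11 (by norm_num), ha] at h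
          beta_reduce
          rw [if_pos (by exact_mod_cast h)]
          simp [Store.label, NExp.eval]
        · simp [NExp.size]
        · simp only [Test.holds, RExp.eval, NExp.eval, hc4.nreg10, k1, k3 11 (by norm_num), ha] at h
          beta_reduce
          rw [if_neg (by exact_mod_cast h)]
          simp [Store.label, NExp.eval]
        · simp [NExp.size]
        · simp [NExp.size, RExp.size, Test.cost]
      · omega
    · omega
  · simp only [evalTime]; omega

end

section

/-! ## The constants of the learner -/

namespace Params

/-- An upper bound for `1 / ε` that is at least `1`. -/
def invEps (p : Params) : ℝ := 1 + 1 / p.ε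

open Classical in
/-- The ratio of the spectral gaps, made at least `1 / 4`. -/
def ratio (p : Params) : ℝ := if p.γ < 1 / 4 then 1 / 4 else p.γ

open Classical in
/-- The exponent, which is irrelevant when there is a single block with a single element. -/
def expo (p : Params) : ℝ := if p.N + p.k < 3 then 0 else p.c

open Classical in
/-- The number of blocks that can be nonempty. -/
def blocks (p : Params) : ℕ := if p.expo < 1 then 1 else p.k

/-- The precision that the walk has to reach when the coefficients are at most `B`. -/
def precision (p : Params) (B : ℝ) : ℝ := 8 * p.blocks * p.N * (1 + p.α) * p.invEps * B

/-- The length of the walk that reaches this precision. -/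
def walkLength (p : Params) (B : ℝ) : ℕ := sInf {t : ℕ | p.precision B ≤ p.ratio⁻¹ ^ t}

/-- Eigenvalues in the blocks are at least `γ ^ expo`, so when `ratio` is `γ`, this power of
`ratio⁻¹` dominates `λ^(-t)` for `t` the walk length. Being an integer power, it can be computed by
repeated division. -/
def lossLength (p : Params) (B : ℝ) : ℕ := ⌈(p.walkLength B : ℝ) * p.expo⌉₊

/-- The bound for the coefficients after one more block. -/
def nextBound (p : Params) (B : ℝ) : ℝ :=
  B * (1 + p.N * (1 + p.α) * p.ratio⁻¹ ^ p.lossLength B)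

def coeffBound (p : Params) : ℕ → ℝ
  | 0 => 1
  | j + 1 => p.nextBound (p.coeffBound j)

/-- Walk lengths increase with the coefficient bound, so the length found last, which is the one
still in the register, is the longest. -/
def lastLength (p : Params) : ℕ → ℕ
  | 0 => 0
  | j + 1 => p.walkLength (p.coeffBound j)

/-- One number in four roles: bound for the weights, length of the walks, number of memorized
points, number of bits of the threshold. The last summand makes the expected missing mass small
compared with `δ ε`. -/
def size (p : Params) : ℕ :=
  ⌈p.coeffBound p.blocks + p.lastLength p.blocks + 32 * p.N * p.invEps / p.δ⌉₊

/-- One indicator per memorized point and `M` averages for each of the times `0, …, size`. -/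
def dim (p : Params) : ℕ := p.size + p.M * (p.size + 1)

def root (p : Params) : ℕ := ⌈64 * p.dim * p.size * p.invEps / p.δ⌉₊

/-- The number of descent steps and also the number of walks per point. It is a square so that the
step size and the standard deviation of the features involve no square root. -/
def rounds (p : Params) : ℕ := p.root * p.root

def rate (p : Params) : ℝ := p.size / p.root

/-- The total length of the searches in all blocks, used as a common bound for those in a single
block. -/
def searchBound (p : Params) : ℕ :=
  ∑ j ∈ Finset.range p.blocks,
    (p.walkLength (p.coeffBound j) + p.lossLength (p.coeffBound j))

def setupTime (p : Params) : ℕ :=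
  p.blocks * (p.searchBound * 50 + 200) + (p.size + p.dim + p.root + p.rounds) * 50 + 400

end Params

/-- Set register `r` to the least natural number that is not below `e`. -/
def ceilTo (r : ℕ) (e : RExp) : Cmd :=
  .seq (.nset r (.const 0)) (.loop (.rlt (.cast (.reg r)) e) (incr r))

def mem (a : ℕ) : RExp := .mem (.const a)

def nat (r : ℕ) : RExp := .cast (.reg r)

/-- One step of the recursion for the coefficient bound. -/
def blockStep : Cmd :=
  .seq (.rset (.const 7) (.mul (.mul (.mul (.mul (.mul (.const 8) (nat 2)) (nat 1))
    (.add (.const 1) (mem 2))) (mem 5)) (mem 6))) <|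
  .seq (.seq (.nset 4 (.const 0)) <| .seq (.rset (.const 8) (.const 1)) <|
    .loop (.rlt (mem 8) (mem 7)) <| .seq (.rset (.const 8) (.div (mem 8) (mem 0))) <| incr 4) <|
  .seq (.seq (.nset 5 (.const 0)) <| .seq (.rset (.const 9) (.const 1)) <|
    .loop (.rlt (nat 5) (.mul (nat 4) (mem 1))) <|
      .seq (.rset (.const 9) (.div (mem 9) (mem 0))) <| incr 5) <|
  .rset (.const 6) (.mul (mem 6)
    (.add (.const 1) (.mul (.mul (nat 1) (.add (.const 1) (mem 2))) (mem 9))))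

def normalize : Cmd :=
  .seq (.rset (.const 5) (.add (.const 1) (.div (.const 1) (mem 3)))) <|
  .seq (.ite (.rlt (mem 0) (.div (.const 1) (.const 4)))
    (.rset (.const 0) (.div (.const 1) (.const 4))) .skip) <|
  .seq (.ite (.nlt (.add (.reg 1) (.reg 2)) (.const 3)) (.rset (.const 1) (.const 0)) .skip) <|
  .seq (.ite (.rlt (mem 1) (.const 1)) (.nset 2 (.const 1)) .skip) <|
  .rset (.const 6) (.const 1)

/-- Integer expressions have no products, so `dim` and `rounds` too are obtained as ceilings of real
expressions. Counting up to them costs time proportional to their values. -/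
def setConstants : Cmd :=
  .seq (ceilTo 7 (.add (.add (mem 6) (nat 4))
    (.div (.mul (.mul (.const 32) (nat 1)) (mem 5)) (mem 4)))) <|
  .seq (ceilTo 8 (.add (nat 7) (.mul (nat 3) (.add (nat 7) (.const 1))))) <|
  .seq (ceilTo 9 (.div (.mul (.mul (.mul (.const 64) (nat 8)) (nat 7)) (mem 5)) (mem 4))) <|
  .seq (ceilTo 10 (.mul (nat 9) (nat 9))) <|
  .rset (.const 14) (.div (nat 7) (nat 9))

/-- Compute the constants. -/
def setup : Cmd :=
  .seq normalize <| .seq (.nset 6 (.const 0)) <| .seq (forLoop 6 (.reg 2) blockStep) setConstants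

/-! ### Correctness of the program that computes the constants. -/

variable {X : Type} {O : Oracles X} {s : Store X} {τ : ℕ}

/-- The state of the computation of the constants. -/
structure SetupState (p : Params) (B : ℝ) (t : ℕ) (s : Store X) : Prop where
  nreg1 : s.nreg 1 = p.N
  nreg2 : s.nreg 2 = p.blocks
  nreg3 : s.nreg 3 = p.M
  nreg4 : s.nreg 4 = t
  rmem0 : s.rmem 0 = p.ratio
  rmem1 : s.rmem 1 = p.expo
  rmem2 : s.rmem 2 = p.α
  rmem4 : s.rmem 4 = p.δ
  rmem5 : s.rmem 5 = p.invEps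
  rmem6 : s.rmem 6 = B
  high : ∀ a, 21 ≤ a → s.rmem a = 0
  pmem : ∀ a, s.pmem a = none

/-- The assumption says that the value of `e` does not depend on the counter, so the linear search
has a fixed target. -/
theorem sim_ceilTo {r : ℕ} {e : RExp} {x : ℝ}
    (he : ∀ i, e.eval (Store.mk (Function.update s.nreg r i) s.rmem s.pmem) = x) :
    Sim O (ceilTo r e) s (⌈x⌉₊ * (e.size + 8) + e.size + 8) (Rnd.ret ()) fun _ s' =>
      s' = ⟨Function.update s.nreg r ⌈x⌉₊, s.rmem, s.pmem⟩ := by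
  refine Sim.time (Sim.nset_seq (Sim.det_loop (n := ⌈x⌉₊) (τ := 4)
    (I := fun i s' => s' = ⟨Function.update s.nreg r i, s.rmem, s.pmem⟩) ?_ ?_ ?_)) ?_
  · rintro i s' - rfl
    simp [Test.holds, he, RExp.eval, NExp.eval, Nat.lt_ceil]
  · rintro i s' - rfl
    exact Sim.nset (by simp [NExp.eval])
  · simp [NExp.eval]
  · simp only [NExp.size, RExp.size, Test.cost]; nlinarith

theorem Params.ratio_pos {p : Params} (h : 0 < p.γ) : 0 < p.ratio := by
  unfold Params.ratio; split_ifs <;> linarith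

theorem Params.ratio_lt_one {p : Params} (h : p.γ < 1) : p.ratio < 1 := by
  unfold Params.ratio; split_ifs <;> linarith

theorem Params.precision_le {p : Params} (h0 : 0 < p.γ) (h1 : p.γ < 1) (B : ℝ) :
    p.precision B ≤ p.ratio⁻¹ ^ p.walkLength B := by
  have : {t : ℕ | p.precision B ≤ p.ratio⁻¹ ^ t}.Nonempty := by
    obtain ⟨t, ht⟩ := pow_unbounded_of_one_lt (p.precision B)
      ((one_lt_inv₀ (ratio_pos h0)).2 (ratio_lt_one h1))
    exact ⟨t, ht.le⟩
  exact Nat.sInf_mem this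

/-- The powers of `ratio⁻¹` increase, so the search by repeated division stops exactly at the
infimum. -/
theorem Params.lt_walkLength_iff {p : Params} (h0 : 0 < p.γ) (h1 : p.γ < 1) {B : ℝ} {i : ℕ} :
    p.ratio⁻¹ ^ i < p.precision B ↔ i < p.walkLength B := by
  constructor
  · intro h
    by_contra h'
    push Not at h'
    have := pow_le_pow_right₀ ((one_le_inv₀ (ratio_pos h0)).2 (ratio_lt_one h1).le) h'
    linarith [precision_le h0 h1 B]
  · intro h
    have := Nat.notMem_of_lt_sInf h
    simpa using this

theorem sim_blockStep {p : Params} {B : ℝ} {t U j : ℕ} (h0 : 0 < p.γ) (h1 : p.γ < 1)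
    (hU : p.walkLength B + p.lossLength B ≤ U) (hs : SetupState p B t s) (hj : s.nreg 6 = j) :
    Sim O blockStep s (U * 50 + 150) (Rnd.ret ()) fun _ s' =>
      s'.nreg 6 = j ∧ SetupState p (p.nextBound B) (p.walkLength B) s' := by
  refine Sim.time (Sim.rset_seq (Sim.det_seq (R := fun s' => s'.nreg 6 = j ∧
    SetupState p B (p.walkLength B) s') (τ₁ := U * 25 + 30) (Sim.time (τ := p.walkLength B * 25 + 30) ?_ ?_) (τ₂ := U * 25 + 70) ?_)) ?_
  · refine Sim.time (Sim.nset_seq (Sim.rset_seq (Sim.post (Sim.det_loop (n := p.walkLength B) (τ := 14)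
      (I := fun i s' => s'.nreg 6 = j ∧ SetupState p B i s' ∧ s'.rmem 7 = p.precision B ∧
        s'.rmem 8 = p.ratio⁻¹ ^ i) ?_ ?_ ?_) ?_))) ?_
    · rintro i s' - ⟨-, hs', h7, h8⟩
      simp only [Test.holds, mem, RExp.eval, NExp.eval, h7, h8, Params.lt_walkLength_iff h0 h1]
    · rintro i s' - ⟨hj', hs', h7, h8⟩
      refine Sim.time (Sim.rset_seq (Sim.nset ?_)) ?_
      · refine ⟨by simp [hj'], ⟨?_, ?_, ?_, ?_, ?_, ?_, ?_, ?_, ?_, ?_, fun a ha => ?_, ?_⟩, ?_, ?_⟩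
        all_goals simp [NExp.eval, RExp.eval, mem, hs'.nreg1, hs'.nreg2, hs'.nreg3, hs'.nreg4,
          hs'.rmem0, hs'.rmem1, hs'.rmem2, hs'.rmem4, hs'.rmem5, hs'.rmem6, hs'.pmem, h7, h8]
        · rw [Function.update_of_ne (by omega), hs'.high a ha]
        · rw [pow_succ, div_eq_mul_inv, mul_inv]
      · simp [NExp.size, RExp.size, mem]
    · refine ⟨by simp [hj], ⟨?_, ?_, ?_, ?_, ?_, ?_, ?_, ?_, ?_, ?_, fun a ha => ?_, ?_⟩, ?_, ?_⟩
      all_goals simp [NExp.eval, RExp.eval, mem, nat, hs.nreg1, hs.nreg2, hs.nreg3,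
          hs.rmem0, hs.rmem1, hs.rmem2, hs.rmem4, hs.rmem5, hs.rmem6, hs.pmem, Params.precision]
      rw [Function.update_of_ne (by omega), Function.update_of_ne (by omega), hs.high a ha]
    · rintro _ s' ⟨h6, h, -⟩; exact ⟨h6, h⟩
    · simp only [NExp.size, RExp.size, Test.cost, mem]; omega
  · omega
  · rintro s₁ ⟨hj₁, hs₁⟩
    refine Sim.time (Sim.det_seq (R := fun s' => s'.nreg 6 = j ∧
      SetupState p B (p.walkLength B) s' ∧ s'.rmem 9 = p.ratio⁻¹ ^ p.lossLength B)
      (τ₁ := p.lossLength B * 25 + 30) ?_ (τ₂ := 30) ?_) ?_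
    · refine Sim.time (Sim.nset_seq (Sim.rset_seq (Sim.post (Sim.det_loop (n := p.lossLength B) (τ := 14)
        (I := fun i s' => s'.nreg 6 = j ∧ SetupState p B (p.walkLength B) s' ∧ s'.nreg 5 = i ∧
          s'.rmem 9 = p.ratio⁻¹ ^ i) ?_ ?_ ?_) ?_))) ?_
      · rintro i s' - ⟨-, hs', h5, h9⟩
        simp only [Test.holds, mem, nat, RExp.eval, NExp.eval, h5, hs'.nreg4, hs'.rmem1,
          Params.lossLength, Nat.lt_ceil]
      · rintro i s' - ⟨hj', hs', h7, h8⟩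
        refine Sim.time (Sim.rset_seq (Sim.nset ?_)) ?_
        · refine ⟨by simp [hj'], ⟨?_, ?_, ?_, ?_, ?_, ?_, ?_, ?_, ?_, ?_, fun a ha => ?_, ?_⟩, ?_, ?_⟩
          all_goals simp [NExp.eval, RExp.eval, mem, hs'.nreg1, hs'.nreg2, hs'.nreg3, hs'.nreg4,
            hs'.rmem0, hs'.rmem1, hs'.rmem2, hs'.rmem4, hs'.rmem5, hs'.rmem6, hs'.pmem, h7, h8]
          · rw [Function.update_of_ne (by omega), hs'.high a ha]
          · rw [pow_succ, div_eq_mul_inv, mul_inv]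
        · simp [NExp.size, RExp.size, mem]
      · refine ⟨by simp [hj₁], ⟨?_, ?_, ?_, ?_, ?_, ?_, ?_, ?_, ?_, ?_, fun a ha => ?_, ?_⟩, ?_, ?_⟩
        all_goals simp [NExp.eval, RExp.eval, hs₁.nreg1, hs₁.nreg2, hs₁.nreg3, hs₁.nreg4,
            hs₁.rmem0, hs₁.rmem1, hs₁.rmem2, hs₁.rmem4, hs₁.rmem5, hs₁.rmem6, hs₁.pmem]
        rw [Function.update_of_ne (by omega), hs₁.high a ha]
      · rintro _ s' ⟨h6, h, -, h'⟩; exact ⟨h6, h, h'⟩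
      · simp only [NExp.size, RExp.size, Test.cost, mem, nat]; omega
    · rintro s₂ ⟨hj₂, hs₂, h9⟩
      refine Sim.time (Sim.rset ?_) ?_
      · refine ⟨by simp [hj₂], ⟨?_, ?_, ?_, ?_, ?_, ?_, ?_, ?_, ?_, ?_, fun a ha => ?_, ?_⟩⟩
        all_goals simp [NExp.eval, RExp.eval, mem, nat, hs₂.nreg1, hs₂.nreg2, hs₂.nreg3, hs₂.nreg4,
            hs₂.rmem0, hs₂.rmem1, hs₂.rmem2, hs₂.rmem4, hs₂.rmem5, hs₂.rmem6, hs₂.pmem,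
            Params.nextBound, h9]
        rw [Function.update_of_ne (by omega), hs₂.high a ha]
      · simp [NExp.size, RExp.size, mem, nat]
    · omega
  · simp only [NExp.size, RExp.size, mem, nat]; omega

theorem sim_setConstants {p : Params}
    (hs : SetupState p (p.coeffBound p.blocks) (p.lastLength p.blocks) s) (hM : O.M = p.M) :
    Sim O setConstants s ((p.size + p.dim + p.root + p.rounds) * 50 + 200) (Rnd.ret ()) fun _ s' =>
      HasConstants O p.size p.dim p.rounds s' ∧ s'.rmem 14 = p.rate ∧
      (∀ a, 21 ≤ a → s'.rmem a = 0) ∧ ∀ a, s'.pmem a = none := by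
  have e8 : ⌈(p.size : ℝ) + p.M * (p.size + 1)⌉₊ = p.dim := by
    rw [Params.dim, ← Nat.ceil_natCast (R := ℝ) (p.size + p.M * (p.size + 1))]; push_cast; rfl
  have e10 : ⌈(p.root : ℝ) * p.root⌉₊ = p.rounds := by
    rw [Params.rounds, ← Nat.ceil_natCast (R := ℝ) (p.root * p.root)]; push_cast; rfl
  refine Sim.time (Sim.det_seq (sim_ceilTo
    (x := p.coeffBound p.blocks + p.lastLength p.blocks + 32 * p.N * p.invEps / p.δ)
    fun i => ?_) ?_ (τ₂ := (p.dim + p.root + p.rounds) * 50 + 150)) ?_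
  · simp [NExp.eval, RExp.eval, mem, nat, hs.rmem6, hs.nreg4, hs.nreg1, hs.rmem5, hs.rmem4]
  · rintro s₁ h₁
    have h₁' : s₁ = ⟨Function.update s.nreg 7 p.size, s.rmem, s.pmem⟩ := h₁
    refine Sim.time (Sim.det_seq (sim_ceilTo (x := p.size + p.M * (p.size + 1))
      fun i => ?_) ?_ (τ₂ := (p.root + p.rounds) * 50 + 100)) ?_
    · simp [NExp.eval, RExp.eval, nat, h₁', hs.nreg3]
    · rintro s₂ h₂
      rw [e8] at h₂
      refine Sim.time (Sim.det_seq (sim_ceilTo (x := 64 * p.dim * p.size * p.invEps / p.δ)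
        fun i => ?_) ?_ (τ₂ := p.rounds * 50 + 50)) ?_
      · simp [NExp.eval, RExp.eval, mem, nat, h₂, h₁', hs.rmem5, hs.rmem4]
      · rintro s₃ h₃
        have h₃' : s₃ = ⟨Function.update s₂.nreg 9 p.root, s₂.rmem, s₂.pmem⟩ := h₃
        refine Sim.time (Sim.det_seq (sim_ceilTo (x := p.root * p.root)
          fun i => ?_) ?_ (τ₂ := 10)) ?_
        · simp [NExp.eval, RExp.eval, nat, h₃']
        · rintro s₄ h₄
          rw [e10] at h₄
          refine Sim.time (Sim.rset ?_) ?_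
          · subst h₄ h₃' h₂ h₁'
            refine ⟨⟨?_, ?_, ?_, ?_⟩, ?_, fun a ha => ?_, ?_⟩
            all_goals simp [NExp.eval, RExp.eval, nat, hs.nreg3, hM, Params.rate, hs.pmem]
            rw [Function.update_of_ne (by omega), hs.high a ha]
          · simp [NExp.size, RExp.size, nat]
        · rw [e10]; simp only [NExp.size, RExp.size, nat]; omega
      · have e9 : ⌈64 * (p.dim : ℝ) * p.size * p.invEps / p.δ⌉₊ = p.root := rfl
        rw [e9]
        simp only [NExp.size, RExp.size, mem, nat]; omega
    · rw [e8]; simp only [NExp.size, RExp.size, nat]; omega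
  · have e7 : ⌈p.coeffBound p.blocks + p.lastLength p.blocks + 32 * p.N * p.invEps / p.δ⌉₊ =
      p.size := rfl
    rw [e7]
    simp only [NExp.size, RExp.size, mem, nat]; omega

theorem sim_normalize {p : Params} :
    Sim O normalize (initStore X p) 120 (Rnd.ret ()) fun _ s' => SetupState p 1 0 s' := by
  refine Sim.time (Sim.rset_seq (Sim.det_seq (τ₁ := 25) (R := fun s' =>
    s' = ⟨(initStore X p).nreg, Function.update (Function.update (initStore X p).rmem 5 p.invEps) 0 p.ratio, (initStore X p).pmem⟩) ?_ (τ₂ := 70) ?_)) ?_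
  · refine Sim.time (Sim.ite (τ := 10) (fun h => Sim.time (Sim.rset ?_) ?_) fun h => Sim.time (Sim.skip ?_) ?_) ?_
    · simp [Test.holds, NExp.eval, RExp.eval, mem, initStore] at h
      simp [NExp.eval, RExp.eval, mem, initStore, Params.invEps, Params.ratio, h]
    · simp [NExp.size, RExp.size]
    · simp [Test.holds, NExp.eval, RExp.eval, mem, initStore] at h
      have : ¬ p.γ < 1 / 4 := by simpa using h
      have e : Function.update (Function.update (initStore X p).rmem 5 p.invEps) 0 p.γ =
          Function.update (initStore X p).rmem 5 p.invEps := by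
        rw [Function.update_eq_self_iff]
        simp [initStore]
      rw [Params.ratio, if_neg this, e]
      simp [NExp.eval, RExp.eval, mem, initStore, Params.invEps]
    · simp
    · simp [NExp.size, RExp.size, mem, Test.cost]
  · rintro s₁ h₁
    refine Sim.time (Sim.det_seq (τ₁ := 20) (R := fun s' =>
      s' = ⟨s₁.nreg, Function.update s₁.rmem 1 p.expo, s₁.pmem⟩) ?_ (τ₂ := 40) ?_) ?_
    · refine Sim.time (Sim.ite (τ := 10) (fun h => Sim.time (Sim.rset ?_) ?_) fun h => Sim.time (Sim.skip ?_) ?_) ?_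
      · have : p.N + p.k < 3 := by simpa [Test.holds, NExp.eval, h₁, initStore] using h
        simp [NExp.eval, RExp.eval, Params.expo, this]
      · simp [NExp.size, RExp.size]
      · have : ¬ p.N + p.k < 3 := by simpa [Test.holds, NExp.eval, h₁, initStore] using h
        simp only [Params.expo, if_neg this]
        have : Function.update s₁.rmem 1 p.c = s₁.rmem := by
          rw [Function.update_eq_self_iff]
          simp [h₁, initStore]
        rw [this]
      · simp
      · simp [NExp.size, Test.cost]
    · rintro s₂ h₂
      refine Sim.time (Sim.det_seq (τ₁ := 20) (R := fun s' =>
        s' = ⟨Function.update s₂.nreg 2 p.blocks, s₂.rmem, s₂.pmem⟩) ?_ (τ₂ := 10) ?_) ?_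
      · refine Sim.time (Sim.ite (τ := 10) (fun h => Sim.time (Sim.nset ?_) ?_) fun h => Sim.time (Sim.skip ?_) ?_) ?_
        · have : p.expo < 1 := by simpa [Test.holds, NExp.eval, RExp.eval, mem, h₂] using h
          simp [NExp.eval, Params.blocks, this]
        · simp [NExp.size]
        · have : ¬ p.expo < 1 := by simpa [Test.holds, NExp.eval, RExp.eval, mem, h₂] using h
          simp only [Params.blocks, if_neg this]
          have : Function.update s₂.nreg 2 p.k = s₂.nreg := by
            rw [Function.update_eq_self_iff]
            simp [h₂, h₁, initStore]
          rw [this]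
        · simp
        · simp [RExp.size, NExp.size, Test.cost, mem]
      · rintro s₃ rfl
        refine Sim.time (Sim.rset ?_) ?_
        · subst h₂ h₁
          refine ⟨?_, ?_, ?_, ?_, ?_, ?_, ?_, ?_, ?_, ?_, fun a ha => ?_, ?_⟩
          all_goals simp [NExp.eval, RExp.eval, initStore]
          rw [Function.update_of_ne (by omega), Function.update_of_ne (by omega),
            Function.update_of_ne (by omega), Function.update_of_ne (by omega)]
          split <;> first | omega | rfl
        · simp [NExp.size, RExp.size]
      · simp
    · simp
  · simp [NExp.size, RExp.size, mem]

theorem sim_setup {p : Params} (h0 : 0 < p.γ) (h1 : p.γ < 1) (hM : O.M = p.M) :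
    Sim O setup (initStore X p) p.setupTime (Rnd.ret ()) fun _ s' =>
      HasConstants O p.size p.dim p.rounds s' ∧ s'.rmem 14 = p.rate ∧
      (∀ a, 21 ≤ a → s'.rmem a = 0) ∧ ∀ a, s'.pmem a = none := by
  refine Sim.time (Sim.det_seq sim_normalize ?_ (τ₂ := p.blocks * (p.searchBound * 50 + 170) + 50 +
    (p.size + p.dim + p.root + p.rounds) * 50 + 200)) ?_
  · intro s₁ h₁
    refine Sim.time (Sim.nset_seq (Sim.det_seq (Sim.det_forLoop (n := p.blocks)
      (τ := p.searchBound * 50 + 150)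
      (I := fun i s' => s'.nreg 6 = i ∧ SetupState p (p.coeffBound i) (p.lastLength i) s') ?_ ?_ ?_)
      fun s' h' => sim_setConstants h'.2 hM)) ?_
    · rintro i s' ⟨h, hs⟩
      exact ⟨h, hs.nreg2⟩
    · rintro i s' hi ⟨h6, hs⟩
      refine Sim.post (sim_blockStep (U := p.searchBound) h0 h1 ?_ hs h6) ?_
      · exact Finset.single_le_sum (f := fun j => p.walkLength (p.coeffBound j) + p.lossLength (p.coeffBound j)) (fun _ _ => Nat.zero_le _) (Finset.mem_range.2 hi)
      · rintro _ s'' ⟨h6', k⟩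
        refine ⟨by simp [h6'], ?_, ?_, ?_, ?_, k.rmem0, k.rmem1, k.rmem2, k.rmem4, k.rmem5, k.rmem6, k.high, k.pmem⟩
        all_goals simp [k.nreg1, k.nreg2, k.nreg3, k.nreg4, Params.lastLength]
    · refine ⟨by simp [NExp.eval], ?_, ?_, ?_, ?_, h₁.rmem0, h₁.rmem1, h₁.rmem2, h₁.rmem4, h₁.rmem5, h₁.rmem6, h₁.high, h₁.pmem⟩
      all_goals simp [h₁.nreg1, h₁.nreg2, h₁.nreg3, h₁.nreg4, Params.lastLength]
    · have := Nat.mul_le_mul_left p.blocks (show p.searchBound * 50 + 150 + 1 + 8 ≤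
        p.searchBound * 50 + 170 by omega)
      simp only [NExp.size]; omega
  · have := Nat.mul_le_mul_left p.blocks (show p.searchBound * 50 + 170 ≤
        p.searchBound * 50 + 200 by omega)
    simp only [Params.setupTime]; omega

end

section

/-! ## The learner, and the reduction to its model -/

def learner : LearningAlgorithm where
  train := .seq setup (.seq memorize descent)
  evaluate := evaluation

namespace Params

def trainTime (p : Params) : ℕ :=
  p.setupTime + (p.size * (p.n + 20) + 20 + descentTime p.n p.M p.size p.dim p.rounds + 1) + 1

/-- A bound for all resources of the learner. -/
def resources (p : Params) : ℕ := p.trainTime + evalTime p.n p.M p.size p.dim p.rounds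

end Params

variable {X : Type} {O : Oracles X} {s : Store X} {τ : ℕ}

def Oracles.trainModel [Fintype X] (O : Oracles X) (z d q : ℕ) (η : ℝ) :
    Rnd ((ℕ → Option X) × (ℕ → ℝ)) :=
  (O.memorizeModel z).bind fun pts => (O.descentModel z d q η pts).map fun a => (pts, a.2)

/-- The store holds the memorized points `a.1` and the sums `a.2` of the weights. -/
structure HasHypothesis (O : Oracles X) (z d q : ℕ) (a : (ℕ → Option X) × (ℕ → ℝ))
    (s : Store X) : Prop where
  const : HasConstants O z d q s
  pts : ∀ j, s.pmem (j + 2) = a.1 j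
  sums : ∀ j < d, s.rmem (3 * j + 22) = a.2 j

theorem sim_train [Fintype X] {p : Params} (h0 : 0 < p.γ) (h1 : p.γ < 1) (hM : O.M = p.M)
    (hn : O.n = p.n) :
    Sim O learner.train (initStore X p) p.trainTime
      (O.trainModel p.size p.dim p.rounds p.rate) (HasHypothesis O p.size p.dim p.rounds) := by
  refine Sim.det_seq (sim_setup h0 h1 hM) fun s₁ h₁ => ?_
  obtain ⟨hc, h14, hr, hp⟩ := h₁
  rw [← hn, ← hM]
  refine Sim.seq (sim_memorize hc fun j => hp _) fun pts s₂ h₂ => ?_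
  obtain ⟨hc2, hp2, hr2⟩ := h₂
  refine Sim.map (sim_descent hc2 (by rw [hr2 _ (by norm_num), h14]) hp2 ?_ ?_) _ ?_
  · intro j _; rw [hr2 _ (by omega), hr _ (by omega)]
  · intro j _; rw [hr2 _ (by omega), hr _ (by omega)]
  · rintro a s' ⟨k1, k2, k3⟩; exact ⟨k1, k2, k3⟩

open Classical in
/-- The error of the hypothesis in the model. -/
def Oracles.hypothesisRisk [Fintype X] (O : Oracles X) (z d q : ℕ)
    (a : (ℕ → Option X) × (ℕ → ℝ)) : ℝ :=
  ∑ e : X × ℤˣ, (O.labelled e).toReal *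
    (O.evalModel z d q a.1 a.2 e.1).E fun y => if y ≠ e.2 then 1 else 0

/-- On every branch of the coupling the label read off the final store is the result of `evalModel`,
so the error can be computed in the model. -/
theorem hypRisk_eq [Fintype X] {z d q T : ℕ} {a : (ℕ → Option X) × (ℕ → ℝ)}
    (hs : HasHypothesis O z d q a s) (hT : evalTime O.n O.M z d q ≤ T) :
    learner.hypRisk O T s = O.hypothesisRisk z d q a := by
  classical
  have hsim : ∀ x, Sim O evaluation (learner.evalStart s x).store (evalTime O.n O.M z d q)
      (O.evalModel z d q a.1 a.2 x) fun y s' => s'.label = y := by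
    intro x
    refine sim_evaluation (hs.const.of_eq fun _ _ => rfl) ?_ (fun j => ?_) hs.sums
    · simp [LearningAlgorithm.evalStart]
    · simp [LearningAlgorithm.evalStart, hs.pts]
  choose κ h1 h2 h3 using fun x => (hsim x).runFor_eq
  have : (O.labelled.bind fun e => (runFor O T (learner.evalStart s e.1)).map
      fun C => (C.store.label, e.2)) =
      (Rnd.samp inferInstance O.labelled fun e =>
        (κ e.1).map fun y => (y.2.store.label, e.2)).toPMF := by
    simp only [Rnd.toPMF]
    congr 1; funext e
    have : runFor O T (learner.evalStart s e.1) = _ := h3 e.1 T hT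
    rw [this, Rnd.map, Rnd.map, Rnd.toPMF_bind, Rnd.toPMF_bind, PMF.map_bind]
    simp [Rnd.toPMF, PMF.pure_map]
  rw [LearningAlgorithm.hypRisk, this, Rnd.prob_toPMF_eq, Rnd.E_samp, Oracles.hypothesisRisk]
  refine Finset.sum_congr rfl fun e _ => ?_
  rw [Rnd.E_map, ← h1]
  congr 1
  refine Rnd.E_congr_of_All ((h2 e.1).mono fun y hy => ?_)
  simp [hy.1]

/-- Commands that draw no examples. -/
def Cmd.NoDraw : Cmd → Prop
  | .draw _ _ => False
  | .seq p q => p.NoDraw ∧ q.NoDraw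
  | .ite _ p q => p.NoDraw ∧ q.NoDraw
  | .loop _ p => p.NoDraw
  | _ => True

/-- A draw costs at least one unit of time, so a bound for the time is also one for the number of
examples. -/
theorem step_drawn_le {C C' : Config X} (h : C' ∈ (step O C).support) (hC : C.drawn ≤ C.time) :
    C'.drawn ≤ C'.time := by
  obtain ⟨L, s, t, d⟩ := C
  rcases L with _ | ⟨c, K⟩
  · simp only [step, PMF.support_pure, Set.mem_singleton_iff] at h
    subst h; exact hC
  cases c <;> simp only [step, PMF.support_pure, Set.mem_singleton_iff, PMF.support_map,
    Set.mem_image] at h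
  all_goals first
    | (subst h; simp only at hC ⊢; omega)
    | (obtain ⟨_, -, rfl⟩ := h; simp only at hC ⊢; omega)

theorem runFor_drawn_le {T : ℕ} {C C' : Config X} (h : C' ∈ (runFor O T C).support)
    (hC : C.drawn ≤ C.time) : C'.drawn ≤ C'.time := by
  induction T generalizing C with
  | zero =>
    simp only [runFor, PMF.support_pure, Set.mem_singleton_iff] at h
    subst h; exact hC
  | succ T ih =>
    rw [runFor_succ, PMF.mem_support_bind_iff] at h
    obtain ⟨D, hD, h⟩ := h
    exact ih h (step_drawn_le hD hC)

theorem step_noDraw {C C' : Config X} (h : C' ∈ (step O C).support)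
    (hC : ∀ c ∈ C.todo, c.NoDraw) : C'.drawn = C.drawn ∧ ∀ c ∈ C'.todo, c.NoDraw := by
  obtain ⟨L, s, t, d⟩ := C
  rcases L with _ | ⟨c, K⟩
  · simp only [step, PMF.support_pure, Set.mem_singleton_iff] at h
    subst h; exact ⟨rfl, hC⟩
  simp only [List.mem_cons, forall_eq_or_imp] at hC
  obtain ⟨hc, hK⟩ := hC
  cases c <;> simp only [step, PMF.support_pure, Set.mem_singleton_iff, PMF.support_map,
    Set.mem_image] at h <;> try simp only [Cmd.NoDraw] at hc
  all_goals first
    | (subst h; exact ⟨rfl, hK⟩)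
    | (obtain ⟨_, -, rfl⟩ := h; exact ⟨rfl, hK⟩)
    | (subst h; refine ⟨rfl, ?_⟩; dsimp only; intro c hc'
       split_ifs at hc' <;> (try simp only [List.mem_cons] at hc') <;> grind [Cmd.NoDraw])
    | (subst h; refine ⟨rfl, ?_⟩; dsimp only; intro c hc'
       rw [List.mem_cons, List.mem_cons] at hc'; grind [Cmd.NoDraw])

theorem runFor_noDraw {T : ℕ} {C C' : Config X} (h : C' ∈ (runFor O T C).support)
    (hC : ∀ c ∈ C.todo, c.NoDraw) : C'.drawn = C.drawn := by
  induction T generalizing C with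
  | zero =>
    simp only [runFor, PMF.support_pure, Set.mem_singleton_iff] at h
    subst h; rfl
  | succ T ih =>
    rw [runFor_succ, PMF.mem_support_bind_iff] at h
    obtain ⟨D, hD, h⟩ := h
    have := step_noDraw hD hC
    rw [ih h this.2, this.1]

theorem evaluation_noDraw : evaluation.NoDraw := by
  simp [evaluation, features, dot, threshold, forLoop, oneWalk, queryAll, incr, Cmd.NoDraw]

-- Everything about the machine ends here. Halting and time bounds come from `Sim`, the number of
-- examples is at most the time, and the evaluation program contains no `draw`; only an expectation
-- in the model remains to be estimated.
open Classical in
theorem learner_of_model [Fintype X] {p : Params} (h0 : 0 < p.γ) (h1 : p.γ < 1) (hM : O.M = p.M)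
    (hn : O.n = p.n) {F : Set (X → ℤˣ)}
    (h : 1 - p.δ ≤ (O.trainModel p.size p.dim p.rounds p.rate).E fun a =>
      if ∀ f ∈ F, O.hypothesisRisk p.size p.dim p.rounds a ≤ risk O.labelled f + p.ε
      then 1 else 0) :
    learner.AgnosticallyLearnsWithin O F p p.resources := by
  obtain ⟨κ, e1, e2, e3⟩ := (sim_train h0 h1 hM hn).runFor_eq
  have hT : p.trainTime ≤ p.resources := Nat.le_add_right _ _
  have hT' : evalTime O.n O.M p.size p.dim p.rounds ≤ p.resources := by
    rw [hn, hM]; exact Nat.le_add_left _ _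
  have hrun : runFor O p.resources (learner.trainStart X p) = _ := e3 _ hT
  refine ⟨fun C hC => ?_, ?_⟩
  · have hd := runFor_drawn_le hC (le_refl 0)
    rw [hrun] at hC
    have hall : (κ.map fun z => Config.mk [] z.2.store z.2.time z.2.drawn).All fun C =>
        C.todo = [] ∧ C.time ≤ p.trainTime ∧
        ∃ a, HasHypothesis O p.size p.dim p.rounds a C.store := by
      rw [Rnd.map, Rnd.All_bind]
      exact e2.mono fun z hz => ⟨rfl, hz.2, z.1, hz.1⟩
    obtain ⟨k1, k2, a, ha⟩ := hall.of_mem_support hC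
    refine ⟨k1, by omega, by omega, fun x C' hC' => ?_⟩
    have hd' := runFor_noDraw hC' (by
      simp only [LearningAlgorithm.evalStart, List.mem_singleton, forall_eq]
      exact evaluation_noDraw)
    have hsim : Sim O evaluation (learner.evalStart C.store x).store
        (evalTime O.n O.M p.size p.dim p.rounds)
        (O.evalModel p.size p.dim p.rounds a.1 a.2 x) fun y s' => s'.label = y := by
      refine sim_evaluation (ha.const.of_eq fun _ _ => rfl) ?_ (fun j => ?_) ha.sums
      · simp [LearningAlgorithm.evalStart]
      · simp [LearningAlgorithm.evalStart, ha.pts]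
    obtain ⟨κ', -, f2, f3⟩ := hsim.runFor_eq
    have hrun' : runFor O p.resources (learner.evalStart C.store x) = _ := f3 _ hT'
    rw [hrun'] at hC'
    have hall' : (κ'.map fun z => Config.mk [] z.2.store z.2.time z.2.drawn).All fun C =>
        C.todo = [] ∧ C.time ≤ evalTime O.n O.M p.size p.dim p.rounds := by
      rw [Rnd.map, Rnd.All_bind]
      exact f2.mono fun z hz => ⟨rfl, hz.2⟩
    obtain ⟨l1, l2⟩ := hall'.of_mem_support hC'
    exact ⟨l1, l2.trans hT', hd'⟩
  · rw [hrun, Rnd.prob_toPMF_eq, Rnd.E_map]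
    refine h.trans (le_of_eq ?_)
    rw [← e1]
    refine Rnd.E_congr_of_All (e2.mono fun z hz => ?_)
    simp only [Set.mem_ofPred_eq, hypRisk_eq hz.1 hT']

end

section

/-! ## The random threshold -/

theorem E_uniform_two (f : Fin 2 → ℝ) :
    (Rnd.samp inferInstance (PMF.uniformOfFintype (Fin 2)) fun v => Rnd.ret (f v)).E (fun x => x) =
      (f 0 + f 1) / 2 := by
  have : (Rnd.samp inferInstance (PMF.uniformOfFintype (Fin 2)) fun v => Rnd.ret (f v)).E
      (fun x => x) = ∑ v : Fin 2, (PMF.uniformOfFintype (Fin 2) v).toReal * f v := rfl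
  rw [this]
  simp [Fin.sum_univ_two]; ring

open Classical in
/-- The probability that the random threshold is below `a`. -/
def belowProb (b : ℕ) (a : ℝ) : ℝ := (coinModel b).E fun u => if u < a then 1 else 0

/-- Conditioning on the last coin, which is the leading bit of the threshold. -/
theorem belowProb_succ (b : ℕ) (a : ℝ) :
    belowProb (b + 1) a = (belowProb b (2 * a) + belowProb b (2 * a - 1)) / 2 := by
  classical
  have h : ∀ u : ℝ, (Rnd.samp inferInstance (PMF.uniformOfFintype (Fin 2)) fun v =>
      Rnd.ret ((u + (v.val : ℝ)) / 2)).E (fun u => if u < a then (1 : ℝ) else 0) =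
      (1 / 2) * ((if u < 2 * a then 1 else 0) + if u < 2 * a - 1 then 1 else 0) := by
    intro u
    have := E_uniform_two fun v => if (u + (v.val : ℝ)) / 2 < a then (1 : ℝ) else 0
    refine Eq.trans this ?_
    have e1 : (u + ((0 : Fin 2).val : ℝ)) / 2 < a ↔ u < 2 * a := by
      simp; constructor <;> intro h <;> linarith
    have e2 : (u + ((1 : Fin 2).val : ℝ)) / 2 < a ↔ u < 2 * a - 1 := by
      simp; constructor <;> intro h <;> linarith
    simp only [e1, e2]; ring
  unfold belowProb coinModel
  rw [Rnd.iter_succ, Rnd.E_bind]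
  simp only [h]
  rw [Rnd.E_mul_left, Rnd.E_add]; ring

theorem coinModel_all (b : ℕ) : (coinModel b).All fun u => 0 ≤ u ∧ u < 1 := by
  refine Rnd.iter_all (Q := fun _ u => 0 ≤ u ∧ u < 1) (fun i u hu => ?_) (by norm_num) b
  intro v
  have hv : (v.val : ℝ) ≤ 1 := by exact_mod_cast Nat.le_of_lt_succ v.isLt
  have hv' : (0 : ℝ) ≤ v.val := by positivity
  simp only [Rnd.All_ret]
  constructor <;> linarith [hu.1, hu.2]

theorem belowProb_of_nonpos (b : ℕ) {a : ℝ} (ha : a ≤ 0) : belowProb b a = 0 := by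
  classical
  unfold belowProb
  rw [Rnd.E_congr_of_All (g := fun _ => 0) ((coinModel_all b).mono fun u hu => ?_), Rnd.E_const]
  rw [if_neg (by linarith [hu.1])]

theorem belowProb_of_one_le (b : ℕ) {a : ℝ} (ha : 1 ≤ a) : belowProb b a = 1 := by
  classical
  unfold belowProb
  rw [Rnd.E_congr_of_All (g := fun _ => 1) ((coinModel_all b).mono fun u hu => ?_), Rnd.E_const]
  rw [if_pos (by linarith [hu.2])]

/-- Of the two terms of the recursion one is exactly `0` or `1`, and the error of the other is
halved. -/
theorem abs_belowProb_sub_le (b : ℕ) {a : ℝ} (h0 : 0 ≤ a) (h1 : a ≤ 1) :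
    |belowProb b a - a| ≤ (1 / 2) ^ b := by
  induction b generalizing a with
  | zero =>
    have hle : belowProb 0 a ≤ 1 := by
      classical
      unfold belowProb
      refine (Rnd.E_mono _ (g := fun _ => 1) fun u => ?_).trans (Rnd.E_const _ _).le
      split_ifs <;> norm_num
    have hge : 0 ≤ belowProb 0 a := by
      classical
      exact Rnd.E_nonneg _ fun u => by split_ifs <;> norm_num
    rw [abs_le]; norm_num; constructor <;> linarith
  | succ b ih =>
    rw [belowProb_succ, pow_succ]
    rcases le_total (2 * a) 1 with h | h
    · rw [belowProb_of_nonpos b (show 2 * a - 1 ≤ 0 by linarith)]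
      have := abs_le.1 (ih (a := 2 * a) (by linarith) h)
      rw [abs_le]; constructor <;> linarith [this.1, this.2]
    · rw [belowProb_of_one_le b h]
      have := abs_le.1 (ih (a := 2 * a - 1) (by linarith) (by linarith))
      rw [abs_le]; constructor <;> linarith [this.1, this.2]

/-- Needed also for `a` outside the unit interval, because the regression may predict values outside
`[-1, 1]`. -/
theorem belowProb_le (b : ℕ) (a : ℝ) : belowProb b a ≤ |a| + (1 / 2) ^ b := by
  have hp : (0 : ℝ) < (1 / 2) ^ b := by positivity
  rcases le_total a 0 with h | h
  · rw [belowProb_of_nonpos b h]; positivity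
  rcases le_total a 1 with h' | h'
  · rw [abs_of_nonneg h]; linarith [(abs_le.1 (abs_belowProb_sub_le b h h')).2]
  · rw [belowProb_of_one_le b h', abs_of_nonneg h]; linarith

theorem one_sub_belowProb_le (b : ℕ) (a : ℝ) : 1 - belowProb b a ≤ |1 - a| + (1 / 2) ^ b := by
  have hp : (0 : ℝ) < (1 / 2) ^ b := by positivity
  rcases le_total a 0 with h | h
  · rw [belowProb_of_nonpos b h, abs_of_nonneg (by linarith)]; linarith
  rcases le_total a 1 with h' | h'
  · rw [abs_of_nonneg (by linarith)]; linarith [(abs_le.1 (abs_belowProb_sub_le b h h')).1]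
  · rw [belowProb_of_one_le b h']; have := abs_nonneg (1 - a); linarith

open Classical in
/-- The randomized rounding of the real prediction `A / q` errs at most with probability
`|A / q - y| / 2`, up to the discretization. -/
theorem rounding_error_le (b : ℕ) {q : ℕ} (hq : 0 < q) (A : ℝ) (y : ℤˣ) :
    ((coinModel b).E fun u => if (if q * (2 * u - 1) < A then (1 : ℤˣ) else -1) ≠ y then (1 : ℝ)
      else 0) ≤ |A / q - (y : ℤ)| / 2 + (1 / 2) ^ b := by
  have hq' : (0 : ℝ) < q := by exact_mod_cast hq
  have key : ∀ u : ℝ, q * (2 * u - 1) < A ↔ u < (A / q + 1) / 2 := by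
    intro u
    rw [mul_comm, ← lt_div_iff₀ hq']
    constructor <;> intro h <;> linarith
  simp only [key]
  rcases Int.units_eq_one_or y with rfl | rfl
  · have : ∀ u : ℝ, (if (if u < (A / q + 1) / 2 then (1 : ℤˣ) else -1) ≠ 1 then (1 : ℝ) else 0) =
        1 - if u < (A / q + 1) / 2 then 1 else 0 := by
      intro u; split_ifs <;> simp_all
    simp only [this]
    rw [Rnd.E_sub, Rnd.E_const]
    refine (one_sub_belowProb_le b ((A / q + 1) / 2)).trans (le_of_eq ?_)
    congr 1
    rw [← abs_neg, ← abs_of_pos (show (0 : ℝ) < 2 by norm_num), ← abs_div, abs_of_pos (show (0 : ℝ) < 2 by norm_num)]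
    congr 1; push_cast; ring
  · have : ∀ u : ℝ, (if (if u < (A / q + 1) / 2 then (1 : ℤˣ) else -1) ≠ -1 then (1 : ℝ) else 0) =
        if u < (A / q + 1) / 2 then 1 else 0 := by
      intro u; split_ifs <;> simp_all
    simp only [this]
    refine (belowProb_le b ((A / q + 1) / 2)).trans (le_of_eq ?_)
    congr 1
    rw [← abs_of_pos (show (0 : ℝ) < 2 by norm_num), ← abs_div, abs_of_pos (show (0 : ℝ) < 2 by norm_num)]
    congr 1; push_cast; ring

/-! ## Stochastic subgradient descent -/

/-- The expected absolute loss, with labels scaled by `t`. -/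
def absLoss (S : Rnd ((ℕ → ℝ) × ℤˣ)) (d : ℕ) (t : ℝ) (w : ℕ → ℝ) : ℝ :=
  S.E fun v => |inner d w v.1 - t * ((v.2 : ℤ) : ℝ)|

theorem inner_add (d : ℕ) (w w' V : ℕ → ℝ) :
    inner d (fun j => w j + w' j) V = inner d w V + inner d w' V := by
  simp [inner, add_mul, Finset.sum_add_distrib]

theorem inner_smul (d : ℕ) (c : ℝ) (w V : ℕ → ℝ) :
    inner d (fun j => c * w j) V = c * inner d w V := by
  simp [inner, Finset.mul_sum, mul_assoc]

theorem absLoss_nonneg (S : Rnd ((ℕ → ℝ) × ℤˣ)) (d : ℕ) (t : ℝ) (w : ℕ → ℝ) :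
    0 ≤ absLoss S d t w := Rnd.E_nonneg _ fun _ => abs_nonneg _

/-- Scaling the label along with the number of rounds puts the convexity of the loss into additive
form: the loss of the sum of the iterates is bounded round by round, and the division happens once
at the end. -/
theorem absLoss_add_le (S : Rnd ((ℕ → ℝ) × ℤˣ)) (d : ℕ) (t : ℝ) (A w : ℕ → ℝ) :
    absLoss S d (t + 1) (fun j => A j + w j) ≤ absLoss S d t A + absLoss S d 1 w := by
  unfold absLoss
  rw [← Rnd.E_add]
  refine Rnd.E_mono _ fun v => ?_
  rw [inner_add]
  refine le_trans (le_of_eq ?_) (abs_add_le _ _)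
  congr 1; ring

theorem absLoss_div (S : Rnd ((ℕ → ℝ) × ℤˣ)) (d : ℕ) {t : ℝ} (ht : 0 < t) (A : ℕ → ℝ) :
    absLoss S d 1 (fun j => A j / t) = absLoss S d t A / t := by
  unfold absLoss
  rw [div_eq_inv_mul, ← Rnd.E_mul_left]
  congr 1; funext v
  have : (fun j => A j / t) = fun j => t⁻¹ * A j := by funext j; rw [div_eq_inv_mul]
  rw [this, inner_smul, ← abs_of_pos (inv_pos.2 ht), ← abs_mul, abs_of_pos (inv_pos.2 ht)]
  congr 1; field_simp

/-- Projection to an interval does not move away from the points of the interval. -/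
theorem sq_clip_sub_le {z x w : ℝ} (h1 : -z ≤ w) (h2 : w ≤ z) :
    (clip z x - w) ^ 2 ≤ (x - w) ^ 2 := by
  rw [sq_le_sq]
  unfold clip
  rcases le_total z x with h | h
  · rw [min_eq_left h, max_eq_left (by linarith), abs_of_nonneg (by linarith),
      abs_of_nonneg (by linarith)]; linarith
  · rw [min_eq_right h]
    rcases le_total x (-z) with h' | h'
    · rw [max_eq_right h', abs_of_nonpos (by linarith), abs_of_nonpos (by linarith)]; linarith
    · rw [max_eq_left h']

theorem abs_clip_le {z : ℝ} (hz : 0 ≤ z) (x : ℝ) : |clip z x| ≤ z := by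
  rw [abs_le]
  exact ⟨le_max_right _ _, max_le (min_le_left _ _) (by linarith)⟩

/-- The subgradient inequality for `a ↦ |a - y|`; at the kink either sign is a subgradient. -/
theorem stepSize_mul_le {η a a' y : ℝ} (hη : 0 ≤ η) :
    stepSize η a y * (a - a') ≤ η * (|a' - y| - |a - y|) := by
  unfold stepSize
  split_ifs with h
  · rw [abs_of_neg (show a - y < 0 by linarith)]
    have := neg_abs_le (a' - y)
    nlinarith
  · rw [abs_of_nonneg (show 0 ≤ a - y by linarith)]
    have := le_abs_self (a' - y)
    nlinarith

theorem stepSize_sq (η a y : ℝ) : stepSize η a y ^ 2 = η ^ 2 := by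
  unfold stepSize; split_ifs <;> ring

/-- One update of the descent, on the weights and their sum. -/
def descentUpdate (z d : ℕ) (η : ℝ) (a : (ℕ → ℝ) × (ℕ → ℝ)) (v : (ℕ → ℝ) × ℤˣ) :
    (ℕ → ℝ) × (ℕ → ℝ) :=
  (fun j => clip z (a.1 j + stepSize η (inner d a.1 v.1) ((v.2 : ℤˣ) : ℤ) * v.1 j),
    fun j => a.2 j + a.1 j)

/-- Expanding the square before the projection, the cross term is controlled by the subgradient
inequality. The quadratic term is at most `η²` per coordinate since the features are bounded by `1`.
-/
theorem sum_sq_update_le {z d : ℕ} {η : ℝ} (hη : 0 ≤ η) {a : (ℕ → ℝ) × (ℕ → ℝ)}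
    {v : (ℕ → ℝ) × ℤˣ} (hv : ∀ j, |v.1 j| ≤ 1) {w : ℕ → ℝ} (hw : ∀ j, |w j| ≤ z) :
    ∑ j ∈ Finset.range d, ((descentUpdate z d η a v).1 j - w j) ^ 2 +
      2 * η * |inner d a.1 v.1 - 1 * ((v.2 : ℤ) : ℝ)| ≤
    ∑ j ∈ Finset.range d, (a.1 j - w j) ^ 2 +
      2 * η * |inner d w v.1 - 1 * ((v.2 : ℤ) : ℝ)| + η ^ 2 * d := by
  set y : ℝ := ((v.2 : ℤ) : ℝ)
  set g := stepSize η (inner d a.1 v.1) y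
  have h1 : ∑ j ∈ Finset.range d, ((descentUpdate z d η a v).1 j - w j) ^ 2 ≤
      ∑ j ∈ Finset.range d, ((a.1 j - w j) ^ 2 + 2 * g * (a.1 j * v.1 j - w j * v.1 j) + η ^ 2) := by
    refine Finset.sum_le_sum fun j _ => ?_
    have hwj := abs_le.1 (hw j)
    refine (sq_clip_sub_le hwj.1 hwj.2).trans ?_
    have e : (a.1 j + g * v.1 j - w j) ^ 2 = (a.1 j - w j) ^ 2 +
        2 * g * (a.1 j * v.1 j - w j * v.1 j) + η ^ 2 * v.1 j ^ 2 := by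
      rw [← stepSize_sq η (inner d a.1 v.1) y]; ring
    rw [e]
    have : v.1 j ^ 2 ≤ 1 := by
      rw [sq_le_one_iff_abs_le_one]; exact hv j
    nlinarith [sq_nonneg η]
  have h2 : ∑ j ∈ Finset.range d, ((a.1 j - w j) ^ 2 + 2 * g * (a.1 j * v.1 j - w j * v.1 j) + η ^ 2)
      = ∑ j ∈ Finset.range d, (a.1 j - w j) ^ 2 + 2 * (g * (inner d a.1 v.1 - inner d w v.1)) +
        η ^ 2 * d := by
    rw [Finset.sum_add_distrib, Finset.sum_add_distrib, ← Finset.mul_sum, Finset.sum_sub_distrib]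
    simp only [inner, Finset.sum_const, Finset.card_range, nsmul_eq_mul]
    ring
  have h3 := stepSize_mul_le (a := inner d a.1 v.1) (a' := inner d w v.1) (y := y) hη
  rw [one_mul]
  nlinarith

theorem descent_all {S : Rnd ((ℕ → ℝ) × ℤˣ)} {z d : ℕ} {η : ℝ} (n : ℕ) :
    (Rnd.iter (fun _ a => S.map (descentUpdate z d η a)) n (fun _ => 0, fun _ => 0)).All fun a =>
      (∀ j, |a.1 j| ≤ z) ∧ ∀ j, |a.2 j| ≤ n * z := by
  refine Rnd.iter_all (Q := fun n (a : (ℕ → ℝ) × (ℕ → ℝ)) => (∀ j, |a.1 j| ≤ z) ∧ ∀ j, |a.2 j| ≤ n * z)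
    (fun i a ha => ?_) (by simp) n
  rw [Rnd.map, Rnd.All_bind]
  refine Rnd.all_true _ fun v => ⟨fun j => abs_clip_le (Nat.cast_nonneg z) _, fun j => ?_⟩
  refine (abs_add_le _ _).trans ?_
  have := ha.1 j; have := ha.2 j
  push_cast; linarith

/-- The regret bound for projected stochastic subgradient descent. -/
theorem descent_regret {S : Rnd ((ℕ → ℝ) × ℤˣ)} {z d : ℕ} {η : ℝ} (hη : 0 < η)
    (hS : S.All fun v => ∀ j, |v.1 j| ≤ 1) {w : ℕ → ℝ} (hw : ∀ j, |w j| ≤ z) (n : ℕ) :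
    (Rnd.iter (fun _ a => S.map (descentUpdate z d η a)) n (fun _ => 0, fun _ => 0)).E
      (fun a => absLoss S d n a.2) ≤
    n * absLoss S d 1 w + (d * z ^ 2 / (2 * η) + n * (η * d / 2)) := by
  -- The potential is the squared distance to the comparator `w` plus `2 * η` times the loss of the
  -- accumulated weights.
  have key := Rnd.E_iter_le (f := fun _ a => S.map (descentUpdate z d η a))
    (Φ := fun n a => ∑ j ∈ Finset.range d, (a.1 j - w j) ^ 2 + 2 * η * absLoss S d n a.2)
    (c := 2 * η * absLoss S d 1 w + η ^ 2 * d) (Q := fun _ _ => True)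
    (fun _ _ _ => Rnd.all_true _ fun _ => trivial) (fun i a _ => ?_)
    (a := (fun _ => 0, fun _ => 0)) trivial n
  · have h0 : ∑ j ∈ Finset.range d, ((0 : ℝ) - w j) ^ 2 ≤ d * z ^ 2 := by
      calc _ ≤ ∑ j ∈ Finset.range d, (z : ℝ) ^ 2 := Finset.sum_le_sum fun j _ => by
            rw [zero_sub, neg_sq, ← sq_abs]; gcongr; exact hw j
        _ = _ := by simp
    have h1 : absLoss S d ((0 : ℕ) : ℝ) (fun _ => 0) = 0 := by
      simp [absLoss, inner]
    rw [Rnd.E_add, Rnd.E_mul_left] at key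
    have h2 : 0 ≤ (Rnd.iter (fun _ a => S.map (descentUpdate z d η a)) n
        (fun _ => 0, fun _ => 0)).E fun a => ∑ j ∈ Finset.range d, (a.1 j - w j) ^ 2 :=
      Rnd.E_nonneg _ fun a => Finset.sum_nonneg fun j _ => sq_nonneg _
    simp only [h1] at key
    rw [← mul_le_mul_iff_right₀ (show 0 < 2 * η by positivity)]
    have : 2 * η * (n * absLoss S d 1 w + (d * z ^ 2 / (2 * η) + n * (η * d / 2))) =
      d * z ^ 2 + n * (2 * η * absLoss S d 1 w + η ^ 2 * d) := by field_simp; ring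
    rw [this]
    linarith
  · rw [Rnd.E_map, Rnd.E_add]
    have h1 := Rnd.E_mono_of_All (hS.mono fun v hv => sum_sq_update_le (d := d) (a := a) hη.le hv hw)
    rw [Rnd.E_add, Rnd.E_add, Rnd.E_add, Rnd.E_mul_left, Rnd.E_mul_left, Rnd.E_const, Rnd.E_const] at h1
    have h2 : (S.E fun v => 2 * η * absLoss S d (i + 1 : ℕ) (descentUpdate z d η a v).2) ≤
        2 * η * (absLoss S d i a.2 + absLoss S d 1 a.1) := by
      simp only [descentUpdate]
      -- The accumulated sum receives the weights from before the draw and so does not depend on the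
      -- fresh sample.
      rw [Rnd.E_const]
      push_cast
      exact mul_le_mul_of_nonneg_left (absLoss_add_le S d i a.2 a.1) (by positivity)
    have e1 : (S.E fun v => |inner d a.1 v.1 - 1 * ((v.2 : ℤ) : ℝ)|) = absLoss S d 1 a.1 := rfl
    have e2 : (S.E fun v => |inner d w v.1 - 1 * ((v.2 : ℤ) : ℝ)|) = absLoss S d 1 w := rfl
    rw [e1, e2] at h1
    linarith

/-- The infimum of the loss over the box. -/
def boxLoss (S : Rnd ((ℕ → ℝ) × ℤˣ)) (d z : ℕ) : ℝ :=
  sInf (absLoss S d 1 '' {w | ∀ j, |w j| ≤ z})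

theorem boxLoss_le (S : Rnd ((ℕ → ℝ) × ℤˣ)) {d z : ℕ} {w : ℕ → ℝ} (hw : ∀ j, |w j| ≤ z) :
    boxLoss S d z ≤ absLoss S d 1 w :=
  csInf_le ⟨0, by rintro _ ⟨w, -, rfl⟩; exact absLoss_nonneg _ _ _ _⟩ ⟨w, hw, rfl⟩

/-- The expected excess loss of the average of the iterates. -/
theorem descent_excess {S : Rnd ((ℕ → ℝ) × ℤˣ)} {z d n : ℕ} {η : ℝ} (hη : 0 < η) (hn : 0 < n)
    (hS : S.All fun v => ∀ j, |v.1 j| ≤ 1) :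
    (Rnd.iter (fun _ a => S.map (descentUpdate z d η a)) n (fun _ => 0, fun _ => 0)).E
      (fun a => absLoss S d 1 fun j => a.2 j / n) ≤
    boxLoss S d z + (d * z ^ 2 / (2 * η * n) + η * d / 2) := by
  have hn' : (0 : ℝ) < n := by exact_mod_cast hn
  rw [← sub_le_iff_le_add]
  -- The regret bound holds against every point of the box, hence against the infimum, attained or
  -- not.
  refine le_csInf ⟨_, fun _ => 0, by simp, rfl⟩ ?_
  rintro _ ⟨w, hw, rfl⟩
  rw [sub_le_iff_le_add]
  have := descent_regret (d := d) hη hS hw n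
  simp only [absLoss_div S d hn']
  simp only [div_eq_inv_mul _ (n : ℝ)]
  rw [Rnd.E_mul_left, ← div_eq_inv_mul, div_le_iff₀ hn']
  refine this.trans (le_of_eq ?_)
  field_simp

end

section

/-! ## Mean and variance of the features -/

variable {X : Type} [Fintype X] {O : Oracles X}

/-- The Markov operator of the one-step oracle. -/
def avg (P : X → PMF X) (f : X → ℝ) (x : X) : ℝ := ∑ y, (P x y).toReal * f y

theorem walkStep_E (z q t : ℕ) (a : X × (ℕ → ℝ)) (f : X × (ℕ → ℝ) → ℝ) :
    (O.walkStep z q t a).E f =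
      ∑ y, (O.next a.1 y).toReal * f (y, O.addValues q (z + t * O.M) O.M a.1 a.2) := rfl

theorem walk_E_fst (z q : ℕ) (x : X) (V : ℕ → ℝ) (n : ℕ) (f : X → ℝ) :
    ((Rnd.iter (O.walkStep z q) n (x, V)).E fun a => f a.1) = (avg O.next)^[n] f x := by
  induction n generalizing f with
  | zero => rfl
  | succ n ih =>
    rw [Rnd.iter_succ, Rnd.E_bind, Function.iterate_succ_apply, ← ih]
    rfl

/-- The sum of the values at `y` of the functions, with the weights that belong to time `t`. -/
def Oracles.gain (O : Oracles X) (z : ℕ) (w : ℕ → ℝ) (t : ℕ) (y : X) : ℝ :=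
  ∑ m ∈ Finset.range O.M, w (z + t * O.M + m) * O.value m (some y)

omit [Fintype X] in
theorem inner_addValues {q o d : ℕ} (hd : o + O.M ≤ d) (w V : ℕ → ℝ) (y : X) :
    inner d w (O.addValues q o O.M y V) = inner d w V +
      (∑ m ∈ Finset.range O.M, w (o + m) * O.value m (some y)) / q := by
  have h1 : ∀ j ∈ Finset.range d, w j * O.addValues q o O.M y V j = w j * V j +
      if j ∈ Finset.Ico o (o + O.M) then w j * O.value (j - o) (some y) / q else 0 := by
    intro j _
    simp only [Oracles.addValues, Finset.mem_Ico]
    split_ifs <;> ring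
  rw [inner, Finset.sum_congr rfl h1, Finset.sum_add_distrib, ← Finset.sum_filter]
  congr 1
  have : (Finset.range d).filter (· ∈ Finset.Ico o (o + O.M)) = Finset.Ico o (o + O.M) := by
    ext j; simp only [Finset.mem_filter, Finset.mem_range, Finset.mem_Ico]; omega
  rw [this, Finset.sum_Ico_eq_sum_range, Finset.sum_div]
  refine Finset.sum_congr (by simp) fun m _ => ?_
  rw [Nat.add_sub_cancel_left]

/-- At time `t` the prediction increases by the gain at the current point, whose expectation is the
`t`-th iterate of `avg` applied to the gain. Linearity suffices; the points of one walk are not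
independent. -/
theorem walk_E_inner {z q d n : ℕ} (hd : z + n * O.M ≤ d) (w V : ℕ → ℝ) (x : X) :
    ((Rnd.iter (O.walkStep z q) n (x, V)).E fun a => inner d w a.2) = inner d w V +
      (∑ t ∈ Finset.range n, (avg O.next)^[t] (O.gain z w t) x) / q := by
  induction n with
  | zero => simp
  | succ n ih =>
    have hd' : z + n * O.M + O.M ≤ d := by rw [add_mul, one_mul] at hd; omega
    rw [Rnd.iter_succ, Rnd.E_bind, Finset.sum_range_succ]
    simp only [walkStep_E, ← Finset.sum_mul, Rnd.sum_toReal, one_mul]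
    simp only [inner_addValues hd']
    rw [Rnd.E_add, ih (by omega)]
    have := walk_E_fst (O := O) z q x V n (O.gain z w n)
    simp only [div_eq_inv_mul, Rnd.E_mul_left]
    simp only [Oracles.gain] at this ⊢
    rw [this]; ring

omit [Fintype X] in
theorem value_abs_le (hg : ∀ m x, |O.g m x| ≤ 1) (m : ℕ) (y : X) : |O.value m (some y)| ≤ 1 := by
  simp only [Oracles.value]; split_ifs
  · exact hg _ _
  · simp

/-- The middle clause, that later windows are still untouched, shows that a walk changes each
coordinate at most once and hence by at most `1 / q`. -/
theorem walk_all (hg : ∀ m x, |O.g m x| ≤ 1) (z q : ℕ) (x : X) (V : ℕ → ℝ) (n : ℕ) :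
    (Rnd.iter (O.walkStep z q) n (x, V)).All fun a => (∀ j < z, a.2 j = V j) ∧
      (∀ j, z + n * O.M ≤ j → a.2 j = V j) ∧ ∀ j, |a.2 j - V j| ≤ 1 / q := by
  refine Rnd.iter_all (Q := fun n (a : X × (ℕ → ℝ)) => (∀ j < z, a.2 j = V j) ∧
      (∀ j, z + n * O.M ≤ j → a.2 j = V j) ∧ ∀ j, |a.2 j - V j| ≤ 1 / q)
    (fun i a ha => ?_) ⟨fun _ _ => rfl, fun _ _ => rfl, fun j => by simp⟩ n
  intro y
  obtain ⟨h1, h2, h3⟩ := ha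
  simp only [Rnd.All_ret, Oracles.addValues]
  refine ⟨fun j hj => ?_, fun j hj => ?_, fun j => ?_⟩
  · rw [if_neg (by omega), h1 j hj]
  · rw [add_mul, one_mul] at hj
    rw [if_neg (by omega), h2 j (by omega)]
  · split_ifs with h
    · rw [h2 j h.1, add_sub_cancel_left, abs_div, Nat.abs_cast]
      gcongr
      exact value_abs_le hg _ _
    · exact h3 j

theorem walkModel_all (hg : ∀ m x, |O.g m x| ≤ 1) (z q : ℕ) (x : X) (V : ℕ → ℝ) :
    (O.walkModel z q x V).All fun V' => (∀ j < z, V' j = V j) ∧ ∀ j, |V' j - V j| ≤ 1 / q := by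
  rw [Oracles.walkModel, Rnd.map, Rnd.All_bind]
  exact (walk_all hg z q x V (z + 1)).mono fun a ha => ⟨ha.1, ha.2.2⟩

theorem featModel_all (hg : ∀ m x, |O.g m x| ≤ 1) {z q : ℕ} (hq : 0 < q) {pts : ℕ → Option X}
    (hp : ∀ j, z ≤ j → pts j = none) (x : X) :
    (O.featModel z q pts x).All fun V => ∀ j, |V j| ≤ 1 := by
  have hq' : (0 : ℝ) < q := by exact_mod_cast hq
  have := Rnd.iter_all (f := fun _ => O.walkModel z q x)
    (Q := fun n V => (∀ j < z, |V j| ≤ 1) ∧ ∀ j, z ≤ j → |V j| ≤ n / q)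
    (fun i V hV => (walkModel_all hg z q x V).mono fun V' hV' => ?_)
    (a := indicators pts x) ⟨fun j _ => ?_, fun j hj => ?_⟩ q
  · refine this.mono fun V hV j => ?_
    rcases lt_or_ge j z with h | h
    · exact hV.1 j h
    · have := hV.2 j h
      rwa [div_self hq'.ne'] at this
  · refine ⟨fun j hj => by rw [hV'.1 j hj]; exact hV.1 j hj, fun j hj => ?_⟩
    have h1 := hV.2 j hj
    have h2 := hV'.2 j
    have : V' j = V j + (V' j - V j) := by ring
    rw [this]
    refine (abs_add_le _ _).trans ?_
    push_cast
    rw [add_div]; linarith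
  · unfold indicators; split_ifs <;> simp
  · simp [indicators, hp j hj]

/-- The mean prediction of the weights that belong to the walk. -/
def Oracles.walkMean (O : Oracles X) (z : ℕ) (w : ℕ → ℝ) (x : X) : ℝ :=
  ∑ t ∈ Finset.range (z + 1), (avg O.next)^[t] (O.gain z w t) x

theorem abs_inner_sub_le {z d q : ℕ} {w V V' : ℕ → ℝ} {W : ℝ}
    (hW : ∑ j ∈ Finset.Ico z d, |w j| ≤ W) (h1 : ∀ j < z, V' j = V j)
    (h2 : ∀ j, |V' j - V j| ≤ 1 / q) (hzd : z ≤ d) : |inner d w V' - inner d w V| ≤ W / q := by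
  unfold inner
  rw [← Finset.sum_sub_distrib, Finset.range_eq_Ico, ← Finset.sum_Ico_consecutive _ (Nat.zero_le z) hzd,
    Finset.sum_eq_zero (s := Finset.Ico 0 z), zero_add]
  · refine (Finset.abs_sum_le_sum_abs _ _).trans ?_
    calc _ ≤ ∑ j ∈ Finset.Ico z d, |w j| * (1 / q) := Finset.sum_le_sum fun j _ => by
          rw [← mul_sub, abs_mul]; gcongr; exact h2 j
      _ = (∑ j ∈ Finset.Ico z d, |w j|) / q := by rw [← Finset.sum_mul, mul_one_div]
      _ ≤ _ := by gcongr
  · intro j hj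
    rw [h1 j (Finset.mem_Ico.1 hj).2, sub_self]

/-- A martingale argument in the form of a drift bound for the squared deviation. Each walk adds an
increment with the same mean `μ` and with modulus at most `W / q`, so the cross term cancels and the
second moment remains. -/
theorem feat_variance (hg : ∀ m x, |O.g m x| ≤ 1) {z q d : ℕ} (hd : d = z + O.M * (z + 1))
    {w : ℕ → ℝ} {W : ℝ} (hW : ∑ j ∈ Finset.Ico z d, |w j| ≤ W) (x : X) (V : ℕ → ℝ) (n : ℕ) :
    ((Rnd.iter (fun _ => O.walkModel z q x) n V).E fun V' =>
      (inner d w V' - inner d w V - n * (O.walkMean z w x / q)) ^ 2) ≤ n * (W / q) ^ 2 := by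
  have hzd : z ≤ d := by omega
  have key := Rnd.E_iter_le (f := fun _ => O.walkModel z q x)
    (Φ := fun n V' => (inner d w V' - inner d w V - n * (O.walkMean z w x / q)) ^ 2)
    (c := (W / q) ^ 2) (Q := fun _ _ => True)
    (fun _ _ _ => Rnd.all_true _ fun _ => trivial) (fun i V' _ => ?_) (a := V) trivial n
  · simpa using key
  · set μ := O.walkMean z w x / q
    set Z := inner d w V' - inner d w V - i * μ with hZ
    have hmean : ((O.walkModel z q x V').E fun V'' => inner d w V'') = inner d w V' + μ := by
      rw [Oracles.walkModel, Rnd.E_map]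
      exact walk_E_inner (by rw [hd, Nat.mul_comm]) w V' x
    have e : ∀ V'', (inner d w V'' - inner d w V - (i + 1 : ℕ) * μ) ^ 2 =
        (Z ^ 2 + 2 * (Z - μ) * (inner d w V'' - inner d w V')) +
          ((inner d w V'' - inner d w V') ^ 2 + (μ ^ 2 - 2 * Z * μ)) := by
      intro V''; rw [hZ]; push_cast; ring
    simp only [e]
    rw [Rnd.E_add, Rnd.E_add, Rnd.E_const, Rnd.E_mul_left, Rnd.E_sub, hmean, Rnd.E_const, Rnd.E_add, Rnd.E_const]
    have h2 : ((O.walkModel z q x V').E fun V'' => (inner d w V'' - inner d w V') ^ 2) ≤ (W / q) ^ 2 := by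
      refine (Rnd.E_mono_of_All ((walkModel_all hg z q x V').mono fun V'' h => ?_)).trans
        (Rnd.E_const _ _).le
      have := abs_inner_sub_le hW h.1 h.2 hzd
      rw [← sq_abs]; gcongr
    nlinarith [sq_nonneg μ]

/-- The features concentrate. -/
theorem feat_noise (hg : ∀ m x, |O.g m x| ≤ 1) {z r d : ℕ} (hd : d = z + O.M * (z + 1))
    (hr : 0 < r) {w : ℕ → ℝ} {W : ℝ} (hW0 : 0 < W) (hW : ∑ j ∈ Finset.Ico z d, |w j| ≤ W)
    (pts : ℕ → Option X) (x : X) :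
    ((O.featModel z (r * r) pts x).E fun V =>
      |inner d w V - (inner d w (indicators pts x) + O.walkMean z w x)|) ≤ W / r := by
  have hr' : (0 : ℝ) < r := by exact_mod_cast hr
  have hθ : 0 < W / r := by positivity
  have h1 := feat_variance hg (q := r * r) hd hW x (indicators pts x) (r * r)
  have e : ((r * r : ℕ) : ℝ) * (O.walkMean z w x / ((r * r : ℕ) : ℝ)) = O.walkMean z w x := by
    push_cast; field_simp
  have e' : ((r * r : ℕ) : ℝ) * (W / ((r * r : ℕ) : ℝ)) ^ 2 = (W / r) ^ 2 := by
    push_cast; field_simp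
  rw [e, e'] at h1
  -- The inequality of arithmetic and geometric means with parameter `W / r`, in place of
  -- Cauchy–Schwarz, to pass from the second moment to the first absolute moment.
  have h2 : ∀ a : ℝ, |a| ≤ (1 / (2 * (W / r))) * a ^ 2 + W / r / 2 := by
    intro a
    rw [← sq_abs a]
    have : 0 ≤ (|a| - W / r) ^ 2 / (2 * (W / r)) := by positivity
    have e2 : (|a| - W / r) ^ 2 / (2 * (W / r)) =
        1 / (2 * (W / r)) * |a| ^ 2 - |a| + W / r / 2 := by field_simp; ring
    linarith
  refine (Rnd.E_mono _ fun V => h2 _).trans ?_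
  rw [Rnd.E_add, Rnd.E_mul_left, Rnd.E_const]
  have h3 : ∀ V, inner d w V - (inner d w (indicators pts x) + O.walkMean z w x) =
      inner d w V - inner d w (indicators pts x) - O.walkMean z w x := fun V => by ring
  simp only [h3]
  calc _ ≤ 1 / (2 * (W / r)) * (W / r) ^ 2 + W / r / 2 := by gcongr; exact h1
    _ = W / r := by field_simp; ring

end

section

/-! ## Spectral theory of lazy reversible chains -/

section Spectral

variable {X : Type} [Fintype X] {P : X → PMF X} {π : PMF X}
  {lam : Fin (Fintype.card X) → ℝ} {nu : Fin (Fintype.card X) → X → ℝ}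

theorem avg_eq_mulVec (f : X → ℝ) : avg P f = (transitionMatrix P).mulVec f := by
  funext x; rfl

theorem ip_add_left (f g h : X → ℝ) : ip π (fun x => f x + g x) h = ip π f h + ip π g h := by
  unfold ip; rw [← Finset.sum_add_distrib]; exact Finset.sum_congr rfl fun _ _ => by ring

theorem ip_smul_left (c : ℝ) (f h : X → ℝ) : ip π (fun x => c * f x) h = c * ip π f h := by
  unfold ip; rw [Finset.mul_sum]; exact Finset.sum_congr rfl fun _ _ => by ring

theorem ip_sum_left {ι : Type*} (s : Finset ι) (f : ι → X → ℝ) (h : X → ℝ) :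
    ip π (fun x => ∑ i ∈ s, f i x) h = ∑ i ∈ s, ip π (f i) h := by
  unfold ip; rw [Finset.sum_comm]
  exact Finset.sum_congr rfl fun _ _ => by rw [Finset.sum_mul, Finset.mul_sum]

variable [DecidableEq X]

/-- Orthonormality says `W * U = 1`. The basis has as many elements as there are states, so the
matrices are square up to reindexing and `U * W = 1` follows. -/
theorem IsSpectralBasis.completeness (hB : IsSpectralBasis P π lam nu) (x y : X) :
    ∑ l, nu l x * ((π y).toReal * nu l y) = if x = y then 1 else 0 := by
  let U : Matrix X (Fin (Fintype.card X)) ℝ := Matrix.of fun x l => nu l x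
  let W : Matrix (Fin (Fintype.card X)) X ℝ := Matrix.of fun l x => (π x).toReal * nu l x
  have hWU : W * U = 1 := by
    ext l l'
    simp only [Matrix.mul_apply, W, U, Matrix.of_apply, Matrix.one_apply]
    rw [← hB.orthonormal l l', ip]
    exact Finset.sum_congr rfl fun _ _ => by ring
  have hUW : U * W = 1 := (Matrix.mul_eq_one_comm_of_card_eq _ _ _ (by simp)).1 hWU
  have := congrFun (congrFun hUW x) y
  simpa [Matrix.mul_apply, U, W, Matrix.one_apply] using this

theorem IsSpectralBasis.expansion (hB : IsSpectralBasis P π lam nu) (f : X → ℝ) (x : X) :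
    f x = ∑ l, ip π f (nu l) * nu l x := by
  have h : ∀ l, ip π f (nu l) * nu l x = ∑ y, f y * (nu l x * ((π y).toReal * nu l y)) := by
    intro l; rw [ip, Finset.sum_mul]; exact Finset.sum_congr rfl fun _ _ => by ring
  simp only [h]
  rw [Finset.sum_comm]
  simp only [← Finset.mul_sum, hB.completeness]
  simp

theorem IsSpectralBasis.parseval (hB : IsSpectralBasis P π lam nu) (f : X → ℝ) :
    ip π f f = ∑ l, ip π f (nu l) ^ 2 := by
  conv_lhs => rw [ip]
  have h : ∀ x, (π x).toReal * (f x * f x) =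
      ∑ l, ip π f (nu l) * ((π x).toReal * (f x * nu l x)) := by
    intro x
    conv_lhs => rw [hB.expansion f x]
    rw [← hB.expansion f x]
    conv_lhs => rw [show (π x).toReal * (f x * f x) = (π x).toReal * f x * f x by ring]
    conv_lhs => arg 2; rw [hB.expansion f x]
    rw [Finset.mul_sum]
    exact Finset.sum_congr rfl fun _ _ => by ring
  simp only [h]
  rw [Finset.sum_comm]
  refine Finset.sum_congr rfl fun l _ => ?_
  rw [← Finset.mul_sum, sq]; rfl

/-- Each eigenvalue is the quadratic form of the chain at its eigenvector; in the sum over all of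
them completeness leaves only the diagonal. -/
theorem IsSpectralBasis.trace (hB : IsSpectralBasis P π lam nu) :
    ∑ l, lam l = ∑ x, transitionMatrix P x x := by
  have h : ∀ l, lam l = ∑ x, ∑ y, transitionMatrix P x y * (nu l y * ((π x).toReal * nu l x)) := by
    intro l
    have h1 := hB.orthonormal l l
    rw [if_pos rfl] at h1
    calc lam l = lam l * ip π (nu l) (nu l) := by rw [h1, mul_one]
      _ = ∑ x, (lam l • nu l) x * ((π x).toReal * nu l x) := by
        rw [ip, Finset.mul_sum]
        exact Finset.sum_congr rfl fun _ _ => by simp [Pi.smul_apply]; ring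
      _ = _ := by
        rw [← hB.eigen l]
        refine Finset.sum_congr rfl fun x _ => ?_
        rw [Matrix.mulVec, dotProduct, Finset.sum_mul]
        exact Finset.sum_congr rfl fun _ _ => by ring
  simp only [h]
  rw [Finset.sum_comm]
  refine Finset.sum_congr rfl fun x _ => ?_
  rw [Finset.sum_comm]
  simp only [← Finset.mul_sum, hB.completeness]
  simp

omit [DecidableEq X] in
theorem IsLazyReversibleChain.avg_symm (hP : IsLazyReversibleChain P π) (f g : X → ℝ) :
    ip π (avg P f) g = ip π f (avg P g) := by
  unfold ip avg
  have h1 : ∀ x, (π x).toReal * ((∑ y, (P x y).toReal * f y) * g x) =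
      ∑ y, ((π x).toReal * (P x y).toReal) * (f y * g x) := by
    intro x; rw [Finset.sum_mul, Finset.mul_sum]; exact Finset.sum_congr rfl fun _ _ => by ring
  have h2 : ∀ x, (π x).toReal * (f x * ∑ y, (P x y).toReal * g y) =
      ∑ y, ((π x).toReal * (P x y).toReal) * (f x * g y) := by
    intro x; rw [Finset.mul_sum, Finset.mul_sum]; exact Finset.sum_congr rfl fun _ _ => by ring
  simp only [h1, h2]
  rw [Finset.sum_comm]
  refine Finset.sum_congr rfl fun x _ => Finset.sum_congr rfl fun y _ => ?_
  rw [← ENNReal.toReal_mul, ← ENNReal.toReal_mul, hP.reversible]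

omit [DecidableEq X] in
theorem ip_avg_iterate (hP : IsLazyReversibleChain P π) (hB : IsSpectralBasis P π lam nu)
    (f : X → ℝ) (t : ℕ) (l : Fin (Fintype.card X)) :
    ip π ((avg P)^[t] f) (nu l) = lam l ^ t * ip π f (nu l) := by
  induction t with
  | zero => simp
  | succ t ih =>
    rw [Function.iterate_succ_apply', hP.avg_symm, avg_eq_mulVec, hB.eigen]
    have : ip π ((avg P)^[t] f) (lam l • nu l) = lam l * ip π ((avg P)^[t] f) (nu l) := by
      unfold ip; rw [Finset.mul_sum]
      exact Finset.sum_congr rfl fun _ _ => by simp [Pi.smul_apply]; ring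
    rw [this, ih]; ring

omit [DecidableEq X] in
theorem transitionMatrix_row_sum (x : X) : ∑ y, transitionMatrix P x y = 1 := Rnd.sum_toReal (P x)

/-- Gershgorin's argument at a state where the eigenvector has maximal modulus gives `|λ - P(x,x)| ≤
1 - P(x,x)`, and laziness makes the lower end nonnegative. -/
theorem eigenvalue_mem_Icc (hP : IsLazyReversibleChain P π) (hB : IsSpectralBasis P π lam nu)
    (l : Fin (Fintype.card X)) : 0 ≤ lam l ∧ lam l ≤ 1 := by
  have hne : Nonempty X := Fintype.card_pos_iff.1 (Nat.zero_lt_of_lt l.isLt)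
  obtain ⟨x, -, hx⟩ := Finset.exists_max_image Finset.univ (fun x => |nu l x|) Finset.univ_nonempty
  have hpos : 0 < |nu l x| := by
    by_contra h
    have h0 : ∀ y, nu l y = 0 := fun y => by
      have := hx y (Finset.mem_univ _)
      exact abs_nonpos_iff.1 (this.trans (not_lt.1 h))
    have := hB.orthonormal l l
    simp [ip, h0] at this
  have heq : (lam l - transitionMatrix P x x) * nu l x =
      ∑ y ∈ Finset.univ.erase x, transitionMatrix P x y * nu l y := by
    have := congrFun (hB.eigen l) x
    simp only [Matrix.mulVec, dotProduct, Pi.smul_apply, smul_eq_mul] at this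
    rw [← Finset.add_sum_erase _ _ (Finset.mem_univ x)] at this
    linarith
  have hle : |lam l - transitionMatrix P x x| * |nu l x| ≤ (1 - transitionMatrix P x x) * |nu l x| := by
    rw [← abs_mul, heq]
    refine (Finset.abs_sum_le_sum_abs _ _).trans ?_
    have hs := transitionMatrix_row_sum (P := P) x
    rw [← Finset.add_sum_erase _ _ (Finset.mem_univ x)] at hs
    rw [← hs, add_sub_cancel_left, Finset.sum_mul]
    refine Finset.sum_le_sum fun y _ => ?_
    rw [abs_mul]
    have : 0 ≤ transitionMatrix P x y := ENNReal.toReal_nonneg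
    rw [abs_of_nonneg this]
    exact mul_le_mul_of_nonneg_left (hx y (Finset.mem_univ _)) this
  have := abs_le.1 (le_of_mul_le_mul_right hle hpos)
  have := hP.lazy x
  constructor <;> linarith

/-- The constant `1` is a fixed point and not zero, so by Parseval it has a nonzero coefficient; the
corresponding eigenvalue must be `1`. -/
theorem top_eigenvalue (hP : IsLazyReversibleChain P π) (hB : IsSpectralBasis P π lam nu)
    (h : 0 < Fintype.card X) : lam ⟨0, h⟩ = 1 := by
  have h1 : avg P (fun _ => 1) = fun _ => 1 := by
    funext x; simp only [avg, mul_one]; exact Rnd.sum_toReal _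
  have hex : ∃ l, ip π (fun _ => 1) (nu l) ≠ 0 := by
    by_contra hall
    push Not at hall
    have := hB.parseval (π := π) (fun _ => 1)
    simp only [hall] at this
    simp only [ip, mul_one, Rnd.sum_toReal] at this
    norm_num at this
  obtain ⟨l, hl⟩ := hex
  have h2 := ip_avg_iterate hP hB (fun _ => 1) 1 l
  rw [Function.iterate_one, h1, pow_one] at h2
  have h3 : lam l = 1 := by
    have : (lam l - 1) * ip π (fun _ => 1) (nu l) = 0 := by linarith
    rcases mul_eq_zero.1 this with h | h
    · linarith
    · exact absurd h hl
  refine le_antisymm (eigenvalue_mem_Icc hP hB _).2 ?_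
  rw [← h3]
  exact hB.antitone (Nat.zero_le _ : (⟨0, h⟩ : Fin _).val ≤ l.val)

variable {N k : ℕ} {γ c : ℝ} {i : ℕ → ℕ}

omit [DecidableEq X] in
theorem IsDiscreteSpectrum.mono' {d : ℕ} {lam : Fin d → ℝ} (hS : IsDiscreteSpectrum lam N k γ c i)
    {a b : ℕ} (hab : a ≤ b) (hb : b ≤ k) : i a ≤ i b := by
  induction b, hab using Nat.le_induction with
  | base => exact le_rfl
  | succ b _ ih => exact (ih (by omega)).trans (hS.mono b (by omega))

omit [DecidableEq X] in
theorem IsDiscreteSpectrum.first_le {d : ℕ} {lam : Fin d → ℝ}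
    (hS : IsDiscreteSpectrum lam N k γ c i) : i 1 ≤ N := by
  have := hS.block_size 0 (by have := hS.one_le_k; omega)
  rw [hS.start] at this; simpa using this

/-- A chain whose first spectral gap is large has few states. -/
theorem card_le_of_small_ratio (hP : IsLazyReversibleChain P π) (hB : IsSpectralBasis P π lam nu)
    (hS : IsDiscreteSpectrum lam N k γ c i) (hγ : γ < 1 / 4) : Fintype.card X ≤ 4 * N := by
  have hi1 := hS.one_le_first
  -- At most `N` eigenvalues lie in the first block, and all others are at most `γ < 1/4`. The trace
  -- is at least half the number of states, so the first block must be a sizeable part of all.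
  have hle : ∀ l : Fin (Fintype.card X), lam l ≤ (if l.val < i 1 then 3 / 4 else 0) + 1 / 4 := by
    intro l
    have hl := eigenvalue_mem_Icc hP hB l
    split_ifs with h
    · linarith
    · have hlt : i 1 < Fintype.card X := by have := l.isLt; omega
      have h1 := hS.gap 1 le_rfl hS.one_le_k ⟨i 1 - 1, by omega⟩ ⟨i 1, hlt⟩
        (by simp; omega) rfl
      have h2 : lam l ≤ lam ⟨i 1, hlt⟩ := hB.antitone (by
        show i 1 ≤ l.val; omega)
      have h3 := eigenvalue_mem_Icc hP hB ⟨i 1 - 1, by omega⟩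
      nlinarith [hS.gamma_pos]
  have h1 : (Fintype.card X : ℝ) / 2 ≤ ∑ l, lam l := by
    rw [hB.trace]
    calc (Fintype.card X : ℝ) / 2 = ∑ x : X, (1 / 2 : ℝ) := by simp; ring
      _ ≤ _ := Finset.sum_le_sum fun x _ => hP.lazy x
  have h2 : ∑ l : Fin (Fintype.card X), ((if l.val < i 1 then (3 / 4 : ℝ) else 0) + 1 / 4) ≤
      3 / 4 * N + 1 / 4 * Fintype.card X := by
    rw [Finset.sum_add_distrib, ← Finset.sum_filter]
    simp only [Finset.sum_const, nsmul_eq_mul, Finset.card_univ, Fintype.card_fin]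
    have : (Finset.univ.filter fun l : Fin (Fintype.card X) => l.val < i 1).card ≤ N := by
      refine le_trans ?_ hS.first_le
      have := Finset.card_le_card_of_injOn (s := Finset.univ.filter fun l : Fin (Fintype.card X) => l.val < i 1)
        (t := Finset.range (i 1)) Fin.val (fun l hl => by simpa using hl) (fun a _ b _ h => Fin.ext h)
      simpa using this
    have : ((Finset.univ.filter fun l : Fin (Fintype.card X) => l.val < i 1).card : ℝ) ≤ N := by
      exact_mod_cast this
    linarith
  have h3 := (h1.trans (Finset.sum_le_sum fun l _ => hle l)).trans h2
  have : (Fintype.card X : ℝ) ≤ 3 * N := by linarith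
  have : Fintype.card X ≤ 3 * N := by exact_mod_cast this
  omega

theorem IsDiscreteSpectrum.c_nonneg (hP : IsLazyReversibleChain P π)
    (hB : IsSpectralBasis P π lam nu) (hS : IsDiscreteSpectrum lam N k γ c i) : 0 ≤ c := by
  have h1 : 1 ≤ i k := hS.one_le_first.trans (hS.mono' hS.one_le_k le_rfl)
  have h2 := hS.not_small ⟨i k - 1, by have := hS.last_le; omega⟩ (by simp; omega)
  by_contra h
  have := Real.one_lt_rpow_of_pos_of_lt_one_of_neg hS.gamma_pos hS.gamma_lt_one (not_le.1 h)
  linarith [(eigenvalue_mem_Icc hP hB ⟨i k - 1, by have := hS.last_le; omega⟩).2]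

/-- The normalized exponent and number of blocks describe the same discrete spectrum. -/
theorem IsDiscreteSpectrum.normalized {p : Params} (hP : IsLazyReversibleChain P π)
    (hB : IsSpectralBasis P π lam nu) (hS : IsDiscreteSpectrum lam p.N p.k p.γ p.c i) :
    1 ≤ p.blocks ∧ p.blocks ≤ p.k ∧ i p.blocks = i p.k ∧ 0 ≤ p.expo ∧
      ∀ a : Fin (Fintype.card X), a.val + 1 ≤ i p.k → p.γ ^ p.expo ≤ lam a := by
  have hc := hS.c_nonneg hP hB
  have hk := hS.one_le_k
  have h1 : 1 ≤ i p.k := hS.one_le_first.trans (hS.mono' hk le_rfl)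
  have hlast := hS.last_le
  have hexpo : 0 ≤ p.expo ∧ p.γ ^ p.expo ≤ lam ⟨i p.k - 1, by omega⟩ := by
    unfold Params.expo
    split_ifs with h
    -- Here `N = k = 1`, and the only eigenvalue concerned is `1 = γ ^ 0`.
    · have hN := hS.first_le
      have hi := hS.one_le_first
      have hk1 : p.k = 1 := by omega
      have : i p.k = 1 := by rw [hk1]; omega
      refine ⟨le_rfl, ?_⟩
      rw [Real.rpow_zero]
      have htop := top_eigenvalue hP hB (by omega)
      simp only [this]
      exact htop.ge
    · exact ⟨hc, hS.not_small _ (by simp; omega)⟩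
  have hall : ∀ a : Fin (Fintype.card X), a.val + 1 ≤ i p.k → p.γ ^ p.expo ≤ lam a :=
    fun a ha => hexpo.2.trans (hB.antitone (by show a.val ≤ i p.k - 1; omega))
  unfold Params.blocks
  split_ifs with h
  · refine ⟨le_rfl, hk, ?_, hexpo.1, hall⟩
    -- A further nonempty block would start with an eigenvalue that is at most `γ` by the first gap,
    -- yet at least `γ ^ expo > γ`.
    by_contra hne
    have hlt : i 1 < i p.k := lt_of_le_of_ne (hS.mono' hk le_rfl) hne
    have hi := hS.one_le_first
    have h2 := hS.gap 1 le_rfl hk ⟨i 1 - 1, by omega⟩ ⟨i 1, by omega⟩ (by simp; omega) rfl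
    have h3 := hall ⟨i 1, by omega⟩ hlt
    have h4 := (eigenvalue_mem_Icc hP hB ⟨i 1 - 1, by omega⟩)
    have h5 : p.γ ^ (1 : ℝ) < p.γ ^ p.expo :=
      Real.rpow_lt_rpow_of_exponent_gt hS.gamma_pos hS.gamma_lt_one h
    rw [Real.rpow_one] at h5
    nlinarith [hS.gamma_pos]
  · exact ⟨hk, le_rfl, rfl, hexpo.1, hall⟩

end Spectral

end

section

/-! ## Approximation by the evolved functions of a useful collection -/

theorem norm_le_of_abs_le {ι : Type*} [Fintype ι] {u v : EuclideanSpace ℝ ι} {K : ℝ} (hK : 0 ≤ K)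
    (h : ∀ l, |u l| ≤ K * |v l|) : ‖u‖ ≤ K * ‖v‖ := by
  rw [EuclideanSpace.norm_eq, EuclideanSpace.norm_eq, ← Real.sqrt_sq hK, ← Real.sqrt_mul (sq_nonneg K)]
  refine Real.sqrt_le_sqrt ?_
  rw [Finset.mul_sum]
  refine Finset.sum_le_sum fun l _ => ?_
  rw [Real.norm_eq_abs, Real.norm_eq_abs, ← mul_pow]
  exact pow_le_pow_left₀ (abs_nonneg _) (h l) 2

/-- The coordinates from `a` on. -/
def cut {d : ℕ} (a : ℕ) (v : EuclideanSpace ℝ (Fin d)) : EuclideanSpace ℝ (Fin d) :=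
  WithLp.toLp 2 fun l => if a ≤ l.val then v l else 0

@[simp] theorem cut_apply {d : ℕ} (a : ℕ) (v : EuclideanSpace ℝ (Fin d)) (l : Fin d) :
    cut a v l = if a ≤ l.val then v l else 0 := rfl

theorem cut_add {d : ℕ} (a : ℕ) (u v : EuclideanSpace ℝ (Fin d)) :
    cut a (u + v) = cut a u + cut a v := by
  ext l; simp only [cut_apply, PiLp.add_apply]; split_ifs <;> simp

theorem cut_sub {d : ℕ} (a : ℕ) (u v : EuclideanSpace ℝ (Fin d)) :
    cut a (u - v) = cut a u - cut a v := by
  ext l; simp only [cut_apply, PiLp.sub_apply]; split_ifs <;> simp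

theorem cut_smul {d : ℕ} (a : ℕ) (c : ℝ) (u : EuclideanSpace ℝ (Fin d)) :
    cut a (c • u) = c • cut a u := by
  ext l; simp only [cut_apply, PiLp.smul_apply]; split_ifs <;> simp

theorem cut_sum {d : ℕ} {ι : Type*} (s : Finset ι) (a : ℕ) (u : ι → EuclideanSpace ℝ (Fin d)) :
    cut a (∑ m ∈ s, u m) = ∑ m ∈ s, cut a (u m) := by
  classical
  induction s using Finset.induction_on with
  | empty => ext l; simp
  | insert m s hm ih => rw [Finset.sum_insert hm, Finset.sum_insert hm, cut_add, ih]

variable {X : Type} [Fintype X] {P : X → PMF X} {π : PMF X}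
  {lam : Fin (Fintype.card X) → ℝ} {nu : Fin (Fintype.card X) → X → ℝ}
  {N k M : ℕ} {γ c α : ℝ} {i : ℕ → ℕ} {g : Fin M → X → ℝ}

/-- The coefficients with respect to the spectral basis. -/
def coeffs (π : PMF X) (nu : Fin (Fintype.card X) → X → ℝ) (f : X → ℝ) :
    EuclideanSpace ℝ (Fin (Fintype.card X)) :=
  WithLp.toLp 2 fun l => ip π f (nu l)

@[simp] theorem coeffs_apply (f : X → ℝ) (l : Fin (Fintype.card X)) :
    coeffs π nu f l = ip π f (nu l) := rfl

theorem norm_coeffs_sq (hB : IsSpectralBasis P π lam nu) (f : X → ℝ) :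
    ‖coeffs π nu f‖ ^ 2 = ip π f f := by
  classical
  rw [EuclideanSpace.norm_sq_eq, hB.parseval]
  simp

theorem norm_coeffs_le_one (hB : IsSpectralBasis P π lam nu) {f : X → ℝ} (hf : ∀ x, |f x| ≤ 1) :
    ‖coeffs π nu f‖ ≤ 1 := by
  rw [← sq_le_one_iff₀ (norm_nonneg _), norm_coeffs_sq hB, ip, ← Rnd.sum_toReal π]
  refine Finset.sum_le_sum fun x _ => mul_le_of_le_one_right ENNReal.toReal_nonneg ?_
  rw [← sq, sq_le_one_iff_abs_le_one]; exact hf x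

/-- The mean distance of two functions is at most the distance of their coefficients. -/
theorem sum_abs_sub_le (hB : IsSpectralBasis P π lam nu) (f h : X → ℝ) :
    ∑ x, (π x).toReal * |f x - h x| ≤ ‖coeffs π nu f - coeffs π nu h‖ := by
  have e : coeffs π nu f - coeffs π nu h = coeffs π nu (fun x => f x - h x) := by
    ext l
    have h1 := ip_add_left (π := π) f (fun x => (-1) * h x) (nu l)
    rw [ip_smul_left] at h1
    simp only [PiLp.sub_apply, coeffs_apply]
    have : (fun x => f x - h x) = fun x => f x + (-1) * h x := by funext x; ring
    rw [this, h1]; ring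
  rw [e]
  refine (sq_le_sq₀ (Finset.sum_nonneg fun x _ => by positivity) (norm_nonneg _)).1 ?_
  rw [norm_coeffs_sq hB, ip]
  have cs := Finset.sum_mul_sq_le_sq_mul_sq Finset.univ (fun x => √(π x).toReal)
    fun x => √(π x).toReal * |f x - h x|
  have h1 : ∀ x, √(π x).toReal * (√(π x).toReal * |f x - h x|) = (π x).toReal * |f x - h x| := by
    intro x; rw [← mul_assoc, Real.mul_self_sqrt ENNReal.toReal_nonneg]
  have h2 : ∀ x, (√(π x).toReal * |f x - h x|) ^ 2 =
      (π x).toReal * ((f x - h x) * (f x - h x)) := by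
    intro x; rw [mul_pow, Real.sq_sqrt ENNReal.toReal_nonneg, sq_abs, sq]
  have h3 : ∀ x, √(π x).toReal ^ 2 = (π x).toReal := fun x => Real.sq_sqrt ENNReal.toReal_nonneg
  simp only [h1, h2, h3, Rnd.sum_toReal, one_mul] at cs
  exact cs

/-- An evolved function has small coefficients where the eigenvalues are small. -/
theorem norm_cut_coeffs_le (hP : IsLazyReversibleChain P π) (hB : IsSpectralBasis P π lam nu)
    {f : X → ℝ} (hf : ∀ x, |f x| ≤ 1) {a t : ℕ} {ρ : ℝ} (hρ : 0 ≤ ρ)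
    (h : ∀ l : Fin (Fintype.card X), a ≤ l.val → lam l ≤ ρ) :
    ‖cut a (coeffs π nu ((avg P)^[t] f))‖ ≤ ρ ^ t := by
  refine (norm_le_of_abs_le (v := coeffs π nu f) (pow_nonneg hρ t) fun l => ?_).trans
    (mul_le_of_le_one_right (pow_nonneg hρ t) (norm_coeffs_le_one hB hf))
  classical
  rw [cut_apply]
  split_ifs with hl
  · have h0 := (eigenvalue_mem_Icc hP hB l).1
    rw [coeffs_apply, coeffs_apply, ip_avg_iterate hP hB, abs_mul, abs_of_nonneg (pow_nonneg h0 t)]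
    gcongr
    exact h l hl
  · rw [abs_zero]; positivity

/-- Multiplying a row vector amounts to applying the adjoint, which has the same operator norm. -/
theorem norm_vecMul_le {ι : Type*} [Fintype ι] [DecidableEq ι] (A : Matrix ι ι ℝ) {α : ℝ}
    (hA : ‖Matrix.toEuclideanCLM (𝕜 := ℝ) A‖ ≤ α) (b : ι → ℝ) :
    ‖WithLp.toLp 2 (Matrix.vecMul b A)‖ ≤ α * ‖WithLp.toLp 2 b‖ := by
  have h1 : ‖Matrix.toEuclideanCLM (𝕜 := ℝ) (star A)‖ ≤ α := by
    rw [map_star, ContinuousLinearMap.star_eq_adjoint, LinearIsometryEquiv.norm_map]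
    exact hA
  have h2 : WithLp.toLp 2 (Matrix.vecMul b A) =
      Matrix.toEuclideanCLM (𝕜 := ℝ) (star A) (WithLp.toLp 2 b) := by
    rw [Matrix.toEuclideanCLM_toLp, Matrix.star_eq_conjTranspose,
      Matrix.conjTranspose_eq_transpose_of_trivial, Matrix.mulVec_transpose]
  rw [h2]
  exact (ContinuousLinearMap.le_opNorm _ _).trans (by gcongr)

theorem card_block_le (hS : IsDiscreteSpectrum lam N k γ c i) {j : ℕ} (hj : j < k) :
    Fintype.card (Block (Fintype.card X) i j) ≤ N := by
  refine le_trans ?_ (hS.block_size j hj)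
  rw [← Nat.card_Ico, ← Fintype.card_coe]
  refine Fintype.card_le_of_injective (fun l => ⟨l.1.val, Finset.mem_Ico.2 l.2⟩) fun a b h => ?_
  simp only [Subtype.mk.injEq] at h
  exact Subtype.ext (Fin.ext h)

/-- Evolution for `t` steps scales the coefficients by `lam l ^ t`, so the target is divided by
these powers before the coefficient matrix is inverted. The resulting weights are of order `ν^(-t)`
for the least eigenvalue `ν` of the block. Beyond the block evolved functions have norm at most `(γ
ν)^t`; the powers of `ν` cancel, and the spill depends on `γ^t` alone. -/
theorem exists_block_coeffs (hP : IsLazyReversibleChain P π) (hB : IsSpectralBasis P π lam nu)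
    (hS : IsDiscreteSpectrum lam N k γ c i) (hG : IsUseful π nu k i g α) (hα : 0 ≤ α)
    {j t : ℕ} (hj : j < k) {H B : ℝ} (hH0 : 0 ≤ H)
    (hpos : ∀ a : Fin (Fintype.card X), a.val + 1 ≤ i k → 0 < lam a)
    (hH : ∀ a : Fin (Fintype.card X), a.val + 1 ≤ i k → 1 ≤ H * lam a ^ t)
    (v : EuclideanSpace ℝ (Fin (Fintype.card X))) (hv : ‖v‖ ≤ B) :
    ∃ β : Fin M → ℝ, ∑ m, |β m| ≤ N * α * H * B ∧
      (∀ l : Fin (Fintype.card X), i j ≤ l.val → l.val < i (j + 1) →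
        (∑ m, β m • coeffs π nu ((avg P)^[t] (g m))) l = v l) ∧
      ‖cut (i (j + 1)) (∑ m, β m • coeffs π nu ((avg P)^[t] (g m)))‖ ≤ N * α * γ ^ t * B := by
  have hB0 : 0 ≤ B := (norm_nonneg v).trans hv
  have hγ := hS.gamma_pos
  -- An empty block has no least eigenvalue, and nothing needs to be matched on it.
  rcases (hS.mono j hj).eq_or_lt with heq | hlt
  · refine ⟨fun _ => 0, by simp; positivity, fun l h1 h2 => by omega, ?_⟩
    have : cut (i (j + 1)) (∑ m : Fin M, (0 : ℝ) • coeffs π nu ((avg P)^[t] (g m))) = 0 := by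
      ext l; simp
    rw [this, norm_zero]; positivity
  obtain ⟨e, A, hA, hdet, hnorm⟩ := hG.well_conditioned j hj
  have hik : i (j + 1) ≤ i k := hS.mono' hj le_rfl
  have hid : i k ≤ Fintype.card X := hS.last_le
  let top : Fin (Fintype.card X) := ⟨i (j + 1) - 1, by omega⟩
  set ν := lam top
  have hν : 0 < ν := hpos top (by simp [top]; omega)
  let b : Block (Fintype.card X) i j → ℝ := fun l => v l.1 / lam l.1 ^ t
  let b' : Block (Fintype.card X) i j → ℝ := Matrix.vecMul b A⁻¹
  have hb'A : Matrix.vecMul b' A = b := by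
    rw [Matrix.vecMul_vecMul, Matrix.nonsing_inv_mul _ hdet, Matrix.vecMul_one]
  have hbn : ‖WithLp.toLp 2 b‖ ≤ B / ν ^ t := by
    have h1 : ‖WithLp.toLp 2 b‖ ≤ (1 / ν ^ t) * ‖WithLp.toLp 2 fun l : Block (Fintype.card X) i j => v l.1‖ := by
      refine norm_le_of_abs_le (by positivity) fun l => ?_
      have hl : 0 < lam l.1 := hpos l.1 (by have := l.2.2; omega)
      have hle : ν ≤ lam l.1 := hB.antitone (by
        show l.1.val ≤ i (j + 1) - 1
        have := l.2.2; omega)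
      simp only [b]
      rw [abs_div, abs_of_pos (pow_pos hl t), div_eq_mul_one_div, mul_comm]
      gcongr
    have h2 : ‖WithLp.toLp 2 fun l : Block (Fintype.card X) i j => v l.1‖ ≤ ‖v‖ := by
      rw [EuclideanSpace.norm_eq, EuclideanSpace.norm_eq]
      refine Real.sqrt_le_sqrt ?_
      classical
      refine (Finset.sum_map Finset.univ (Function.Embedding.subtype _)
        fun l => ‖v l‖ ^ 2).symm.trans_le ?_
      exact Finset.sum_le_univ_sum_of_nonneg fun l => by positivity
    calc _ ≤ _ := h1
      _ ≤ (1 / ν ^ t) * B := by gcongr; exact h2.trans hv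
      _ = _ := by ring
  have hb'n : ‖WithLp.toLp 2 b'‖ ≤ α * (B / ν ^ t) :=
    (norm_vecMul_le _ hnorm b).trans (by gcongr)
  have hb'1 : ∑ r, |b' r| ≤ N * (α * (B / ν ^ t)) := by
    calc ∑ r, |b' r| ≤ ∑ r : Block (Fintype.card X) i j, α * (B / ν ^ t) :=
          Finset.sum_le_sum fun r _ => (PiLp.norm_apply_le (WithLp.toLp 2 b') r).trans hb'n
      _ = Fintype.card (Block (Fintype.card X) i j) * (α * (B / ν ^ t)) := by simp
      _ ≤ _ := by
        gcongr
        exact_mod_cast card_block_le hS hj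
  -- The choice `e` is not assumed injective, so the weights are summed over its fibres.
  let β : Fin M → ℝ := fun m => ∑ r, if e r = m then b' r else 0
  have hβ : ∑ m, |β m| ≤ N * (α * (B / ν ^ t)) := by
    refine le_trans ?_ hb'1
    calc ∑ m, |β m| ≤ ∑ m, ∑ r, |if e r = m then b' r else 0| :=
          Finset.sum_le_sum fun m _ => Finset.abs_sum_le_sum_abs _ _
      _ = ∑ r, ∑ m, |if e r = m then b' r else 0| := Finset.sum_comm
      _ = _ := Finset.sum_congr rfl fun r _ => by
        simp only [apply_ite abs, abs_zero]
        simp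
  refine ⟨β, hβ.trans ?_, fun l h1 h2 => ?_, ?_⟩
  · have : 1 / ν ^ t ≤ H := by
      rw [div_le_iff₀ (pow_pos hν t)]; exact hH top (by simp [top]; omega)
    calc (N : ℝ) * (α * (B / ν ^ t)) = N * α * (1 / ν ^ t) * B := by ring
      _ ≤ _ := by gcongr
  · have hl : 0 < lam l := hpos l (by omega)
    have h3 : (∑ m, β m • coeffs π nu ((avg P)^[t] (g m))) l =
        lam l ^ t * ∑ m, β m * ip π (g m) (nu l) := by
      classical
      simp only [WithLp.ofLp_sum, WithLp.ofLp_smul, Finset.sum_apply, Pi.smul_apply, smul_eq_mul]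
      rw [Finset.mul_sum]
      refine Finset.sum_congr rfl fun m _ => ?_
      have : (coeffs π nu ((avg P)^[t] (g m))).ofLp l = _ := ip_avg_iterate hP hB (g m) t l
      rw [this]; ring
    have h4 : ∑ m, β m * ip π (g m) (nu l) = ∑ r, b' r * ip π (g (e r)) (nu l) := by
      simp only [β, Finset.sum_mul]
      rw [Finset.sum_comm]
      exact Finset.sum_congr rfl fun r _ => by simp
    have h5 := congrFun hb'A ⟨l, h1, h2⟩
    simp only [Matrix.vecMul, dotProduct, hA] at h5
    rw [h3, h4, h5]
    simp only [b]
    field_simp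
  · have h6 : ∀ m, ‖cut (i (j + 1)) (coeffs π nu ((avg P)^[t] (g m)))‖ ≤ (γ * ν) ^ t := by
      intro m
      refine norm_cut_coeffs_le hP hB (hG.bounded m) (by positivity) fun l hl => ?_
      have hlt : i (j + 1) < Fintype.card X := lt_of_le_of_lt hl l.isLt
      have h1 := hS.gap (j + 1) (by omega) hj top ⟨i (j + 1), hlt⟩ (by simp [top]; omega) rfl
      exact (hB.antitone (show (⟨i (j + 1), hlt⟩ : Fin _).val ≤ l.val from hl)).trans h1
    rw [cut_sum]
    calc _ ≤ ∑ m, ‖cut (i (j + 1)) (β m • coeffs π nu ((avg P)^[t] (g m)))‖ := norm_sum_le _ _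
      _ ≤ ∑ m, |β m| * (γ * ν) ^ t := Finset.sum_le_sum fun m _ => by
        rw [cut_smul, norm_smul, Real.norm_eq_abs]; gcongr; exact h6 m
      _ = (∑ m, |β m|) * (γ * ν) ^ t := by rw [Finset.sum_mul]
      _ ≤ N * (α * (B / ν ^ t)) * (γ * ν) ^ t := by gcongr
      _ = _ := by rw [mul_pow]; field_simp

end

section

/-! ## The comparison functions -/

/-- What the analysis needs to know about the parameters. -/
structure Params.Admissible (p : Params) : Prop where
  one_le_N : 1 ≤ p.N
  one_le_blocks : 1 ≤ p.blocks
  gamma_pos : 0 < p.γ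
  gamma_lt_one : p.γ < 1
  expo_nonneg : 0 ≤ p.expo
  alpha_nonneg : 0 ≤ p.α
  eps_pos : 0 < p.ε
  delta_pos : 0 < p.δ
  delta_lt_one : p.δ < 1

namespace Params.Admissible

variable {p : Params} (hp : p.Admissible)
include hp

theorem ratio_pos : 0 < p.ratio := Params.ratio_pos hp.gamma_pos

theorem ratio_lt_one : p.ratio < 1 := Params.ratio_lt_one hp.gamma_lt_one

theorem one_le_inv_ratio : 1 ≤ p.ratio⁻¹ := (one_le_inv₀ hp.ratio_pos).2 hp.ratio_lt_one.le

theorem one_le_N' : (1 : ℝ) ≤ p.N := by exact_mod_cast hp.one_le_N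

theorem one_le_blocks' : (1 : ℝ) ≤ p.blocks := by exact_mod_cast hp.one_le_blocks

theorem one_le_invEps : 1 ≤ p.invEps := by
  have := hp.eps_pos
  rw [Params.invEps, le_add_iff_nonneg_right]; positivity

theorem inv_invEps_le : 1 / p.invEps ≤ p.ε := by
  have := hp.eps_pos
  rw [Params.invEps, div_le_iff₀ (by positivity), mul_add, mul_one_div_cancel this.ne']
  linarith

theorem le_nextBound {B : ℝ} (hB : 0 ≤ B) : B ≤ p.nextBound B := by
  have h1 := hp.one_le_inv_ratio
  have h2 := hp.alpha_nonneg
  rw [Params.nextBound]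
  exact le_mul_of_one_le_right hB (le_add_of_nonneg_right (by positivity))

theorem one_le_coeffBound (j : ℕ) : 1 ≤ p.coeffBound j := by
  induction j with
  | zero => exact le_rfl
  | succ j ih => exact ih.trans (hp.le_nextBound (by linarith))

theorem coeffBound_mono : Monotone p.coeffBound :=
  monotone_nat_of_le_succ fun j => hp.le_nextBound (by linarith [hp.one_le_coeffBound j])

theorem walkLength_mono : Monotone p.walkLength := by
  intro B B' h
  refine Nat.sInf_le (show p.precision B ≤ p.ratio⁻¹ ^ p.walkLength B' from ?_)
  refine le_trans ?_ (Params.precision_le hp.gamma_pos hp.gamma_lt_one B')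
  have := hp.alpha_nonneg
  have := hp.one_le_invEps
  rw [Params.precision, Params.precision]
  gcongr

theorem walkLength_le_lastLength {j : ℕ} (hj : j < p.blocks) :
    p.walkLength (p.coeffBound j) ≤ p.lastLength p.blocks := by
  obtain ⟨b, hb⟩ : ∃ b, p.blocks = b + 1 := ⟨p.blocks - 1, by omega⟩
  rw [hb, Params.lastLength]
  exact hp.walkLength_mono (hp.coeffBound_mono (by omega))

theorem size_terms_nonneg : 0 ≤ 32 * p.N * p.invEps / p.δ := by
  have := hp.one_le_invEps
  have := hp.delta_pos
  positivity

theorem lastLength_le_size : p.lastLength p.blocks ≤ p.size := by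
  have := Nat.le_ceil (p.coeffBound p.blocks + p.lastLength p.blocks + 32 * p.N * p.invEps / p.δ)
  have h1 := hp.one_le_coeffBound p.blocks
  have h2 := hp.size_terms_nonneg
  rw [Params.size]
  have : (p.lastLength p.blocks : ℝ) ≤ _ := le_trans (by linarith) this
  exact_mod_cast this

theorem coeffBound_le_size : p.coeffBound p.blocks ≤ p.size := by
  have := Nat.le_ceil (p.coeffBound p.blocks + p.lastLength p.blocks + 32 * p.N * p.invEps / p.δ)
  have h2 := hp.size_terms_nonneg
  rw [Params.size]
  refine le_trans ?_ this
  have : (0 : ℝ) ≤ p.lastLength p.blocks := by positivity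
  linarith

theorem le_size : 32 * p.N * p.invEps / p.δ ≤ p.size := by
  have := Nat.le_ceil (p.coeffBound p.blocks + p.lastLength p.blocks + 32 * p.N * p.invEps / p.δ)
  have h1 := hp.one_le_coeffBound p.blocks
  rw [Params.size]
  refine le_trans ?_ this
  have : (0 : ℝ) ≤ p.lastLength p.blocks := by positivity
  linarith

/-- This is what `precision` is chosen for: the spills of all blocks together amount to at most `1 /
(8 * invEps) ≤ ε / 8`. -/
theorem spill_le (hγ : p.ratio = p.γ) {B : ℝ} (hB : 0 ≤ B) :
    p.N * p.α * p.γ ^ p.walkLength B * B ≤ 1 / (8 * p.blocks * p.invEps) := by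
  have h := Params.precision_le hp.gamma_pos hp.gamma_lt_one B
  have hα := hp.alpha_nonneg
  have he := hp.one_le_invEps
  have hb := hp.one_le_blocks'
  have hg := hp.gamma_pos
  have hq : 0 < p.γ ^ p.walkLength B := pow_pos hg _
  rw [hγ, inv_pow, ← one_div, le_div_iff₀ hq, Params.precision] at h
  rw [le_div_iff₀ (by positivity)]
  refine le_trans ?_ h
  have : 0 ≤ 8 * p.blocks * p.N * p.invEps * B * p.γ ^ p.walkLength B := by positivity
  nlinarith

end Params.Admissible

variable {X : Type} [Fintype X] {P : X → PMF X} {π : PMF X}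
  {lam : Fin (Fintype.card X) → ℝ} {nu : Fin (Fintype.card X) → X → ℝ}

theorem abs_avg_iterate_le {f : X → ℝ} (hf : ∀ x, |f x| ≤ 1) (t : ℕ) (x : X) :
    |(avg P)^[t] f x| ≤ 1 := by
  induction t generalizing x with
  | zero => exact hf x
  | succ t ih =>
    rw [Function.iterate_succ_apply']
    refine (Finset.abs_sum_le_sum_abs _ _).trans ?_
    rw [← Rnd.sum_toReal (P x)]
    refine Finset.sum_le_sum fun y _ => ?_
    rw [abs_mul, abs_of_nonneg ENNReal.toReal_nonneg]
    exact mul_le_of_le_one_right ENNReal.toReal_nonneg (ih y)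

/-- The coefficients of a combination of evolved functions. -/
def evolved (P : X → PMF X) (π : PMF X) (nu : Fin (Fintype.card X) → X → ℝ) {M : ℕ}
    (g : Fin M → X → ℝ) (T : ℕ) (w : ℕ → Fin M → ℝ) : EuclideanSpace ℝ (Fin (Fintype.card X)) :=
  ∑ t ∈ Finset.range T, ∑ m, w t m • coeffs π nu ((avg P)^[t] (g m))

theorem evolved_add {M T t : ℕ} (g : Fin M → X → ℝ) (w : ℕ → Fin M → ℝ) (β : Fin M → ℝ)
    (ht : t < T) : evolved P π nu g T (fun s m => w s m + if s = t then β m else 0) =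
      evolved P π nu g T w + ∑ m, β m • coeffs π nu ((avg P)^[t] (g m)) := by
  have : ∑ m, β m • coeffs π nu ((avg P)^[t] (g m)) = ∑ s ∈ Finset.range T,
      ∑ m, (if s = t then β m else 0) • coeffs π nu ((avg P)^[s] (g m)) := by
    rw [Finset.sum_eq_single_of_mem t (Finset.mem_range.2 ht)]
    · simp
    · intro s _ hs; simp [hs]
  rw [this, evolved, evolved, ← Finset.sum_add_distrib]
  refine Finset.sum_congr rfl fun s _ => ?_
  rw [← Finset.sum_add_distrib]
  exact Finset.sum_congr rfl fun m _ => add_smul _ _ _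

theorem sum_abs_add_le {M T t : ℕ} (w : ℕ → Fin M → ℝ) (β : Fin M → ℝ) (ht : t < T) :
    ∑ s ∈ Finset.range T, ∑ m, |w s m + if s = t then β m else 0| ≤
      (∑ s ∈ Finset.range T, ∑ m, |w s m|) + ∑ m, |β m| := by
  have : ∑ m, |β m| = ∑ s ∈ Finset.range T, ∑ m, |if s = t then β m else 0| := by
    rw [Finset.sum_eq_single_of_mem t (Finset.mem_range.2 ht)]
    · simp
    · intro s _ hs; simp [hs]
  rw [this, ← Finset.sum_add_distrib]
  refine Finset.sum_le_sum fun s _ => ?_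
  rw [← Finset.sum_add_distrib]
  exact Finset.sum_le_sum fun m _ => abs_add_le _ _

variable {p : Params} {M : ℕ} {i : ℕ → ℕ} {g : Fin M → X → ℝ}

/-- Induction on the number `b` of blocks already treated, starting from the last. On the treated
part the residual consists only of accumulated spill; on the rest merely its norm is controlled, by
`coeffBound b`. The same recursion bounds the total weight. -/
theorem exists_evolved_blocks (hp : p.Admissible) (hγ : p.ratio = p.γ)
    (hP : IsLazyReversibleChain P π) (hB : IsSpectralBasis P π lam nu)
    (hS : IsDiscreteSpectrum lam p.N p.k p.γ p.c i) (hG : IsUseful π nu p.k i g p.α)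
    {u : EuclideanSpace ℝ (Fin (Fintype.card X))} (hu : ‖u‖ ≤ 1) (hcut : cut (i p.k) u = 0)
    (b : ℕ) (hb : b ≤ p.blocks) :
    ∃ w : ℕ → Fin M → ℝ,
      ∑ t ∈ Finset.range (p.size + 1), ∑ m, |w t m| ≤ p.coeffBound b - 1 ∧
      ‖u - evolved P π nu g (p.size + 1) w‖ ≤ p.coeffBound b ∧
      ‖cut (i (p.blocks - b)) (u - evolved P π nu g (p.size + 1) w)‖ ≤
        b * (1 / (8 * p.blocks * p.invEps)) := by
  classical
  obtain ⟨-, hbk, hik, -, hlam⟩ := hS.normalized hP hB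
  induction b with
  | zero =>
    refine ⟨0, by simp [Params.coeffBound], ?_, ?_⟩
    · simpa [evolved, Params.coeffBound] using hu
    · simp [evolved, hik, hcut]
  | succ b ih =>
    obtain ⟨w, h1, h2, h3⟩ := ih (by omega)
    set B := p.coeffBound b with hBdef
    set r := u - evolved P π nu g (p.size + 1) w with hr
    set t := p.walkLength B with htdef
    have hB1 : 1 ≤ B := hp.one_le_coeffBound b
    have ht : t < p.size + 1 :=
      Nat.lt_succ_of_le ((hp.walkLength_le_lastLength (by omega)).trans hp.lastLength_le_size)
    obtain ⟨j, hj⟩ : ∃ j, p.blocks - b = j + 1 := ⟨p.blocks - b - 1, by omega⟩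
    have hj' : p.blocks - (b + 1) = j := by omega
    set H := p.ratio⁻¹ ^ p.lossLength B with hH
    have hg0 := hp.gamma_pos
    have hH0 : 0 ≤ H := pow_nonneg (zero_le_one.trans hp.one_le_inv_ratio) _
    -- `lam a ≥ γ ^ expo`, and `lossLength` is at least `expo * t`.
    have hloss : ∀ a : Fin (Fintype.card X), a.val + 1 ≤ i p.k → 1 ≤ H * lam a ^ t := by
      intro a ha
      have e1 : p.γ ^ p.lossLength B ≤ lam a ^ t := by
        calc p.γ ^ p.lossLength B = p.γ ^ (p.lossLength B : ℝ) := (Real.rpow_natCast _ _).symm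
          _ ≤ p.γ ^ (p.expo * t) := Real.rpow_le_rpow_of_exponent_ge hg0 hp.gamma_lt_one.le (by
            rw [mul_comm]; exact Nat.le_ceil _)
          _ = (p.γ ^ p.expo) ^ t := by rw [Real.rpow_mul hg0.le, Real.rpow_natCast]
          _ ≤ lam a ^ t := pow_le_pow_left₀ (by positivity) (hlam a ha) t
      calc (1 : ℝ) = H * p.γ ^ p.lossLength B := by
            rw [hH, hγ, ← mul_pow, inv_mul_cancel₀ hg0.ne', one_pow]
        _ ≤ _ := by gcongr
    obtain ⟨β, hβ1, hβ2, hβ3⟩ := exists_block_coeffs hP hB hS hG hp.alpha_nonneg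
      (j := j) (t := t) (by omega) hH0
      (fun a ha => (Real.rpow_pos_of_pos hg0 _).trans_le (hlam a ha)) hloss r h2
    set S := ∑ m, β m • coeffs π nu ((avg P)^[t] (g m)) with hSdef
    -- Evolved functions stay bounded by `1`, so total weight and residual grow by the same amount
    -- at most.
    have hSn : ‖S‖ ≤ ∑ m, |β m| := by
      refine (norm_sum_le _ _).trans (Finset.sum_le_sum fun m _ => ?_)
      rw [norm_smul, Real.norm_eq_abs]
      exact mul_le_of_le_one_right (abs_nonneg _)
        (norm_coeffs_le_one hB fun x => abs_avg_iterate_le (hG.bounded m) t x)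
    have hnext : B + p.N * p.α * H * B ≤ p.coeffBound (b + 1) := by
      show _ ≤ p.nextBound B
      rw [Params.nextBound, ← hH]
      have : 0 ≤ p.N * H * B := by positivity
      nlinarith
    have hr' : u - evolved P π nu g (p.size + 1) (fun s m => w s m + if s = t then β m else 0) =
        r - S := by
      rw [evolved_add g w β ht, hr]; abel
    refine ⟨fun s m => w s m + if s = t then β m else 0, ?_, ?_, ?_⟩
    · refine (sum_abs_add_le w β ht).trans ?_
      linarith
    · rw [hr']
      refine (norm_sub_le _ _).trans ?_
      linarith
    · rw [hr', hj']
      -- The new residual vanishes on the block `j`, so extending the range by this block adds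
      -- nothing.
      have e1 : ‖cut (i j) (r - S)‖ ≤ 1 * ‖cut (i (j + 1)) (r - S)‖ := by
        refine norm_le_of_abs_le zero_le_one fun l => ?_
        rw [cut_apply, cut_apply, one_mul]
        by_cases h4 : i j ≤ l.val
        · by_cases h5 : i (j + 1) ≤ l.val
          · rw [if_pos h4, if_pos h5]
          · have h6 := hβ2 l h4 (by omega)
            rw [if_pos h4, PiLp.sub_apply, h6, sub_self, abs_zero]
            exact abs_nonneg _
        · rw [if_neg h4, abs_zero]; exact abs_nonneg _
      have e2 := hp.spill_le hγ (zero_le_one.trans hB1)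
      rw [hj] at h3
      simp only [cut_sub] at e1
      have e3 := norm_sub_le (cut (i (j + 1)) r) (cut (i (j + 1)) S)
      rw [cut_sub]
      push_cast
      linarith

/-- Functions with small coefficients beyond the last block are close to a combination of evolved
functions. -/
theorem exists_evolved (hp : p.Admissible) (hγ : p.ratio = p.γ)
    (hP : IsLazyReversibleChain P π) (hB : IsSpectralBasis P π lam nu)
    (hS : IsDiscreteSpectrum lam p.N p.k p.γ p.c i) (hG : IsUseful π nu p.k i g p.α)
    {f : X → ℝ} (hf : ∀ x, |f x| ≤ 1) {lstar : ℕ} (hl : lstar ≤ i p.k)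
    (htail : ∑ l with lstar ≤ l.val, ip π f (nu l) ^ 2 ≤ p.ε ^ 2 / 4) :
    ∃ w : ℕ → Fin M → ℝ, ∑ t ∈ Finset.range (p.size + 1), ∑ m, |w t m| ≤ p.size ∧
      ‖coeffs π nu f - evolved P π nu g (p.size + 1) w‖ ≤ 5 / 8 * p.ε := by
  set v := coeffs π nu f with hv
  have hε := hp.eps_pos
  -- The part within the blocks is approximated up to `ε / 8`, and the discarded tail has norm at
  -- most `ε / 2`; together `5 / 8 * ε`.
  have h1 : ‖v - cut (i p.k) v‖ ≤ 1 := by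
    refine le_trans ?_ (norm_coeffs_le_one hB hf)
    rw [← one_mul ‖coeffs π nu f‖]
    refine norm_le_of_abs_le zero_le_one fun l => ?_
    rw [PiLp.sub_apply, cut_apply, one_mul]
    split_ifs
    · rw [sub_self, abs_zero]; exact abs_nonneg _
    · rw [sub_zero]
  have h2 : cut (i p.k) (v - cut (i p.k) v) = 0 := by
    ext l; simp only [cut_apply, PiLp.sub_apply, PiLp.zero_apply]; split_ifs <;> simp
  obtain ⟨w, hw1, -, hw3⟩ := exists_evolved_blocks hp hγ hP hB hS hG h1 h2 p.blocks le_rfl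
  have h3 : ‖cut (i p.k) v‖ ≤ p.ε / 2 := by
    rw [← sq_le_sq₀ (norm_nonneg _) (by linarith), EuclideanSpace.norm_sq_eq]
    refine le_trans ?_ (htail.trans_eq (by ring))
    rw [Finset.sum_filter]
    refine Finset.sum_le_sum fun l _ => ?_
    rw [cut_apply, Real.norm_eq_abs, sq_abs]
    split_ifs with h4 h5
    · exact le_rfl
    · omega
    · rw [zero_pow two_ne_zero]; positivity
    · simp
  refine ⟨w, ?_, ?_⟩
  · have := hp.coeffBound_le_size
    linarith
  · have e0 : ∀ a : EuclideanSpace ℝ (Fin (Fintype.card X)), cut 0 a = a := fun a => by ext l; simp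
    rw [Nat.sub_self, hS.start, e0] at hw3
    have e1 : (p.blocks : ℝ) * (1 / (8 * p.blocks * p.invEps)) = (1 / p.invEps) / 8 := by
      have := hp.one_le_blocks'
      have := hp.one_le_invEps
      field_simp
    rw [e1] at hw3
    have e2 := hp.inv_invEps_le
    have e3 : v - evolved P π nu g (p.size + 1) w =
        (v - cut (i p.k) v - evolved P π nu g (p.size + 1) w) + cut (i p.k) v := by abel
    rw [e3]
    refine (norm_add_le _ _).trans ?_
    linarith

end

section

/-! ## Weights that compete with a given function -/

theorem sum_range_mul_eq (f : ℕ → ℝ) (T M : ℕ) :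
    ∑ j ∈ Finset.range (T * M), f j =
      ∑ t ∈ Finset.range T, ∑ m ∈ Finset.range M, f (t * M + m) := by
  induction T with
  | zero => simp
  | succ T ih => rw [add_mul, one_mul, Finset.sum_range_add, ih, Finset.sum_range_succ]

variable {X : Type} [Fintype X] {O : Oracles X} {π : PMF X}
  {lam : Fin (Fintype.card X) → ℝ} {nu : Fin (Fintype.card X) → X → ℝ} {p : Params} {i : ℕ → ℕ}

theorem avg_sum {ι : Type*} (P : X → PMF X) (s : Finset ι) (c : ι → ℝ) (f : ι → X → ℝ) (t : ℕ) :
    (avg P)^[t] (fun y => ∑ m ∈ s, c m * f m y) =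
      fun x => ∑ m ∈ s, c m * (avg P)^[t] (f m) x := by
  induction t with
  | zero => rfl
  | succ t ih =>
    rw [Function.iterate_succ_apply', ih]
    funext x
    simp only [Function.iterate_succ_apply', avg, Finset.mul_sum]
    rw [Finset.sum_comm]
    exact Finset.sum_congr rfl fun _ _ => Finset.sum_congr rfl fun _ _ => by ring

theorem coeffs_sum {ι : Type*} (s : Finset ι) (f : ι → X → ℝ) :
    coeffs π nu (fun x => ∑ m ∈ s, f m x) = ∑ m ∈ s, coeffs π nu (f m) := by
  ext l
  simp only [coeffs_apply, WithLp.ofLp_sum, Finset.sum_apply]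
  exact ip_sum_left s f (nu l)

theorem coeffs_smul (c : ℝ) (f : X → ℝ) : coeffs π nu (fun x => c * f x) = c • coeffs π nu f := by
  ext l
  simp only [coeffs_apply, PiLp.smul_apply, smul_eq_mul]
  exact ip_smul_left c f (nu l)

/-- The weight vector with the entries `w t m` on the features that belong to walks. -/
def walkWeights (z M : ℕ) (w : ℕ → Fin M → ℝ) (j : ℕ) : ℝ :=
  if h : z ≤ j ∧ (j - z) % M < M ∧ j < z + M * (z + 1) then w ((j - z) / M) ⟨(j - z) % M, h.2.1⟩
  else 0

theorem walkWeights_add {z M t : ℕ} (w : ℕ → Fin M → ℝ) (ht : t < z + 1) (m : Fin M) :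
    walkWeights z M w (z + t * M + m) = w t m := by
  have hM : 0 < M := by have := m.2; omega
  have e1 : z + t * M + m - z = m + M * t := by rw [mul_comm M t]; omega
  have e2 : (m + M * t) % M = m := by rw [Nat.add_mul_mod_self_left, Nat.mod_eq_of_lt m.2]
  have e3 : (m + M * t) / M = t := by
    rw [Nat.add_mul_div_left _ _ hM, Nat.div_eq_of_lt m.2, zero_add]
  have h : z ≤ z + t * M + m ∧ (z + t * M + m - z) % M < M ∧
      z + t * M + m < z + M * (z + 1) := by
    refine ⟨by omega, Nat.mod_lt _ hM, ?_⟩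
    have := Nat.mul_le_mul_left M (Nat.succ_le_of_lt ht)
    rw [Nat.succ_eq_add_one, mul_add, mul_one, mul_comm M t] at this
    have := m.2
    omega
  rw [walkWeights, dif_pos h]
  congr 1
  · rw [e1, e3]
  · exact Fin.ext (by simp only [e1, e2])

theorem sum_abs_walkWeights (z M : ℕ) (w : ℕ → Fin M → ℝ) :
    ∑ j ∈ Finset.Ico z (z + M * (z + 1)), |walkWeights z M w j| =
      ∑ t ∈ Finset.range (z + 1), ∑ m, |w t m| := by
  rw [Finset.sum_Ico_eq_sum_range, Nat.add_sub_cancel_left, mul_comm, sum_range_mul_eq]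
  refine Finset.sum_congr rfl fun t ht => ?_
  rw [← Fin.sum_univ_eq_sum_range fun m => |walkWeights z M w (z + (t * M + m))|]
  refine Finset.sum_congr rfl fun m _ => ?_
  rw [← add_assoc, walkWeights_add w (Finset.mem_range.1 ht)]

omit [Fintype X] in
theorem gain_walkWeights {z t : ℕ} (w : ℕ → Fin O.M → ℝ) (ht : t < z + 1) (y : X) :
    O.gain z (walkWeights z O.M w) t y = ∑ m, w t m * O.g m y := by
  rw [Oracles.gain, ← Fin.sum_univ_eq_sum_range
    fun m => walkWeights z O.M w (z + t * O.M + m) * O.value m (some y)]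
  refine Finset.sum_congr rfl fun m _ => ?_
  rw [walkWeights_add w ht, Oracles.value, dif_pos m.2]

theorem coeffs_walkMean (z : ℕ) (w : ℕ → Fin O.M → ℝ) :
    coeffs π nu (O.walkMean z (walkWeights z O.M w)) = evolved O.next π nu O.g (z + 1) w := by
  have : O.walkMean z (walkWeights z O.M w) = fun x => ∑ t ∈ Finset.range (z + 1),
      ∑ m, w t m * (avg O.next)^[t] (O.g m) x := by
    funext x
    refine Finset.sum_congr rfl fun t ht => ?_
    rw [funext (gain_walkWeights w (Finset.mem_range.1 ht)), avg_sum]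
  rw [this, coeffs_sum, evolved]
  refine Finset.sum_congr rfl fun t _ => ?_
  rw [coeffs_sum]
  exact Finset.sum_congr rfl fun m _ => coeffs_smul _ _

open Classical in
/-- The mass of the points that were not memorized. -/
def missingMass (π : PMF X) (z : ℕ) (pts : ℕ → Option X) : ℝ :=
  ∑ x, (π x).toReal * if ∀ j < z, pts j ≠ some x then 1 else 0

theorem missingMass_nonneg (z : ℕ) (pts : ℕ → Option X) : 0 ≤ missingMass π z pts :=
  Finset.sum_nonneg fun _ _ => mul_nonneg ENNReal.toReal_nonneg (by split_ifs <;> norm_num)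

open Classical in
/-- The weights on the indicators of the memorized points that reproduce `f`. -/
def tableWeights (z : ℕ) (pts : ℕ → Option X) (f : X → ℝ) (j : ℕ) : ℝ :=
  match pts j with
  | none => 0
  | some y => if j < z ∧ ∀ j' < j, pts j' ≠ some y then f y else 0

omit [Fintype X] in
theorem abs_tableWeights_le (z : ℕ) (pts : ℕ → Option X) {f : X → ℝ} (hf : ∀ x, |f x| ≤ 1)
    (j : ℕ) : |tableWeights z pts f j| ≤ 1 := by
  unfold tableWeights
  split
  · simp
  · split_ifs
    · exact hf _
    · simp

omit [Fintype X] in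
theorem tableWeights_of_le {z j : ℕ} (pts : ℕ → Option X) (f : X → ℝ) (hj : z ≤ j) :
    tableWeights z pts f j = 0 := by
  unfold tableWeights
  split
  · rfl
  · rw [if_neg (by omega)]

-- Only the first occurrence of a point carries weight, so points drawn repeatedly are not counted
-- twice. At points that were not memorized the prediction is `0`.
omit [Fintype X] in
open Classical in
theorem abs_inner_tableWeights_sub_le {z d : ℕ} (hd : z ≤ d) (pts : ℕ → Option X) {f : X → ℝ}
    (hf : ∀ x, |f x| ≤ 1) (x : X) :
    |inner d (tableWeights z pts f) (indicators pts x) - f x| ≤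
      if ∀ j < z, pts j ≠ some x then 1 else 0 := by
  have h1 : ∀ j, tableWeights z pts f j * indicators pts x j =
      if pts j = some x ∧ j < z ∧ ∀ j' < j, pts j' ≠ some x then f x else 0 := by
    intro j
    unfold tableWeights indicators
    by_cases h : pts j = some x
    · rw [h]; simp
    · simp [h]
  rw [inner, Finset.sum_congr rfl fun j _ => h1 j]
  split_ifs with h
  · rw [Finset.sum_eq_zero fun j _ => if_neg fun h' => h j h'.2.1 h'.1, zero_sub, abs_neg]
    exact hf x
  · push Not at h
    have hex : ∃ j, j < z ∧ pts j = some x := h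
    have h0 := Nat.find_spec hex
    rw [Finset.sum_eq_single_of_mem (Nat.find hex) (Finset.mem_range.2 (h0.1.trans_le hd)),
      if_pos ⟨h0.2, h0.1, fun j' hj' e => Nat.find_min hex hj' ⟨hj'.trans h0.1, e⟩⟩, sub_self,
      abs_zero]
    intro j _ hj
    refine if_neg fun h' => ?_
    rcases lt_trichotomy j (Nat.find hex) with hlt | heq | hgt
    · exact Nat.find_min hex hlt ⟨h'.2.1, h'.1⟩
    · exact hj heq
    · exact h'.2.2 _ hgt h0.2

open Classical in
/-- The part of the error of the competitors that depends on the memorized points. -/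
def slack (p : Params) (π : PMF X) (pts : ℕ → Option X) : ℝ :=
  if p.γ < 1 / 4 then missingMass π p.size pts else 0

theorem slack_nonneg (pts : ℕ → Option X) : 0 ≤ slack p π pts := by
  unfold slack; split_ifs
  · exact missingMass_nonneg _ _
  · exact le_rfl

namespace Params.Admissible

variable (hp : p.Admissible)
include hp

theorem one_le_size : 1 ≤ p.size := by
  have := (hp.one_le_coeffBound p.blocks).trans hp.coeffBound_le_size
  exact_mod_cast this

end Params.Admissible

/-- For `γ < 1/4` the competitor is a lookup table on the indicators, with error at most the mass
that was missed. Otherwise it lives on the walk features alone, and the indicators get weight `0`.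
-/
theorem exists_weights (hp : p.Admissible) (hM : O.M = p.M) (hP : IsLazyReversibleChain O.next π)
    (hB : IsSpectralBasis O.next π lam nu) (hS : IsDiscreteSpectrum lam p.N p.k p.γ p.c i)
    (hG : IsUseful π nu p.k i O.g p.α) {f : X → ℝ} (hf : ∀ x, |f x| ≤ 1) {lstar : ℕ}
    (hl : lstar ≤ i p.k) (htail : ∑ l with lstar ≤ l.val, ip π f (nu l) ^ 2 ≤ p.ε ^ 2 / 4)
    {pts : ℕ → Option X} (hpts : ∀ j, p.size ≤ j → pts j = none) :
    ∃ w : ℕ → ℝ, (∀ j, |w j| ≤ p.size) ∧ ∑ j ∈ Finset.Ico p.size p.dim, |w j| ≤ p.size ∧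
      ∑ x, (π x).toReal * |inner p.dim w (indicators pts x) + O.walkMean p.size w x - f x| ≤
        5 / 8 * p.ε + slack p π pts := by
  have hdim : p.dim = p.size + O.M * (p.size + 1) := by rw [hM]; rfl
  by_cases hγ : p.γ < 1 / 4
  · refine ⟨tableWeights p.size pts f, fun j => ?_, ?_, ?_⟩
    · refine (abs_tableWeights_le _ _ hf j).trans ?_
      exact_mod_cast hp.one_le_size
    · rw [Finset.sum_eq_zero]
      · positivity
      · intro j hj
        rw [tableWeights_of_le _ _ (Finset.mem_Ico.1 hj).1, abs_zero]
    · have hw : ∀ x, O.walkMean p.size (tableWeights p.size pts f) x = 0 := by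
        intro x
        refine Finset.sum_eq_zero fun t _ => ?_
        have : O.gain p.size (tableWeights p.size pts f) t =
            fun y => ∑ m ∈ (∅ : Finset ℕ), (0 : ℝ) * (fun _ : X => (0 : ℝ)) y := by
          funext y
          rw [Finset.sum_empty]
          refine Finset.sum_eq_zero fun m _ => ?_
          rw [tableWeights_of_le _ _ (by omega), zero_mul]
        rw [this, avg_sum]; simp
      simp only [hw, add_zero]
      rw [slack, if_pos hγ, missingMass]
      have := hp.eps_pos
      refine le_add_of_nonneg_of_le (by positivity) (Finset.sum_le_sum fun x _ => ?_)
      exact mul_le_mul_of_nonneg_left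
        (abs_inner_tableWeights_sub_le (by rw [hdim]; omega) pts hf x) ENNReal.toReal_nonneg
  · have hr : p.ratio = p.γ := by rw [Params.ratio, if_neg hγ]
    obtain ⟨w, h1, h2⟩ := exists_evolved hp hr hP hB hS hG hf hl htail
    have hsum : ∑ j ∈ Finset.Ico p.size p.dim, |walkWeights p.size O.M w j| ≤ p.size := by
      rw [hdim, sum_abs_walkWeights]; exact h1
    refine ⟨walkWeights p.size O.M w, fun j => ?_, hsum, ?_⟩
    · by_cases hj : j ∈ Finset.Ico p.size p.dim
      · exact (Finset.single_le_sum (f := fun j => |walkWeights p.size O.M w j|)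
          (fun _ _ => abs_nonneg _) hj).trans hsum
      · rw [walkWeights, dif_neg, abs_zero]
        · positivity
        · rw [← hdim]; intro h; exact hj (Finset.mem_Ico.2 ⟨h.1, h.2.2⟩)
    · have hin : ∀ x, inner p.dim (walkWeights p.size O.M w) (indicators pts x) = 0 := by
        intro x
        refine Finset.sum_eq_zero fun j _ => ?_
        by_cases hj : p.size ≤ j
        · simp [indicators, hpts j hj]
        · rw [walkWeights, dif_neg (fun h => hj h.1), zero_mul]
      simp only [hin, zero_add]
      rw [slack, if_neg hγ, add_zero]
      simp only [abs_sub_comm _ (f _)]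
      exact (sum_abs_sub_le hB f _).trans (by rw [coeffs_walkMean]; exact h2)

/-! ## The number of memorized points -/

theorem sum_map_eq {Ω Ω' : Type} [Fintype Ω] [Fintype Ω'] (q : PMF Ω) (f : Ω → Ω') (φ : Ω' → ℝ) :
    ∑ ω, (q ω).toReal * φ (f ω) = ∑ y, ((q.map f) y).toReal * φ y := by
  classical
  have h : ∀ y, ((q.map f) y).toReal = ∑ ω, if y = f ω then (q ω).toReal else 0 := by
    intro y
    rw [PMF.map_apply, tsum_fintype, ENNReal.toReal_sum]
    · refine Finset.sum_congr rfl fun ω _ => ?_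
      split_ifs <;> simp_all
    · intro ω _; split_ifs
      · exact q.apply_ne_top ω
      · simp
  simp only [h, Finset.sum_mul]
  rw [Finset.sum_comm]
  refine Finset.sum_congr rfl fun ω _ => ?_
  simp only [ite_mul, zero_mul, Finset.sum_ite_eq', Finset.mem_univ, if_true]

omit [Fintype X] in
theorem labelledLaw_map_fst (π : PMF X) (L : X → PMF ℤˣ) : (labelledLaw π L).map Prod.fst = π := by
  rw [labelledLaw, PMF.map_bind]
  simp only [PMF.map_comp]
  have : ∀ x, PMF.map (Prod.fst ∘ fun y : ℤˣ => (x, y)) (L x) = PMF.pure x := by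
    intro x
    exact PMF.map_const (L x) x
  simp only [this, PMF.bind_pure]

theorem memorizeModel_all (z : ℕ) : (O.memorizeModel z).All fun pts => ∀ j, z ≤ j → pts j = none := by
  refine Rnd.iter_all (Q := fun n (pts : ℕ → Option X) => ∀ j, n ≤ j → pts j = none)
    (fun n pts h => ?_) (fun _ _ => rfl) z
  intro e j hj
  rw [Function.update_of_ne (by omega), h j (by omega)]

open Classical in
theorem memorizeModel_miss (hD : O.labelled.map Prod.fst = π) (z : ℕ) (x : X) :
    ((O.memorizeModel z).E fun pts => if ∀ j < z, pts j ≠ some x then 1 else 0) =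
      (1 - (π x).toReal) ^ z := by
  induction z with
  | zero => simp [Oracles.memorizeModel]
  | succ n ih =>
    rw [Oracles.memorizeModel, Rnd.iter_succ, Rnd.E_bind, pow_succ', ← ih, ← Rnd.E_mul_left]
    congr 1; funext pts
    rw [Rnd.E_samp]
    have h1 : ∀ e : X × ℤˣ, (Rnd.ret (Function.update pts n (some e.1))).E
        (fun pts => if ∀ j < n + 1, pts j ≠ some x then (1 : ℝ) else 0) =
        (1 - if e.1 = x then 1 else 0) * if ∀ j < n, pts j ≠ some x then 1 else 0 := by
      intro e
      rw [Rnd.E_ret]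
      have : (∀ j < n + 1, Function.update pts n (some e.1) j ≠ some x) ↔
          e.1 ≠ x ∧ ∀ j < n, pts j ≠ some x := by
        constructor
        · intro h
          refine ⟨fun h' => h n (by omega) (by simp [h']), fun j hj => ?_⟩
          have := h j (by omega)
          rwa [Function.update_of_ne (by omega)] at this
        · rintro ⟨h, h'⟩ j hj
          rcases Nat.lt_succ_iff_lt_or_eq.1 hj with hlt | rfl
          · rw [Function.update_of_ne (by omega)]; exact h' j hlt
          · simpa using h
      simp only [this]
      by_cases hx : e.1 = x <;> simp [hx]
    simp only [h1, ← mul_assoc]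
    rw [← Finset.sum_mul]
    congr 1
    rw [sum_map_eq O.labelled Prod.fst fun y => 1 - if y = x then (1 : ℝ) else 0, hD]
    simp only [mul_sub, mul_one, Finset.sum_sub_distrib, Rnd.sum_toReal]
    simp

/-- `(1 - q)^z (1 + q)^z ≤ 1`, combined with Bernoulli's inequality for `(1 + q)^z`. -/
theorem mul_one_sub_pow_le {q : ℝ} (h0 : 0 ≤ q) (h1 : q ≤ 1) {z : ℕ} (hz : 0 < z) :
    q * (1 - q) ^ z ≤ 1 / z := by
  have hz' : (0 : ℝ) < z := by exact_mod_cast hz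
  have h2 := one_add_mul_le_pow (show -2 ≤ q by linarith) z
  have h3 : (1 - q) ^ z * (1 + q) ^ z ≤ 1 := by
    rw [← mul_pow]; exact pow_le_one₀ (by nlinarith) (by nlinarith)
  have h4 : 0 ≤ (1 - q) ^ z := pow_nonneg (by linarith) z
  rw [le_div_iff₀ hz']
  nlinarith

/-- A state `x` is missed by `z` independent examples with probability `(1 - π x)^z`, so each state
contributes at most `1 / z`. -/
theorem E_missingMass_le (hD : O.labelled.map Prod.fst = π) {z : ℕ} (hz : 0 < z) :
    (O.memorizeModel z).E (missingMass π z) ≤ Fintype.card X / z := by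
  have : (O.memorizeModel z).E (missingMass π z) =
      ∑ x, (π x).toReal * (1 - (π x).toReal) ^ z := by
    classical
    unfold missingMass
    rw [Rnd.E_sum]
    refine Finset.sum_congr rfl fun x _ => ?_
    rw [Rnd.E_mul_left, ← memorizeModel_miss hD]
  rw [this]
  calc _ ≤ ∑ _x : X, (1 : ℝ) / z := Finset.sum_le_sum fun x _ =>
        mul_one_sub_pow_le ENNReal.toReal_nonneg
          (ENNReal.toReal_mono ENNReal.one_ne_top (π.coe_le_one x)) hz
    _ = _ := by simp [div_eq_mul_inv]

end

section

/-! ## Accuracy of the learner -/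

variable {X : Type} [Fintype X] {O : Oracles X} {π : PMF X}
  {lam : Fin (Fintype.card X) → ℝ} {nu : Fin (Fintype.card X) → X → ℝ} {p : Params} {i : ℕ → ℕ}

/-- The law of the features and the label of a random example. -/
def Oracles.sample (O : Oracles X) (z q : ℕ) (pts : ℕ → Option X) : Rnd ((ℕ → ℝ) × ℤˣ) :=
  .samp inferInstance O.labelled fun e => (O.featModel z q pts e.1).map fun V => (V, e.2)

theorem E_sample (z q : ℕ) (pts : ℕ → Option X) (φ : (ℕ → ℝ) × ℤˣ → ℝ) :
    (O.sample z q pts).E φ =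
      ∑ e, (O.labelled e).toReal * (O.featModel z q pts e.1).E fun V => φ (V, e.2) := by
  rw [Oracles.sample, Rnd.E_samp]
  exact Finset.sum_congr rfl fun e _ => by rw [Rnd.E_map]

theorem sample_all (hg : ∀ m x, |O.g m x| ≤ 1) {z q : ℕ} (hq : 0 < q) {pts : ℕ → Option X}
    (hp : ∀ j, z ≤ j → pts j = none) : (O.sample z q pts).All fun v => ∀ j, |v.1 j| ≤ 1 := by
  intro e
  show Rnd.All (Rnd.map _ _) _
  rw [Rnd.map, Rnd.All_bind]
  exact featModel_all hg hq hp e.1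

theorem descentStep_eq (z d q : ℕ) (η : ℝ) (pts : ℕ → Option X) (a : (ℕ → ℝ) × (ℕ → ℝ)) :
    O.descentStep z d q η pts a = (O.sample z q pts).map (descentUpdate z d η a) := by
  simp only [Oracles.descentStep, Oracles.sample, Rnd.map, Rnd.bind, Rnd.bind_assoc]
  rfl

theorem risk_eq (D : PMF (X × ℤˣ)) (f : X → ℤˣ) :
    2 * risk D f = ∑ e, (D e).toReal * |(((f e.1 : ℤˣ) : ℤ) : ℝ) - ((e.2 : ℤ) : ℝ)| := by
  classical
  have h1 : D = (Rnd.samp inferInstance D Rnd.ret).toPMF := by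
    show D = D.bind PMF.pure
    rw [PMF.bind_pure]
  have h2 := Rnd.prob_toPMF_eq (Rnd.samp inferInstance D Rnd.ret) {z : X × ℤˣ | f z.1 ≠ z.2}
  rw [← h1, Rnd.E_samp] at h2
  rw [risk, h2, Finset.mul_sum]
  refine Finset.sum_congr rfl fun e _ => ?_
  rw [Rnd.E_ret, mul_left_comm]
  congr 1
  simp only [Set.mem_ofPred_eq]
  rcases Int.units_eq_one_or (f e.1) with h | h <;> rcases Int.units_eq_one_or e.2 with h' | h' <;>
    simp [h, h'] <;> norm_num

/-- `rounding_error_le` is applied for fixed features; the average weights `a.2 / q` enter by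
linearity of the prediction. -/
theorem hypothesisRisk_le (z d : ℕ) {q : ℕ} (hq : 0 < q) (a : (ℕ → Option X) × (ℕ → ℝ)) :
    O.hypothesisRisk z d q a ≤
      absLoss (O.sample z q a.1) d 1 (fun j => a.2 j / q) / 2 + (1 / 2) ^ z := by
  have h : ∀ e : X × ℤˣ, ((O.evalModel z d q a.1 a.2 e.1).E fun y => if y ≠ e.2 then (1 : ℝ) else 0)
      ≤ ((O.featModel z q a.1 e.1).E fun V =>
        |inner d (fun j => a.2 j / q) V - 1 * ((e.2 : ℤ) : ℝ)|) / 2 + (1 / 2) ^ z := by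
    intro e
    rw [Oracles.evalModel, Rnd.E_bind]
    rw [div_eq_inv_mul, ← Rnd.E_mul_left, ← Rnd.E_const (O.featModel z q a.1 e.1) ((1 / 2 : ℝ) ^ z),
      ← Rnd.E_add]
    refine Rnd.E_mono _ fun V => ?_
    rw [Rnd.E_map]
    refine (rounding_error_le z hq (inner d a.2 V) e.2).trans (le_of_eq ?_)
    have e1 : (fun j => a.2 j / (q : ℝ)) = fun j => (q : ℝ)⁻¹ * a.2 j := by
      funext j; rw [div_eq_inv_mul]
    rw [e1, inner_smul, one_mul, div_eq_inv_mul _ (q : ℝ), div_eq_inv_mul _ (2 : ℝ)]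
  rw [Oracles.hypothesisRisk, absLoss, E_sample]
  calc _ ≤ ∑ e, (O.labelled e).toReal * (((O.featModel z q a.1 e.1).E fun V =>
        |inner d (fun j => a.2 j / q) V - 1 * ((e.2 : ℤ) : ℝ)|) / 2 + (1 / 2) ^ z) :=
        Finset.sum_le_sum fun e _ => mul_le_mul_of_nonneg_left (h e) ENNReal.toReal_nonneg
    _ = _ := by
      simp only [mul_add, Finset.sum_add_distrib, ← Finset.sum_mul, Rnd.sum_toReal, one_mul,
        ← mul_div_assoc, ← Finset.sum_div]

theorem Params.size_le_dim (p : Params) : p.size ≤ p.dim := Nat.le_add_right _ _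

theorem Params.le_root (p : Params) : 64 * p.dim * p.size * p.invEps / p.δ ≤ p.root :=
  Nat.le_ceil _

namespace Params.Admissible

variable (hp : p.Admissible)
include hp

theorem root_pos : 0 < p.root := by
  have h1 := hp.one_le_size
  have h2 : 1 ≤ p.dim := h1.trans p.size_le_dim
  have h3 := hp.one_le_invEps
  have h4 := hp.delta_pos
  refine Nat.ceil_pos.2 ?_
  have : (1 : ℝ) ≤ p.size := by exact_mod_cast h1
  have : (1 : ℝ) ≤ p.dim := by exact_mod_cast h2
  positivity

theorem rounds_pos : 0 < p.rounds := Nat.mul_pos hp.root_pos hp.root_pos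

theorem rate_pos : 0 < p.rate := by
  have h1 : (0 : ℝ) < p.size := by exact_mod_cast hp.one_le_size
  have h2 : (0 : ℝ) < p.root := by exact_mod_cast hp.root_pos
  exact div_pos h1 h2

theorem dim_mul_size_div_root_le : p.dim * p.size / p.root ≤ p.δ * p.ε / 64 := by
  have h2 : (0 : ℝ) < p.root := by exact_mod_cast hp.root_pos
  have h3 := p.le_root
  have h4 := hp.delta_pos
  have h5 := hp.one_le_invEps
  have h6 := hp.inv_invEps_le
  rw [div_le_iff₀ h2]
  rw [div_le_iff₀ h4] at h3
  rw [div_le_iff₀ (by linarith)] at h6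
  have h7 : (0 : ℝ) ≤ p.dim * p.size := by positivity
  have h8 := hp.eps_pos
  calc (p.dim * p.size : ℝ) ≤ p.dim * p.size * (p.ε * p.invEps) := le_mul_of_one_le_right h7 h6
    _ = p.ε / 64 * (64 * p.dim * p.size * p.invEps) := by ring
    _ ≤ p.ε / 64 * (p.root * p.δ) := by gcongr
    _ = _ := by ring

theorem size_div_root_le : (p.size : ℝ) / p.root ≤ p.ε / 64 := by
  have h1 := hp.dim_mul_size_div_root_le
  have h2 : (1 : ℝ) ≤ p.dim := by exact_mod_cast hp.one_le_size.trans p.size_le_dim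
  have h4 : p.δ * p.ε ≤ p.ε := mul_le_of_le_one_left hp.eps_pos.le hp.delta_lt_one.le
  have h3 : (p.size : ℝ) / p.root ≤ p.dim * p.size / p.root := by
    gcongr
    exact le_mul_of_one_le_left (by positivity) h2
  linarith

theorem four_mul_N_div_size_le : 4 * p.N / p.size ≤ p.δ * p.ε / 8 := by
  have h2 : (0 : ℝ) < p.size := by exact_mod_cast hp.one_le_size
  have h3 := hp.le_size
  have h4 := hp.delta_pos
  have h5 := hp.one_le_invEps
  have h6 := hp.inv_invEps_le
  have h8 := hp.eps_pos
  rw [div_le_iff₀ h2]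
  rw [div_le_iff₀ h4] at h3
  rw [div_le_iff₀ (by linarith)] at h6
  calc (4 * p.N : ℝ) ≤ 4 * p.N * (p.ε * p.invEps) := le_mul_of_one_le_right (by positivity) h6
    _ = p.ε / 8 * (32 * p.N * p.invEps) := by ring
    _ ≤ p.ε / 8 * (p.size * p.δ) := by gcongr
    _ = _ := by ring

theorem half_pow_size_le : (1 / 2 : ℝ) ^ p.size ≤ p.ε / 32 := by
  have h2 : (0 : ℝ) < p.size := by exact_mod_cast hp.one_le_size
  have h1 := hp.four_mul_N_div_size_le
  have h3 : (1 / 2 : ℝ) ^ p.size ≤ 1 / p.size := by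
    rw [one_div_pow]
    exact one_div_le_one_div_of_le h2 (by exact_mod_cast Nat.lt_two_pow_self.le)
  have h4 : (1 : ℝ) / p.size ≤ p.N / p.size := by gcongr; exact hp.one_le_N'
  have h5 : p.δ * p.ε ≤ p.ε := mul_le_of_le_one_left hp.eps_pos.le hp.delta_lt_one.le
  rw [mul_div_assoc] at h1
  linarith

end Params.Admissible

/-- The loss of good weights is at most the loss of the function that they approximate, up to the
approximation error and the noise of the features. -/
theorem absLoss_le_risk (hD : O.labelled.map Prod.fst = π) (hg : ∀ m x, |O.g m x| ≤ 1)
    {z r d : ℕ} (hd : d = z + O.M * (z + 1)) (hz : 0 < z) (hr : 0 < r) {w : ℕ → ℝ}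
    (hW : ∑ j ∈ Finset.Ico z d, |w j| ≤ z) (pts : ℕ → Option X) (f : X → ℤˣ) {κ : ℝ}
    (hκ : ∑ x, (π x).toReal * |inner d w (indicators pts x) + O.walkMean z w x - ((f x : ℤ) : ℝ)|
      ≤ κ) :
    absLoss (O.sample z (r * r) pts) d 1 w ≤ 2 * risk O.labelled f + κ + z / r := by
  have hz' : (0 : ℝ) < z := by exact_mod_cast hz
  rw [absLoss, E_sample, risk_eq]
  have h : ∀ e : X × ℤˣ, ((O.featModel z (r * r) pts e.1).E fun V =>
      |inner d w V - 1 * ((e.2 : ℤ) : ℝ)|) ≤ |((f e.1 : ℤ) : ℝ) - ((e.2 : ℤ) : ℝ)| +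
        |inner d w (indicators pts e.1) + O.walkMean z w e.1 - ((f e.1 : ℤ) : ℝ)| + z / r := by
    intro e
    refine le_trans ?_ (add_le_add_right (feat_noise hg hd hr hz' hW pts e.1) _)
    rw [← Rnd.E_const (O.featModel z (r * r) pts e.1) (|((f e.1 : ℤ) : ℝ) - ((e.2 : ℤ) : ℝ)| +
        |inner d w (indicators pts e.1) + O.walkMean z w e.1 - ((f e.1 : ℤ) : ℝ)|), ← Rnd.E_add]
    refine Rnd.E_mono _ fun V => ?_
    -- Disagreement of `f` with the label, error of the approximation to `f`, and noise of the
    -- features.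
    have e1 : inner d w V - 1 * ((e.2 : ℤ) : ℝ) = (((f e.1 : ℤ) : ℝ) - ((e.2 : ℤ) : ℝ)) +
        (inner d w (indicators pts e.1) + O.walkMean z w e.1 - ((f e.1 : ℤ) : ℝ)) +
        (inner d w V - (inner d w (indicators pts e.1) + O.walkMean z w e.1)) := by ring
    rw [e1]
    exact (abs_add_le _ _).trans (add_le_add_left (abs_add_le _ _) _)
  calc _ ≤ ∑ e, (O.labelled e).toReal * (|((f e.1 : ℤ) : ℝ) - ((e.2 : ℤ) : ℝ)| +
        |inner d w (indicators pts e.1) + O.walkMean z w e.1 - ((f e.1 : ℤ) : ℝ)| + z / r) :=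
        Finset.sum_le_sum fun e _ => mul_le_mul_of_nonneg_left (h e) ENNReal.toReal_nonneg
    _ ≤ _ := by
      simp only [mul_add, Finset.sum_add_distrib, ← Finset.sum_mul, Rnd.sum_toReal, one_mul]
      rw [sum_map_eq O.labelled Prod.fst fun x =>
        |inner d w (indicators pts x) + O.walkMean z w x - ((f x : ℤ) : ℝ)|, hD]
      linarith

-- Markov's inequality for the nonnegative quantity `Z`, which consists of the excess loss of the
-- average iterate and the slack. If `Z ≤ ε / 2`, the hypothesis competes with all of `F` at once,
-- because the infimum over the box already does.
open Classical in
theorem trainModel_accurate (hp : p.Admissible) (hM : O.M = p.M)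
    (hD : O.labelled.map Prod.fst = π) (hP : IsLazyReversibleChain O.next π)
    (hB : IsSpectralBasis O.next π lam nu) (hS : IsDiscreteSpectrum lam p.N p.k p.γ p.c i)
    (hG : IsUseful π nu p.k i O.g p.α) {F : Set (X → ℤˣ)} {lstar : ℕ} (hl : lstar ≤ i p.k)
    (htail : ∀ f ∈ F, ∑ l with lstar ≤ l.val, ip π (fun x => ((f x : ℤ) : ℝ)) (nu l) ^ 2
      ≤ p.ε ^ 2 / 4) :
    1 - p.δ ≤ (O.trainModel p.size p.dim p.rounds p.rate).E fun a =>
      if ∀ f ∈ F, O.hypothesisRisk p.size p.dim p.rounds a ≤ risk O.labelled f + p.ε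
      then 1 else 0 := by
  have hε := hp.eps_pos
  have hδ := hp.delta_pos
  have hdim : p.dim = p.size + O.M * (p.size + 1) := by rw [hM]; rfl
  have hq := hp.rounds_pos
  set S := O.sample p.size p.rounds with hSdef
  let Z : (ℕ → Option X) → (ℕ → ℝ) → ℝ := fun pts A =>
    absLoss (S pts) p.dim 1 (fun j => A j / p.rounds) - boxLoss (S pts) p.dim p.size +
      slack p π pts
  have hgood : ∀ pts : ℕ → Option X, (∀ j, p.size ≤ j → pts j = none) → ∀ A, Z pts A ≤ p.ε / 2 →
      ∀ f ∈ F, O.hypothesisRisk p.size p.dim p.rounds (pts, A) ≤ risk O.labelled f + p.ε := by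
    intro pts hpts A hZ f hf
    obtain ⟨w, hw1, hw2, hw3⟩ := exists_weights hp hM hP hB hS hG
      (f := fun x => ((f x : ℤ) : ℝ)) (fun x => by
        rcases Int.units_eq_one_or (f x) with h | h <;> rw [h] <;> simp) hl (htail f hf) hpts
    have h1 := boxLoss_le (S pts) (d := p.dim) hw1
    have h2 : absLoss (S pts) p.dim 1 w ≤ _ :=
      absLoss_le_risk hD hG.bounded hdim hp.one_le_size hp.root_pos hw2 pts f hw3
    have h3 := hypothesisRisk_le (O := O) p.size p.dim hq (pts, A)
    have h4 := hp.size_div_root_le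
    have h5 := hp.half_pow_size_le
    simp only [Z] at hZ
    simp only [← hSdef] at h3
    -- The slack in `Z` cancels that of the competitor. The error left is half of `ε/2 + 5ε/8 +
    -- ε/64`, plus `ε/32` for the discretized threshold, which is less than `ε`.
    linarith
  rw [Oracles.trainModel, Rnd.E_bind]
  simp only [Rnd.E_map]
  have hexcess : ∀ pts : ℕ → Option X, (∀ j, p.size ≤ j → pts j = none) →
      (1 - (2 / p.ε) * (p.dim * p.size / p.root)) - (2 / p.ε) * slack p π pts ≤
      (O.descentModel p.size p.dim p.rounds p.rate pts).E fun a =>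
        if ∀ f ∈ F, O.hypothesisRisk p.size p.dim p.rounds (pts, a.2) ≤ risk O.labelled f + p.ε
        then 1 else 0 := by
    intro pts hpts
    have hmodel : O.descentModel p.size p.dim p.rounds p.rate pts =
        Rnd.iter (fun _ a => (S pts).map (descentUpdate p.size p.dim p.rate a)) p.rounds
          (fun _ => 0, fun _ => 0) := by
      rw [Oracles.descentModel, funext (descentStep_eq p.size p.dim p.rounds p.rate pts)]
    have hex := descent_excess (d := p.dim) (z := p.size) hp.rate_pos hq
      (sample_all hG.bounded hq hpts)
    have hall := descent_all (S := S pts) (z := p.size) (d := p.dim) (η := p.rate) p.rounds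
    simp only [← hSdef] at hex
    rw [← hmodel] at hex hall
    have hZ0 : (O.descentModel p.size p.dim p.rounds p.rate pts).All fun a => 0 ≤ Z pts a.2 := by
      refine hall.mono fun a ha => ?_
      have hq' : (0 : ℝ) < p.rounds := by exact_mod_cast hq
      have := boxLoss_le (S pts) (d := p.dim) (z := p.size) (w := fun j => a.2 j / p.rounds)
        (fun j => by
          rw [abs_div, abs_of_pos hq', div_le_iff₀ hq', mul_comm]; exact ha.2 j)
      have := slack_nonneg (p := p) (π := π) pts
      simp only [Z]; linarith
    -- The step size balances the two terms of the regret bound.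
    have hrate : p.dim * (p.size : ℝ) ^ 2 / (2 * p.rate * p.rounds) + p.rate * p.dim / 2 =
        p.dim * p.size / p.root := by
      have h1 : (0 : ℝ) < p.size := by exact_mod_cast hp.one_le_size
      have h2 : (0 : ℝ) < p.root := by exact_mod_cast hp.root_pos
      rw [Params.rate, Params.rounds]
      push_cast
      field_simp
      ring
    rw [hrate] at hex
    have hEZ : (O.descentModel p.size p.dim p.rounds p.rate pts).E (fun a => Z pts a.2) ≤
        p.dim * p.size / p.root + slack p π pts := by
      simp only [Z]
      rw [Rnd.E_add, Rnd.E_sub, Rnd.E_const, Rnd.E_const]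
      linarith
    have hmark : (O.descentModel p.size p.dim p.rounds p.rate pts).E
        (fun a => 1 - (2 / p.ε) * Z pts a.2) ≤
        (O.descentModel p.size p.dim p.rounds p.rate pts).E fun a =>
        if ∀ f ∈ F, O.hypothesisRisk p.size p.dim p.rounds (pts, a.2) ≤ risk O.labelled f + p.ε
        then 1 else 0 := by
      refine Rnd.E_mono_of_All (hZ0.mono fun a ha => ?_)
      split_ifs with h
      · have : 0 ≤ (2 / p.ε) * Z pts a.2 := by positivity
        linarith
      · have h1 : p.ε / 2 < Z pts a.2 := by
          by_contra h2
          exact h (hgood pts hpts a.2 (not_lt.1 h2))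
        have : (2 / p.ε) * (p.ε / 2) = 1 := by field_simp
        have : (2 / p.ε) * (p.ε / 2) ≤ (2 / p.ε) * Z pts a.2 := by gcongr
        linarith
    refine le_trans ?_ hmark
    rw [Rnd.E_sub, Rnd.E_const, Rnd.E_mul_left]
    have : (2 / p.ε) * _ ≤ (2 / p.ε) * _ := mul_le_mul_of_nonneg_left hEZ (by positivity)
    rw [mul_add] at this
    linarith
  refine le_trans ?_ (Rnd.E_mono_of_All ((memorizeModel_all p.size).mono hexcess))
  rw [Rnd.E_sub, Rnd.E_const, Rnd.E_mul_left]
  have hslack : (O.memorizeModel p.size).E (slack p π) ≤ p.δ * p.ε / 8 := by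
    by_cases hγ : p.γ < 1 / 4
    · have : slack p π = missingMass π p.size := by funext pts; rw [slack, if_pos hγ]
      rw [this]
      refine (E_missingMass_le hD hp.one_le_size).trans (le_trans ?_ hp.four_mul_N_div_size_le)
      have := card_le_of_small_ratio hP hB hS hγ
      gcongr
      exact_mod_cast this
    · have : slack p π = fun _ => 0 := by funext pts; rw [slack, if_neg hγ]
      rw [this, Rnd.E_const]; positivity
  have h1 := hp.dim_mul_size_div_root_le
  have h2 : (2 / p.ε) * (p.dim * p.size / p.root) ≤ (2 / p.ε) * (p.δ * p.ε / 64) := by gcongr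
  have h3 : (2 / p.ε) * (O.memorizeModel p.size).E (slack p π) ≤ (2 / p.ε) * (p.δ * p.ε / 8) := by
    gcongr
  have e1 : (2 / p.ε) * (p.δ * p.ε / 64) = p.δ / 32 := by field_simp; norm_num
  have e2 : (2 / p.ε) * (p.δ * p.ε / 8) = p.δ / 4 := by field_simp; norm_num
  rw [e1] at h2
  rw [e2] at h3
  -- The failure probability is at most `δ / 32` from the descent plus `δ / 4` from the
  -- memorization.
  linarith

end

/-! ### Correctness of the learner, and growth of its constants. -/

section

/-- The range of most parameters is forced by the data: the nonempty first block gives `1 ≤ N`, and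
`α` dominates an operator norm. -/
theorem learner_learns {X : Type} [Fintype X] {P : X → PMF X} {π : PMF X}
    {lam : Fin (Fintype.card X) → ℝ} {nu : Fin (Fintype.card X) → X → ℝ} {p : Params} {i : ℕ → ℕ}
    {g : Fin p.M → X → ℝ} {F : Set (X → ℤˣ)} {lstar : ℕ} (L : X → PMF ℤˣ) (hε : 0 < p.ε)
    (hδ : 0 < p.δ) (hδ1 : p.δ < 1) (hP : IsLazyReversibleChain P π)
    (hB : IsSpectralBasis P π lam nu) (hS : IsDiscreteSpectrum lam p.N p.k p.γ p.c i)
    (hG : IsUseful π nu p.k i g p.α) (hl : lstar ≤ i p.k)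
    (htail : ∀ f ∈ F, ∑ l with lstar ≤ l.val, ip π (fun x => ((f x : ℤ) : ℝ)) (nu l) ^ 2
      ≤ p.ε ^ 2 / 4) :
    learner.AgnosticallyLearnsWithin
      { n := p.n, next := P, M := p.M, g := g, labelled := labelledLaw π L } F p p.resources := by
  classical
  obtain ⟨h1, -, -, h2, -⟩ := hS.normalized hP hB
  obtain ⟨e, A, -, -, hA⟩ := hG.well_conditioned 0 hS.one_le_k
  exact learner_of_model hS.gamma_pos hS.gamma_lt_one rfl rfl
    (trainModel_accurate
      { one_le_N := hS.one_le_first.trans hS.first_le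
        one_le_blocks := h1
        gamma_pos := hS.gamma_pos
        gamma_lt_one := hS.gamma_lt_one
        expo_nonneg := h2
        alpha_nonneg := (norm_nonneg _).trans hA
        eps_pos := hε
        delta_pos := hδ
        delta_lt_one := hδ1 }
      rfl (labelledLaw_map_fst π L) hP hB hS hG hl htail)

/-! ## Resource bounds -/

namespace Params

theorem Valid.admissible {p : Params} (h : p.Valid) : p.Admissible where
  one_le_N := h.one_le_N
  one_le_blocks := by
    unfold blocks; split_ifs
    · exact le_rfl
    · exact h.one_le_k
  gamma_pos := h.gamma_pos
  gamma_lt_one := h.gamma_lt_one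
  expo_nonneg := by
    unfold expo; split_ifs
    · exact le_rfl
    · exact h.c_nonneg
  alpha_nonneg := zero_le_one.trans h.one_le_alpha
  eps_pos := h.eps_pos
  delta_pos := h.delta_pos
  delta_lt_one := h.delta_lt_one

namespace Admissible

variable {p : Params} (hp : p.Admissible)
include hp

theorem inv_ratio_le : p.ratio⁻¹ ≤ 4 := by
  have h : 1 / 4 ≤ p.ratio := by unfold ratio; split_ifs <;> linarith
  rw [inv_le_comm₀ hp.ratio_pos (by norm_num)]; linarith

theorem inv_one_sub_ratio_le : 1 / (1 - p.ratio) ≤ 1 / (1 - p.γ) + 2 := by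
  have h1 := hp.gamma_lt_one
  have h2 : 0 ≤ 1 / (1 - p.γ) := one_div_nonneg.2 (by linarith)
  unfold ratio; split_ifs
  · have : (1 : ℝ) / (1 - 1 / 4) = 4 / 3 := by norm_num
    linarith
  · linarith

/-- Bernoulli's inequality and `ratio⁻¹ - 1 ≥ 1 - ratio`. It turns bounds for powers of `ratio⁻¹`
into bounds for lengths, at the price of the inverse gap. -/
theorem le_pow_inv_ratio (t : ℕ) : (t : ℝ) ≤ p.ratio⁻¹ ^ t * (1 / (1 - p.ratio)) := by
  have h0 := hp.ratio_pos
  have h1 := hp.ratio_lt_one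
  have h2 : 1 - p.ratio ≤ p.ratio⁻¹ - 1 := by
    rw [le_sub_iff_add_le, ← mul_le_mul_iff_left₀ h0, inv_mul_cancel₀ h0.ne']
    nlinarith [sq_nonneg (1 - p.ratio)]
  have h3 := one_add_mul_sub_le_pow (show -1 ≤ p.ratio⁻¹ by linarith [hp.one_le_inv_ratio]) t
  rw [mul_one_div, le_div_iff₀ (by linarith)]
  have : (t : ℝ) * (1 - p.ratio) ≤ t * (p.ratio⁻¹ - 1) := by gcongr
  linarith

theorem one_le_coeff : (1 : ℝ) ≤ p.N * (1 + p.α) :=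
  one_le_mul_of_one_le_of_one_le hp.one_le_N' (by linarith [hp.alpha_nonneg])

theorem one_lt_precision {B : ℝ} (hB : 1 ≤ B) : 1 < p.precision B := by
  have h : 1 ≤ p.blocks * (p.N * (1 + p.α)) * p.invEps * B :=
    one_le_mul_of_one_le_of_one_le (one_le_mul_of_one_le_of_one_le
      (one_le_mul_of_one_le_of_one_le hp.one_le_blocks' hp.one_le_coeff) hp.one_le_invEps) hB
  have : p.precision B = 8 * (p.blocks * (p.N * (1 + p.α)) * p.invEps * B) := by
    rw [precision]; ring
  linarith

/-- The power just before is below the precision, and one more factor is at most `4`; this is why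
`ratio` is kept above `1/4`. -/
theorem pow_walkLength_le {B : ℝ} (hB : 1 ≤ B) :
    p.ratio⁻¹ ^ p.walkLength B ≤ 4 * p.precision B := by
  have h0 : 0 < p.walkLength B := by
    rw [← lt_walkLength_iff hp.gamma_pos hp.gamma_lt_one, pow_zero]
    exact hp.one_lt_precision hB
  obtain ⟨t, ht⟩ : ∃ t, p.walkLength B = t + 1 := ⟨p.walkLength B - 1, by omega⟩
  have h1 := (lt_walkLength_iff hp.gamma_pos hp.gamma_lt_one (B := B) (i := t)).2 (by omega)
  rw [ht, pow_succ']
  have := hp.inv_ratio_le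
  have := hp.one_le_inv_ratio
  gcongr

theorem pow_lossLength_le {B : ℝ} (hB : 1 ≤ B) :
    p.ratio⁻¹ ^ p.lossLength B ≤ 4 * (4 * p.precision B) ^ p.expo := by
  have h1 := hp.one_le_inv_ratio
  have h0 : 0 < p.ratio⁻¹ := by linarith
  have h2 : (p.lossLength B : ℝ) ≤ p.walkLength B * p.expo + 1 :=
    (Nat.ceil_lt_add_one (mul_nonneg (Nat.cast_nonneg _) hp.expo_nonneg)).le
  calc p.ratio⁻¹ ^ p.lossLength B = p.ratio⁻¹ ^ (p.lossLength B : ℝ) :=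
        (Real.rpow_natCast _ _).symm
    _ ≤ p.ratio⁻¹ ^ (p.walkLength B * p.expo + 1) := Real.rpow_le_rpow_of_exponent_le h1 h2
    _ = (p.ratio⁻¹ ^ p.walkLength B) ^ p.expo * p.ratio⁻¹ := by
      rw [Real.rpow_add h0, Real.rpow_one, Real.rpow_mul h0.le, Real.rpow_natCast]
    _ ≤ (4 * p.precision B) ^ p.expo * 4 := by
      have := hp.one_lt_precision hB
      have := hp.inv_ratio_le
      gcongr
      · exact hp.expo_nonneg
      · exact hp.pow_walkLength_le hB
    _ = _ := mul_comm _ _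

/-- The growth of the coefficient bound in one block. -/
theorem nextBound_le {B : ℝ} (hB : 1 ≤ B) : p.nextBound B ≤
    (32 * p.blocks * p.N * (1 + p.α)) ^ (1 + p.expo) * p.invEps ^ p.expo * B ^ (1 + p.expo) := by
  set D : ℝ := 32 * p.blocks * p.N * (1 + p.α) with hD
  have hb := hp.one_le_blocks'
  have hc := hp.one_le_coeff
  have he := hp.one_le_invEps
  have hD8 : 8 * (p.N * (1 + p.α)) ≤ D := by
    rw [hD]; nlinarith
  have hD0 : 0 < D := by linarith
  have h1 := hp.pow_lossLength_le hB
  have e1 : 4 * p.precision B = D * p.invEps * B := by rw [precision, hD]; ring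
  rw [e1] at h1
  have h2 : 1 ≤ p.ratio⁻¹ ^ p.lossLength B := one_le_pow₀ hp.one_le_inv_ratio
  calc p.nextBound B ≤ B * (2 * (p.N * (1 + p.α) * p.ratio⁻¹ ^ p.lossLength B)) := by
        rw [nextBound]
        gcongr
        nlinarith [one_le_mul_of_one_le_of_one_le hc h2]
    _ ≤ B * (2 * (p.N * (1 + p.α) * (4 * (D * p.invEps * B) ^ p.expo))) := by gcongr
    _ = 8 * (p.N * (1 + p.α)) * (B * (D * p.invEps * B) ^ p.expo) := by ring
    _ ≤ D * (B * (D * p.invEps * B) ^ p.expo) := by gcongr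
    _ = _ := by
      rw [Real.mul_rpow (by positivity) (by positivity), Real.mul_rpow (by positivity) (by positivity),
        Real.rpow_add hD0, Real.rpow_add (by linarith), Real.rpow_one, Real.rpow_one]
      ring

/-- Iterating `B ↦ K * B^(1 + expo)` from `1` makes the exponents of `K` a geometric sum. -/
theorem coeffBound_le (j : ℕ) : p.coeffBound j ≤
    ((32 * p.blocks * p.N * (1 + p.α)) ^ (1 + p.expo) * p.invEps ^ p.expo) ^
      (∑ l ∈ Finset.range j, (1 + p.expo) ^ l) := by
  have hb := hp.one_le_blocks'
  have hc := hp.one_le_coeff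
  have he := hp.one_le_invEps
  have hα := hp.alpha_nonneg
  have hK : 0 < (32 * p.blocks * p.N * (1 + p.α)) ^ (1 + p.expo) * p.invEps ^ p.expo := by
    have := hp.one_le_N'
    positivity
  induction j with
  | zero => simp [coeffBound]
  | succ j ih =>
    have h1 := hp.one_le_coeffBound j
    refine (hp.nextBound_le h1).trans ?_
    have h2 : ∑ l ∈ Finset.range (j + 1), (1 + p.expo) ^ l =
        1 + (∑ l ∈ Finset.range j, (1 + p.expo) ^ l) * (1 + p.expo) := by
      rw [Finset.sum_range_succ', Finset.sum_mul, pow_zero, add_comm]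
      simp only [pow_succ]
    rw [h2, Real.rpow_add hK, Real.rpow_one, Real.rpow_mul hK.le]
    have := hp.expo_nonneg
    gcongr

end Admissible

/-- A bound for all quantities that enter the resource bound. -/
def scale (p : Params) : ℝ :=
  1 + ((p.α * p.N * p.k) ^ ((1 + p.c) ^ (p.k + 1)) + p.ε ^ (-((1 + p.c) ^ p.k)) + p.M + p.n +
    1 / (1 - p.γ) + 1 / p.δ)

namespace Valid

variable {p : Params} (hp : p.Valid)
include hp

theorem one_le_base : 1 ≤ p.α * p.N * p.k := by
  have h1 : (1 : ℝ) ≤ p.N := by exact_mod_cast hp.one_le_N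
  have h2 : (1 : ℝ) ≤ p.k := by exact_mod_cast hp.one_le_k
  exact one_le_mul_of_one_le_of_one_le (one_le_mul_of_one_le_of_one_le hp.one_le_alpha h1) h2

theorem base_le : p.α * p.N * p.k ≤ (p.α * p.N * p.k) ^ ((1 + p.c) ^ (p.k + 1)) :=
  Real.self_le_rpow_of_one_le hp.one_le_base (one_le_pow₀ (by linarith [hp.c_nonneg]))

theorem scale_terms : (0 ≤ (p.α * p.N * p.k) ^ ((1 + p.c) ^ (p.k + 1)) ∧
    0 ≤ p.ε ^ (-((1 + p.c) ^ p.k))) ∧ 0 ≤ 1 / (1 - p.γ) ∧ 0 ≤ 1 / p.δ := by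
  have h0 := hp.one_le_base
  have h1 := hp.eps_pos
  have h2 := hp.gamma_lt_one
  have h3 := hp.delta_pos
  exact ⟨⟨by positivity, by positivity⟩, one_div_nonneg.2 (by linarith), by positivity⟩

theorem le_scale : (p.α * p.N * p.k) ^ ((1 + p.c) ^ (p.k + 1)) ≤ p.scale ∧
    1 + p.ε ^ (-((1 + p.c) ^ p.k)) ≤ p.scale ∧ (p.M : ℝ) ≤ p.scale ∧ (p.n : ℝ) ≤ p.scale ∧
    1 / (1 - p.γ) ≤ p.scale ∧ 1 / p.δ ≤ p.scale ∧ 1 ≤ p.scale := by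
  obtain ⟨⟨h1, h2⟩, h3, h4⟩ := hp.scale_terms
  have h5 : (0 : ℝ) ≤ p.M := Nat.cast_nonneg _
  have h6 : (0 : ℝ) ≤ p.n := Nat.cast_nonneg _
  unfold scale
  refine ⟨?_, ?_, ?_, ?_, ?_, ?_, ?_⟩ <;> linarith

theorem one_le_scale : 1 ≤ p.scale := hp.le_scale.2.2.2.2.2.2

theorem N_le_scale : (p.N : ℝ) ≤ p.scale := by
  refine le_trans ?_ (hp.base_le.trans hp.le_scale.1)
  have h2 : (1 : ℝ) ≤ p.k := by exact_mod_cast hp.one_le_k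
  have := hp.one_le_alpha
  calc (p.N : ℝ) ≤ p.α * p.N := le_mul_of_one_le_left (by positivity) hp.one_le_alpha
    _ ≤ _ := le_mul_of_one_le_right (by positivity) h2

theorem k_le_scale : (p.k : ℝ) ≤ p.scale := by
  refine le_trans ?_ (hp.base_le.trans hp.le_scale.1)
  have h1 : (1 : ℝ) ≤ p.N := by exact_mod_cast hp.one_le_N
  exact le_mul_of_one_le_left (by positivity)
    (one_le_mul_of_one_le_of_one_le hp.one_le_alpha h1)

theorem alpha_le_scale : p.α ≤ p.scale := by
  refine le_trans ?_ (hp.base_le.trans hp.le_scale.1)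
  have h1 : (1 : ℝ) ≤ p.N := by exact_mod_cast hp.one_le_N
  have h2 : (1 : ℝ) ≤ p.k := by exact_mod_cast hp.one_le_k
  have := hp.one_le_alpha
  calc p.α ≤ p.α * p.N := le_mul_of_one_le_right (by positivity) h1
    _ ≤ _ := le_mul_of_one_le_right (by positivity) h2

theorem blocks_le_scale : (p.blocks : ℝ) ≤ p.scale := by
  unfold blocks; split_ifs
  · simpa using hp.one_le_scale
  · exact hp.k_le_scale

/-- Since `invEps` is at most twice the larger of `1` and `1 / ε`, the only loss is `2 ^ a`, which a
base of at least `2` absorbs later. -/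
theorem invEps_rpow_le {a : ℝ} (ha : 0 ≤ a) : p.invEps ^ a ≤ 2 ^ a * (1 + p.ε ^ (-a)) := by
  have hε := hp.eps_pos
  have h1 : p.invEps ≤ 2 * max 1 (1 / p.ε) := by
    rw [invEps, two_mul]
    exact add_le_add (le_max_left _ _) (le_max_right _ _)
  calc p.invEps ^ a ≤ (2 * max 1 (1 / p.ε)) ^ a :=
        Real.rpow_le_rpow (zero_le_one.trans hp.admissible.one_le_invEps) h1 ha
    _ = 2 ^ a * max 1 (1 / p.ε) ^ a := Real.mul_rpow (by norm_num) (by positivity)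
    _ ≤ _ := by
      gcongr
      have h2 : (1 / p.ε) ^ a = p.ε ^ (-a) := by
        rw [one_div, Real.inv_rpow hε.le, Real.rpow_neg hε.le]
      rcases le_total 1 (1 / p.ε) with h | h
      · rw [max_eq_right h, h2]; linarith
      · rw [max_eq_left h, Real.one_rpow]
        have : 0 ≤ p.ε ^ (-a) := by positivity
        linarith

theorem invEps_le_scale : p.invEps ≤ 2 * p.scale := by
  have hε := hp.eps_pos
  have h1 := hp.le_scale.2.1
  have ha : (1 : ℝ) ≤ (1 + p.c) ^ p.k := one_le_pow₀ (by linarith [hp.c_nonneg])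
  have h0 := hp.scale_terms.1.2
  rw [invEps]
  rcases le_total 1 p.ε with h | h
  · have : 1 / p.ε ≤ 1 := by rw [div_le_one hε]; exact h
    linarith
  · have : 1 / p.ε ≤ p.ε ^ (-((1 + p.c) ^ p.k)) := by
      rw [one_div, ← Real.rpow_neg_one]
      exact Real.rpow_le_rpow_of_exponent_ge hε h (by linarith)
    linarith

/-- For `expo < 1` there is a single block, and the exponents are below `2`. Otherwise `c ≥ 1`, and
the geometric sum `σ` satisfies `σ ≤ c σ ≤ (1 + c)^k`, which gives the exponents of the theorem. For
small `c` the sum could be as large as `k`, and for `α N k = 1` the numerical constants could not be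
absorbed; the definitions of `blocks` and `expo` exclude both. -/
theorem coeffBound_le_scale : p.coeffBound p.blocks ≤ 2 ^ 15 * p.scale ^ 9 := by
  have hadm := hp.admissible
  have h1 := hadm.coeffBound_le p.blocks
  have hV := hp.one_le_scale
  have hE := hadm.one_le_invEps
  have hN := hadm.one_le_N'
  have hb := hadm.one_le_blocks'
  have hα := hp.one_le_alpha
  refine h1.trans ?_
  set D : ℝ := 32 * p.blocks * p.N * (1 + p.α) with hDdef
  have hD1 : 1 ≤ D := by
    have : 1 ≤ (p.blocks : ℝ) * (p.N * (1 + p.α)) :=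
      one_le_mul_of_one_le_of_one_le hb hadm.one_le_coeff
    rw [hDdef]; nlinarith
  by_cases he : p.expo < 1
  · have hb1 : p.blocks = 1 := by rw [blocks, if_pos he]
    rw [hb1, Finset.sum_range_one, pow_zero, Real.rpow_one]
    have hD : D ≤ 64 * p.scale ^ 2 := by
      have h2 := hp.N_le_scale
      have h3 := hp.alpha_le_scale
      rw [hDdef, hb1]
      have : (p.N : ℝ) * (1 + p.α) ≤ p.scale * (2 * p.scale) := by
        gcongr; linarith
      push_cast
      nlinarith
    have h2 : D ^ (1 + p.expo) ≤ D ^ 2 := by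
      rw [← Real.rpow_natCast]
      exact Real.rpow_le_rpow_of_exponent_le hD1 (by push_cast; linarith)
    have h3 : p.invEps ^ p.expo ≤ p.invEps := by
      conv_rhs => rw [← Real.rpow_one p.invEps]
      exact Real.rpow_le_rpow_of_exponent_le hE he.le
    calc _ ≤ D ^ 2 * p.invEps := by gcongr
      _ ≤ (64 * p.scale ^ 2) ^ 2 * (2 * p.scale) := by
        gcongr
        exact hp.invEps_le_scale
      _ = 2 ^ 13 * p.scale ^ 5 := by ring
      _ ≤ 2 ^ 15 * p.scale ^ 9 := by gcongr <;> norm_num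
  · have hNk : ¬p.N + p.k < 3 := by
      intro h; rw [expo, if_pos h] at he; norm_num at he
    have hc : p.expo = p.c := by rw [expo, if_neg hNk]
    have hbk : p.blocks = p.k := by rw [blocks, if_neg he]
    rw [hc] at he ⊢
    have hc1 : 1 ≤ p.c := not_lt.1 he
    -- `N + k ≥ 3` gives `N * k ≥ 2`; six further factors of the base then absorb the constant `2 ^
    -- 6` in `D`.
    have hbase : 2 ≤ p.α * p.N * p.k := by
      have h2 : 2 ≤ p.N * p.k := by
        have := hp.one_le_N; have := hp.one_le_k
        nlinarith [Nat.mul_le_mul this hp.one_le_k, (show 3 ≤ p.N + p.k by omega)]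
      have h3 : (2 : ℝ) ≤ p.N * p.k := by exact_mod_cast h2
      rw [mul_assoc]; nlinarith
    set σ := ∑ l ∈ Finset.range p.blocks, (1 + p.c) ^ l with hσ
    have hgeom : p.c * σ = (1 + p.c) ^ p.k - 1 := by
      have := mul_geom_sum (1 + p.c) p.k
      rw [add_sub_cancel_left] at this
      rw [hσ, hbk, this]
    have hσ0 : 0 ≤ σ := Finset.sum_nonneg fun l _ => by positivity
    have hpow : 1 ≤ (1 + p.c) ^ p.k := one_le_pow₀ (by linarith)
    have hσ1 : (1 + p.c) * σ ≤ (1 + p.c) ^ (p.k + 1) := by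
      rw [pow_succ']
      gcongr
      nlinarith
    have hσ2 : p.c * σ ≤ (1 + p.c) ^ p.k := by linarith
    have hDle : D ≤ (p.α * p.N * p.k) ^ 7 := by
      calc D ≤ 2 ^ 6 * (p.α * p.N * p.k) := by
            rw [hDdef, hbk]
            have : (p.k : ℝ) * p.N * (1 + p.α) ≤ p.k * p.N * (2 * p.α) := by
              gcongr; linarith
            nlinarith
        _ ≤ (p.α * p.N * p.k) ^ 6 * (p.α * p.N * p.k) := by gcongr
        _ = _ := by ring
    set x := (p.α * p.N * p.k) ^ ((1 + p.c) ^ (p.k + 1)) with hx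
    have hxV : x ≤ p.scale := hp.le_scale.1
    have hx0 : 0 ≤ x := hp.scale_terms.1.1
    have h2 : D ^ ((1 + p.c) * σ) ≤ x ^ 7 := by
      calc D ^ ((1 + p.c) * σ) ≤ D ^ ((1 + p.c) ^ (p.k + 1)) :=
            Real.rpow_le_rpow_of_exponent_le hD1 hσ1
        _ ≤ ((p.α * p.N * p.k) ^ 7) ^ ((1 + p.c) ^ (p.k + 1)) := by gcongr
        _ = _ := (Real.rpow_pow_comm (by positivity) _ _).symm
    have h3 : p.invEps ^ (p.c * σ) ≤ p.scale * p.scale := by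
      calc p.invEps ^ (p.c * σ) ≤ p.invEps ^ ((1 + p.c) ^ p.k) :=
            Real.rpow_le_rpow_of_exponent_le hE hσ2
        _ ≤ 2 ^ ((1 + p.c) ^ p.k) * (1 + p.ε ^ (-((1 + p.c) ^ p.k))) :=
            hp.invEps_rpow_le (by positivity)
        _ ≤ p.scale * p.scale := by
          have := hp.scale_terms.1.2
          gcongr
          · refine le_trans ?_ hxV
            calc (2 : ℝ) ^ ((1 + p.c) ^ p.k) ≤ (p.α * p.N * p.k) ^ ((1 + p.c) ^ p.k) := by gcongr
              _ ≤ x := Real.rpow_le_rpow_of_exponent_le (by linarith)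
                (pow_le_pow_right₀ (by linarith) (Nat.le_succ _))
          · exact hp.le_scale.2.1
    rw [Real.mul_rpow (by positivity) (by positivity), ← Real.rpow_mul (by positivity),
      ← Real.rpow_mul (by positivity)]
    calc _ ≤ x ^ 7 * (p.scale * p.scale) := by gcongr
      _ ≤ p.scale ^ 7 * (p.scale * p.scale) := by gcongr
      _ = 1 * p.scale ^ 9 := by ring
      _ ≤ _ := by gcongr; norm_num

end Valid

end Params

end

/-! ### Polynomial bounds in the scale. -/

section

/-- Nonnegative quantities that are bounded by a polynomial in the scale. -/
def PolyBounded (f : Params → ℝ) : Prop :=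
  (∀ p : Params, p.Valid → 0 ≤ f p) ∧
    ∃ C D : ℕ, ∀ p : Params, p.Valid → f p ≤ C * p.scale ^ D

namespace PolyBounded

variable {f g : Params → ℝ}

theorem of_le (hg : PolyBounded g) (h0 : ∀ p : Params, p.Valid → 0 ≤ f p)
    (h : ∀ p : Params, p.Valid → f p ≤ g p) : PolyBounded f := by
  obtain ⟨-, C, D, hC⟩ := hg
  exact ⟨h0, C, D, fun p hp => (h p hp).trans (hC p hp)⟩

theorem scale : PolyBounded Params.scale :=
  ⟨fun p hp => zero_le_one.trans hp.one_le_scale, 1, 1, fun p _ => by simp⟩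

theorem const (a : ℕ) : PolyBounded fun _ => (a : ℝ) :=
  ⟨fun _ _ => Nat.cast_nonneg a, a, 0, fun _ _ => by simp⟩

theorem add (hf : PolyBounded f) (hg : PolyBounded g) : PolyBounded fun p => f p + g p := by
  obtain ⟨f0, C, D, hC⟩ := hf
  obtain ⟨g0, C', D', hC'⟩ := hg
  refine ⟨fun p hp => add_nonneg (f0 p hp) (g0 p hp), C + C', D + D', fun p hp => ?_⟩
  have hV := hp.one_le_scale
  calc f p + g p ≤ C * p.scale ^ D + C' * p.scale ^ D' := add_le_add (hC p hp) (hC' p hp)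
    _ ≤ C * p.scale ^ (D + D') + C' * p.scale ^ (D + D') := by
      gcongr <;> first | exact hV | omega
    _ = _ := by push_cast; ring

theorem mul (hf : PolyBounded f) (hg : PolyBounded g) : PolyBounded fun p => f p * g p := by
  obtain ⟨f0, C, D, hC⟩ := hf
  obtain ⟨g0, C', D', hC'⟩ := hg
  refine ⟨fun p hp => mul_nonneg (f0 p hp) (g0 p hp), C * C', D + D', fun p hp => ?_⟩
  calc f p * g p ≤ (C * p.scale ^ D) * (C' * p.scale ^ D') :=
        mul_le_mul (hC p hp) (hC' p hp) (g0 p hp) ((f0 p hp).trans (hC p hp))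
    _ = _ := by push_cast; ring

theorem pow (hf : PolyBounded f) (n : ℕ) : PolyBounded fun p => f p ^ n := by
  induction n with
  | zero => simpa using const 1
  | succ n ih => simp only [pow_succ]; exact ih.mul hf

theorem ceil (hf : PolyBounded f) : PolyBounded fun p => (⌈f p⌉₊ : ℝ) :=
  (hf.add (const 1)).of_le (fun _ _ => Nat.cast_nonneg _) fun p hp => by
    push_cast; exact (Nat.ceil_lt_add_one (hf.1 p hp)).le

theorem natCast_add {f g : Params → ℕ} (hf : PolyBounded fun p => (f p : ℝ))
    (hg : PolyBounded fun p => (g p : ℝ)) : PolyBounded fun p => ((f p + g p : ℕ) : ℝ) := by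
  simpa using hf.add hg

theorem natCast_mul {f g : Params → ℕ} (hf : PolyBounded fun p => (f p : ℝ))
    (hg : PolyBounded fun p => (g p : ℝ)) : PolyBounded fun p => ((f p * g p : ℕ) : ℝ) := by
  simpa using hf.mul hg

theorem n : PolyBounded fun p => (p.n : ℝ) :=
  scale.of_le (fun _ _ => Nat.cast_nonneg _) fun _ hp => hp.le_scale.2.2.2.1

theorem M : PolyBounded fun p => (p.M : ℝ) :=
  scale.of_le (fun _ _ => Nat.cast_nonneg _) fun _ hp => hp.le_scale.2.2.1

theorem N : PolyBounded fun p => (p.N : ℝ) :=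
  scale.of_le (fun _ _ => Nat.cast_nonneg _) fun _ hp => hp.N_le_scale

theorem alpha : PolyBounded fun p => p.α :=
  scale.of_le (fun _ hp => zero_le_one.trans hp.one_le_alpha) fun _ hp => hp.alpha_le_scale

theorem blocks : PolyBounded fun p => (p.blocks : ℝ) :=
  scale.of_le (fun _ _ => Nat.cast_nonneg _) fun _ hp => hp.blocks_le_scale

theorem inv_delta : PolyBounded fun p => 1 / p.δ :=
  scale.of_le (fun _ hp => hp.scale_terms.2.2) fun _ hp => hp.le_scale.2.2.2.2.2.1

theorem invEps : PolyBounded Params.invEps :=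
  ((const 2).mul scale).of_le (fun _ hp => zero_le_one.trans hp.admissible.one_le_invEps)
    fun _ hp => hp.invEps_le_scale

theorem inv_gap : PolyBounded fun p => 1 / (1 - p.ratio) :=
  (scale.add (const 2)).of_le
    (fun _ hp => one_div_nonneg.2 (by linarith [hp.admissible.ratio_lt_one])) fun p hp => by
      have := hp.admissible.inv_one_sub_ratio_le
      have := hp.le_scale.2.2.2.2.1
      push_cast; linarith

theorem coeffBound : PolyBounded fun p => p.coeffBound p.blocks :=
  ((const (2 ^ 15)).mul (scale.pow 9)).of_le
    (fun p hp => zero_le_one.trans (hp.admissible.one_le_coeffBound _)) fun p hp => by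
      exact hp.coeffBound_le_scale.trans_eq (by norm_num)

/-- Up to the inverse gap, a walk length is at most the power of `ratio⁻¹` that it produces, hence
polynomial in the precision. -/
theorem walkLength : PolyBounded fun p => (p.walkLength (p.coeffBound p.blocks) : ℝ) := by
  have h : PolyBounded fun p => p.precision (p.coeffBound p.blocks) :=
    (((((const 8).mul blocks).mul N).mul ((const 1).add alpha)).mul invEps).mul coeffBound |>.of_le
      (fun p hp => zero_le_one.trans
        (hp.admissible.one_lt_precision (hp.admissible.one_le_coeffBound _)).le)
      fun p _ => by simp [Params.precision]
  refine (((const 4).mul h).mul inv_gap).of_le (fun _ _ => Nat.cast_nonneg _) fun p hp => ?_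
  have hp' := hp.admissible
  refine (hp'.le_pow_inv_ratio _).trans ?_
  have := hp'.pow_walkLength_le (hp'.one_le_coeffBound p.blocks)
  have : 0 ≤ 1 / (1 - p.ratio) := one_div_nonneg.2 (by linarith [hp'.ratio_lt_one])
  push_cast
  gcongr

theorem lastLength : PolyBounded fun p => (p.lastLength p.blocks : ℝ) := by
  refine walkLength.of_le (fun _ _ => Nat.cast_nonneg _) fun p hp => ?_
  have hp' := hp.admissible
  obtain ⟨b, hb⟩ : ∃ b, p.blocks = b + 1 := ⟨p.blocks - 1, by have := hp'.one_le_blocks; omega⟩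
  rw [hb, Params.lastLength]
  exact_mod_cast hp'.walkLength_mono (hp'.coeffBound_mono (Nat.le_succ b))

/-- The loss length is controlled through its power of `ratio⁻¹`, which is a factor in the next
coefficient bound; thus no separate bound for `expo` is needed. -/
theorem searchBound : PolyBounded fun p => (p.searchBound : ℝ) := by
  refine (blocks.mul (walkLength.add (coeffBound.mul inv_gap))).of_le
    (fun _ _ => Nat.cast_nonneg _) fun p hp => ?_
  have hp' := hp.admissible
  rw [Params.searchBound, Nat.cast_sum, ← nsmul_eq_mul]
  refine (Finset.sum_le_card_nsmul _ _ _ fun j hj => ?_).trans_eq (by rw [Finset.card_range])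
  rw [Finset.mem_range] at hj
  push_cast
  refine add_le_add ?_ ?_
  · exact_mod_cast hp'.walkLength_mono (hp'.coeffBound_mono hj.le)
  · refine (hp'.le_pow_inv_ratio _).trans ?_
    have : 0 ≤ 1 / (1 - p.ratio) := one_div_nonneg.2 (by linarith [hp'.ratio_lt_one])
    refine mul_le_mul_of_nonneg_right ?_ this
    have h1 := hp'.one_le_coeffBound j
    have h2 := hp'.one_le_inv_ratio
    have h3 : p.ratio⁻¹ ^ p.lossLength (p.coeffBound j) ≤ p.coeffBound (j + 1) := by
      show _ ≤ p.nextBound _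
      rw [Params.nextBound]
      have h4 : 0 ≤ p.ratio⁻¹ ^ p.lossLength (p.coeffBound j) := by positivity
      have h5 : p.ratio⁻¹ ^ p.lossLength (p.coeffBound j) ≤
          p.N * (1 + p.α) * p.ratio⁻¹ ^ p.lossLength (p.coeffBound j) :=
        le_mul_of_one_le_left h4 hp'.one_le_coeff
      nlinarith
    exact h3.trans (hp'.coeffBound_mono hj)

theorem size : PolyBounded fun p => (p.size : ℝ) := by
  have h : PolyBounded fun p => 32 * p.N * p.invEps / p.δ :=
    ((((const 32).mul N).mul invEps).mul inv_delta).of_le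
      (fun _ hp => hp.admissible.size_terms_nonneg) fun p _ => by
        push_cast; rw [mul_one_div]
  exact ((coeffBound.add lastLength).add h).ceil

theorem dim : PolyBounded fun p => (p.dim : ℝ) :=
  natCast_add size (natCast_mul M (natCast_add size (const 1)))

theorem root : PolyBounded fun p => (p.root : ℝ) := by
  have h : PolyBounded fun p => 64 * p.dim * p.size * p.invEps / p.δ :=
    (((((const 64).mul dim).mul size).mul invEps).mul inv_delta).of_le
      (fun p hp => by
        have := hp.delta_pos
        have := hp.admissible.one_le_invEps
        positivity) fun p _ => by
        push_cast; rw [mul_one_div]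
  exact h.ceil

theorem rounds : PolyBounded fun p => (p.rounds : ℝ) := natCast_mul root root

theorem featTime : PolyBounded fun p => (SpectralLearning.featTime p.n p.M p.size p.dim p.rounds : ℝ) := by
  unfold SpectralLearning.featTime
  have hn := fun a : ℕ => natCast_add n (const a)
  exact natCast_add (natCast_add (natCast_mul dim (hn 40)) (natCast_mul rounds (natCast_add
    (natCast_add (natCast_mul (natCast_add size (const 1)) (natCast_add
      (natCast_add (natCast_mul M (hn 44)) n) (const 50))) n) (const 70)))) (const 40)

theorem resources : PolyBounded fun p => (p.resources : ℝ) := by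
  have h1 : PolyBounded fun p => (p.setupTime : ℝ) :=
    natCast_add (natCast_add
      (natCast_mul blocks (natCast_add (natCast_mul searchBound (const 50)) (const 200)))
      (natCast_mul (natCast_add (natCast_add (natCast_add size dim) root) rounds) (const 50)))
      (const 400)
  have h2 : PolyBounded fun p => (descentTime p.n p.M p.size p.dim p.rounds : ℝ) :=
    natCast_add (natCast_mul rounds (natCast_add
      (natCast_add (natCast_add featTime (natCast_mul dim (const 230))) n) (const 100))) (const 20)
  have h3 : PolyBounded fun p => (evalTime p.n p.M p.size p.dim p.rounds : ℝ) :=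
    natCast_add (natCast_add (natCast_add featTime (natCast_mul dim (const 40)))
      (natCast_mul size (const 30))) (const 90)
  have h4 : PolyBounded fun p => (p.trainTime : ℝ) :=
    natCast_add (natCast_add h1 (natCast_add (natCast_add (natCast_add
      (natCast_mul size (natCast_add n (const 20))) (const 20)) h2) (const 1))) (const 1)
  exact natCast_add h4 h3

end PolyBounded

/-- A polynomial that bounds `K * u ^ D` where `u - 1` is the sum of the variables. -/
theorem exists_polynomial {s : ℕ} (K : ℝ) (D : ℕ) : ∃ q : MvPolynomial (Fin s) ℝ,
    ∀ x : Fin s → ℝ, MvPolynomial.eval x q = K * (1 + ∑ j, x j) ^ D :=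
  ⟨MvPolynomial.C K * (1 + ∑ j, MvPolynomial.X j) ^ D, fun x => by simp⟩

/-- Bounds on the scale by powers carry over to the resources. -/
theorem exists_resources_le (K : ℝ) (E : ℕ) : ∃ (K' : ℝ) (E' : ℕ), ∀ (p : Params) (u : ℝ),
    p.Valid → p.scale ≤ K * u ^ E → (p.resources : ℝ) ≤ K' * u ^ E' := by
  obtain ⟨-, C, D, h⟩ := PolyBounded.resources
  refine ⟨C * K ^ D, E * D, fun p u hp hu => (h p hp).trans ?_⟩
  have := hp.one_le_scale
  calc (C : ℝ) * p.scale ^ D ≤ C * (K * u ^ E) ^ D := by gcongr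
    _ = _ := by rw [mul_pow, ← pow_mul, mul_assoc]

/-- `α N k ≤ (N k)^(a+1)`, and a fixed natural power commutes with the varying real exponent, so
only the degree of the bound changes. -/
theorem scale_le_of_alpha_le {p : Params} (hp : p.Valid) {a b : ℕ}
    (hα : p.α ≤ ((p.N : ℝ) * p.k) ^ a) (hγ : 1 / (1 - p.γ) ≤ b * (p.n : ℝ) ^ b) {u : ℝ}
    (hu : u = 1 + (((p.N : ℝ) * p.k) ^ ((1 + p.c) ^ (p.k + 1)) + p.ε ^ (-((1 + p.c) ^ p.k)) +
      p.M + p.n + 1 / p.δ)) : p.scale ≤ (6 + b) * u ^ (a + b + 1) := by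
  have h1 : (1 : ℝ) ≤ p.N := by exact_mod_cast hp.one_le_N
  have h2 : (1 : ℝ) ≤ p.k := by exact_mod_cast hp.one_le_k
  have hα1 := hp.one_le_alpha
  have hc := hp.c_nonneg
  obtain ⟨⟨t1, t2⟩, t3, t4⟩ := hp.scale_terms
  have t5 : (0 : ℝ) ≤ p.M := Nat.cast_nonneg _
  have t6 : (0 : ℝ) ≤ p.n := Nat.cast_nonneg _
  set y := ((p.N : ℝ) * p.k) ^ ((1 + p.c) ^ (p.k + 1)) with hy
  have hy0 : 0 ≤ y := by positivity
  have hu1 : 1 ≤ u := by linarith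
  have hx : (p.α * p.N * p.k) ^ ((1 + p.c) ^ (p.k + 1)) ≤ u ^ (a + b + 1) := by
    calc (p.α * p.N * p.k) ^ ((1 + p.c) ^ (p.k + 1))
        ≤ (((p.N : ℝ) * p.k) ^ (a + 1)) ^ ((1 + p.c) ^ (p.k + 1)) := by
          refine Real.rpow_le_rpow (by positivity) ?_ (by positivity)
          rw [pow_succ, mul_assoc]; gcongr
      _ = y ^ (a + 1) := (Real.rpow_pow_comm (by positivity) _ _).symm
      _ ≤ u ^ (a + 1) := by gcongr; linarith
      _ ≤ u ^ (a + b + 1) := pow_le_pow_right₀ hu1 (by omega)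
  have hn : b * (p.n : ℝ) ^ b ≤ b * u ^ (a + b + 1) := by
    calc b * (p.n : ℝ) ^ b ≤ b * u ^ b := by gcongr; linarith
      _ ≤ _ := by
        gcongr ?_ * ?_
        exact pow_le_pow_right₀ hu1 (by omega)
  have hu2 : u ≤ u ^ (a + b + 1) := le_self_pow₀ hu1 (by omega)
  rw [Params.scale]
  linarith

/-- A single integer `m` bounds the real exponent as well as the growth of `N`, so the first term of
the scale becomes a constant times a fixed power of `n`. -/
theorem scale_le_of_const {p : Params} (hp : p.Valid) {a b m : ℕ}
    (hm : (1 + p.c) ^ (p.k + 1) ≤ m) (hN : p.N ≤ p.n ^ m) (hα : p.α ≤ a * (p.n : ℝ) ^ a)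
    (hγ : 1 / (1 - p.γ) ≤ b * (p.n : ℝ) ^ b) {u : ℝ} (hu : u = 1 + (p.M + p.n + 1 / p.δ)) :
    p.scale ≤ (4 + ((a : ℝ) * p.k) ^ m + p.ε ^ (-((1 + p.c) ^ p.k)) + b) *
      u ^ ((a + m) * m + b + 1) := by
  obtain ⟨⟨t1, t2⟩, t3, t4⟩ := hp.scale_terms
  have t5 : (0 : ℝ) ≤ p.M := Nat.cast_nonneg _
  have t6 : (0 : ℝ) ≤ p.n := Nat.cast_nonneg _
  have hα1 := hp.one_le_alpha
  have hu1 : 1 ≤ u := by linarith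
  have hx : (p.α * p.N * p.k) ^ ((1 + p.c) ^ (p.k + 1)) ≤
      ((a : ℝ) * p.k) ^ m * u ^ ((a + m) * m + b + 1) := by
    have hN' : (p.N : ℝ) ≤ (p.n : ℝ) ^ m := by exact_mod_cast hN
    calc (p.α * p.N * p.k) ^ ((1 + p.c) ^ (p.k + 1)) ≤ (p.α * p.N * p.k) ^ (m : ℝ) :=
          Real.rpow_le_rpow_of_exponent_le hp.one_le_base hm
      _ = (p.α * p.N * p.k) ^ m := Real.rpow_natCast _ _
      _ ≤ (a * (p.n : ℝ) ^ a * (p.n : ℝ) ^ m * p.k) ^ m := by gcongr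
      _ = (a * p.k) ^ m * (p.n : ℝ) ^ ((a + m) * m) := by
        rw [pow_mul, ← mul_pow, pow_add]; ring
      _ ≤ (a * p.k) ^ m * u ^ ((a + m) * m) := by gcongr; linarith
      _ ≤ _ := by
        gcongr ?_ * ?_
        exact pow_le_pow_right₀ hu1 (by omega)
  have hn : b * (p.n : ℝ) ^ b ≤ b * u ^ ((a + m) * m + b + 1) := by
    calc b * (p.n : ℝ) ^ b ≤ b * u ^ b := by gcongr; linarith
      _ ≤ _ := by
        gcongr ?_ * ?_
        exact pow_le_pow_right₀ hu1 (by omega)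
  have hu2 : u ≤ u ^ ((a + m) * m + b + 1) := le_self_pow₀ hu1 (by omega)
  have hu3 : p.ε ^ (-((1 + p.c) ^ p.k)) ≤
      p.ε ^ (-((1 + p.c) ^ p.k)) * u ^ ((a + m) * m + b + 1) :=
    le_mul_of_one_le_right t2 (hu1.trans hu2)
  rw [Params.scale]
  linarith

end

end

end SpectralLearning

theorem theorem2 :
    ∃ (A : LearningAlgorithm) (T : Params → ℕ),
      -- the algorithm learns, with all resources bounded by `T`
      (∀ (p : Params), 0 < p.ε → 0 < p.δ → p.δ < 1 →
        ∀ (Alphabet : Type) (_ : Finite Alphabet) (X : Type) (_ : Fintype X)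
          (_ : X ↪ (Fin p.n → Alphabet))
          (P : X → PMF X) (π : PMF X)
          (lam : Fin (Fintype.card X) → ℝ) (nu : Fin (Fintype.card X) → X → ℝ)
          (i : ℕ → ℕ) (g : Fin p.M → X → ℝ) (F : Set (X → ℤˣ)) (lstar : ℕ)
          (L : X → PMF ℤˣ),
          IsLazyReversibleChain P π →
          IsSpectralBasis P π lam nu →
          IsDiscreteSpectrum lam p.N p.k p.γ p.c i →
          IsUseful π nu p.k i g p.α →
          lstar ≤ i p.k →
          (∀ f ∈ F, ∑ l with lstar ≤ l.val, ip π (fun x => (((f x : ℤˣ) : ℤ) : ℝ)) (nu l) ^ 2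
            ≤ p.ε ^ 2 / 4) →
          A.AgnosticallyLearnsWithin
            { n := p.n, next := P, M := p.M, g := g, labelled := labelledLaw π L } F p (T p)) ∧
      -- polynomial bound with explicit dependence on all parameters
      (∃ q : MvPolynomial (Fin 6) ℝ, ∀ p : Params, p.Valid →
        (T p : ℝ) ≤ MvPolynomial.eval
          ![(p.α * p.N * p.k) ^ ((1 + p.c) ^ (p.k + 1)), p.ε ^ (-((1 + p.c) ^ p.k)),
            (p.M : ℝ), (p.n : ℝ), 1 / (1 - p.γ), 1 / p.δ] q) ∧
      -- the bound when `α` is polynomial in `N k` and the gap is inverse polynomial in `n`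
      (∀ a b : ℕ, ∃ q : MvPolynomial (Fin 5) ℝ, ∀ p : Params, p.Valid →
        p.α ≤ ((p.N : ℝ) * p.k) ^ a → 1 / (1 - p.γ) ≤ b * (p.n : ℝ) ^ b →
        (T p : ℝ) ≤ MvPolynomial.eval
          ![((p.N : ℝ) * p.k) ^ ((1 + p.c) ^ (p.k + 1)), p.ε ^ (-((1 + p.c) ^ p.k)),
            (p.M : ℝ), (p.n : ℝ), 1 / p.δ] q) ∧
      -- polynomial time for constant `ε`, `k`, `c` and `N ≤ n ^ ζ(k)`
      (∀ (ε c : ℝ) (k : ℕ) (ζ : ℕ → ℕ) (a b : ℕ), ∃ q : MvPolynomial (Fin 3) ℝ,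
        ∀ p : Params, p.Valid → p.ε = ε → p.c = c → p.k = k → p.N ≤ p.n ^ ζ k →
        p.α ≤ a * (p.n : ℝ) ^ a → 1 / (1 - p.γ) ≤ b * (p.n : ℝ) ^ b →
        (T p : ℝ) ≤ MvPolynomial.eval ![(p.M : ℝ), (p.n : ℝ), 1 / p.δ] q) := by
  refine ⟨learner, Params.resources, ?_, ?_, ?_, ?_⟩
  · intro p hε hδ hδ1 _ _ X _ _ P π lam nu i g F lstar L hP hB hS hG hl htail
    exact learner_learns L hε hδ hδ1 hP hB hS hG hl htail
  · obtain ⟨-, C, D, h⟩ := PolyBounded.resources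
    obtain ⟨q, hq⟩ := exists_polynomial (s := 6) C D
    refine ⟨q, fun p hp => (h p hp).trans_eq ?_⟩
    rw [hq, Params.scale]
    simp [Fin.sum_univ_six]
  · intro a b
    obtain ⟨K, E, h⟩ := exists_resources_le (6 + b) (a + b + 1)
    obtain ⟨q, hq⟩ := exists_polynomial (s := 5) K E
    refine ⟨q, fun p hp hα hγ => ?_⟩
    rw [hq]
    refine h p _ hp (scale_le_of_alpha_le hp hα hγ ?_)
    simp [Fin.sum_univ_five]
  · intro ε c k ζ a b
    -- One summand for each role of `m` in `scale_le_of_const`.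
    set m := ⌈(1 + c) ^ (k + 1)⌉₊ + ζ k with hm
    obtain ⟨K, E, h⟩ := exists_resources_le
      (4 + ((a : ℝ) * k) ^ m + ε ^ (-((1 + c) ^ k)) + b) ((a + m) * m + b + 1)
    obtain ⟨q, hq⟩ := exists_polynomial (s := 3) K E
    refine ⟨q, fun p hp hpε hpc hpk hN hα hγ => ?_⟩
    rw [hq]
    refine h p _ hp ?_
    subst hpε hpc hpk
    refine scale_le_of_const hp ?_ ?_ hα hγ ?_
    · rw [hm]; push_cast
      exact (Nat.le_ceil _).trans (le_add_of_nonneg_right (Nat.cast_nonneg _))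
    · refine hN.trans ?_
      have h1 : 0 < 1 / (1 - p.γ) := one_div_pos.2 (by linarith [hp.gamma_lt_one])
      -- Raising the exponent from `ζ k` to `m` requires `n ≥ 1`. For `n = 0` the bound `b * n ^ b`
      -- would be `0` for every `b`, including `b = 0`, although it exceeds a positive number.
      have h0 : 0 < p.n := by
        refine Nat.pos_of_ne_zero fun h0 => ?_
        rw [h0] at hγ
        rcases Nat.eq_zero_or_pos b with rfl | hb
        · norm_num at hγ h1; linarith
        · rw [Nat.cast_zero, zero_pow hb.ne', mul_zero] at hγ; linarith
      exact Nat.pow_le_pow_right h0 (Nat.le_add_left _ _)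
    · simp [Fin.sum_univ_three]
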